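/- For a representation $(G,V)$ of a compact Lie group and $v\in V$ let $G_v$ be the isotropy group. Call $G_v$ a principal isotropy group if its conjugacy class is the least one, i.e. every isotropy group $G_w$, $w\in V$, contains a conjugate of $G_v$. Let $H=G_v$ be a principal isotropy group and $H^0$ its identity component; "$H^0=K$" means that $H^0$ is isomorphic to $K$ as a topological (equivalently Lie) group, and $\mathrm{SO}(k),\mathrm{U}(k),\mathrm{Sp}(k)$ are trivial for $k\le 0$. Here $\mathrm{Sp}(1)\mathrm{Sp}(n)=(\mathrm{Sp}(1)\times\mathrm{Sp}(n))/\{\pm(1,1)\}$ acts on $\mathbb R^{4n}=\mathbb H^n$ by $x\mapsto gx\bar q$, and $\mathrm{U}(1)\mathrm{Sp}(n)=(\mathrm{U}(1)\times\mathrm{Sp}(n))/\{\pm(1,1)\}$ acts on $\mathbb C^{2n}=\mathbb H^n$ (complex structure by right multiplication) by $x\mapsto gxz$; all other factors act in the standard way. Let $m,n\geq 1$ be integers. Then: 1. For $(\mathrm{SO}(m)\times\mathrm{U}(n),\ \mathbb R^m\otimes_{\mathbb R}\mathbb C^n)$: $H^0=\mathrm{SO}(m-2n)$ if $m>2n+1$;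 $H^0=\mathrm{U}(n-m)$ if $n>m$; otherwise $H^0$ is trivial. 2. For $(\mathrm{SO}(m)\times\mathrm{Sp}(n),\ \mathbb R^m\otimes_{\mathbb R}\mathbb H^n)$: $H^0=\mathrm{SO}(m-4n)$ if $m>4n+1$; $H^0=\mathrm{Sp}(n-m)$ if $n>m$; otherwise $H^0$ is trivial. 3. For $(\mathrm{SO}(m)\times\mathrm{Sp}(1)\mathrm{Sp}(n),\ \mathbb R^m\otimes_{\mathbb R}\mathbb R^{4n})$ with $m\ge 3$: $H^0=\mathrm{SO}(m-4n)$ if $m>4n+1$; $H^0=\mathrm{Sp}(n-m)$ if $n>m$; otherwise $H^0$ is trivial. For $m=2$ and $n\ge 2$: $H^0=\{1\}\times \mathrm{U}(1)\mathrm{Sp}(n-2)$, i.e. $H^0$ has trivial component in $\mathrm{SO}(2)$ and is isomorphic to $\mathrm{U}(1)\mathrm{Sp}(n-2)=(\mathrm{U}(1)\times\mathrm{Sp}(n-2))/\{\pm(1,1)\}$. 4. For $(\mathrm{SO}(m)\times\mathrm{U}(1)\mathrm{Sp}(n),\ \mathbb R^m\otimes_{\mathbb R}\mathbb C^{2n})$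 with $m\ge2$: $H^0=\mathrm{SO}(m-4n)$ if $m>4n$; $H^0=\mathrm{Sp}(n-m)$ if $n\ge m$; otherwise $H^0$ is trivial. 5. For $(\mathrm{U}(m)\times\mathrm{Sp}(1)\mathrm{Sp}(n),\ \mathbb C^m\otimes_{\mathbb R}\mathbb R^{4n})$ with $m\ge 2$ and $n\ge2$: $H^0=\mathrm{U}(m-4n)$ if $m\ge4n$; $H^0=\mathrm{Sp}(n-2m)$ if $n\ge 2m$; otherwise $H^0$ is trivial. 6. For $(\mathrm{Sp}(1)\mathrm{Sp}(m)\times\mathrm{Sp}(1)\mathrm{Sp}(n),\ \mathbb R^{4m}\otimes_{\mathbb R}\mathbb R^{4n})$ with $m\ge n$: $H^0=\mathrm{Sp}(m-4n)$ if $m>4n$; otherwise $H^0$ is trivial. 7. For $(\mathrm{U}(m)\times\mathrm{Sp}(n),\ \mathbb C^m\otimes_{\mathbb C}\mathbb H^n)$: $H^0=\mathrm{U}(m-2n)$ if $m\ge n+1$ and $n\ge2$ (trivial if $m\le 2n$); $H^0=\mathrm{Sp}(n-m)$ if $n\ge m\ge3$; $H^0\cong\mathrm{U}(1)\times\mathrm{U}(m-2)$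 if $m\ge2$ and $n=1$; $H^0\cong\mathrm{U}(1)\times\mathrm{Sp}(n-m)$ if $n\ge m$ and $1\le m\le 2$. 8. For $(\mathrm{Sp}(m)\times\mathrm{U}(1)\mathrm{Sp}(n),\ \mathbb H^m\otimes_{\mathbb C}\mathbb C^{2n})$ with $m\ge n\ge2$: $H^0=\mathrm{Sp}(m-2n)$ if $m>2n$; otherwise $H^0$ is trivial. -/

import Mathlib

open scoped Quaternion TensorProduct Matrix

namespace TensorIsotropy

/-! ### Isotropy groups of a representation -/

section Isotropy

variable {k G V : Type*} [CommSemiring k] [Group G] [AddCommMonoid V] [Module k V]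

/-- The isotropy group `G_v = {g ∈ G | ρ(g) v = v}`. -/
def isotropy (ρ : Representation k G V) (v : V) : Subgroup G where
  carrier := {g | ρ g v = v}
  one_mem' := by simp
  mul_mem' := by
    intro a b ha hb
    simp only [Set.mem_ofPred_eq] at ha hb ⊢
    rw [map_mul, Module.End.mul_apply, hb, ha]
  inv_mem' := by
    intro a ha
    simp only [Set.mem_ofPred_eq] at ha ⊢
    conv_lhs => rw [← ha]
    exact ρ.inv_self_apply a v

/-- `v` is a principal point (its orbit is a principal orbit, and `G_v` is a principal isotropy
group) if the conjugacy class of `G_v` is the least one among all isotropy types: every isotropy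
group contains a conjugate of `G_v`. -/
def IsPrincipal (ρ : Representation k G V) (v : V) : Prop :=
  ∀ w : V, ∃ g : G, ∀ h ∈ isotropy ρ v, g * h * g⁻¹ ∈ isotropy ρ w

/-- The identity component `(G_v)⁰` of the isotropy group `G_v`. -/
def isotropyZero [TopologicalSpace G] [IsTopologicalGroup G] (ρ : Representation k G V) (v : V) :
    Subgroup (isotropy ρ v) :=
  Subgroup.connectedComponentOfOne (isotropy ρ v)

end Isotropy

/-- The tensor product `(G₁ × G₂, V₁ ⊗ V₂)` of representations `(G₁, V₁)` and `(G₂, V₂)`. -/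
noncomputable def outerTensor {k G₁ G₂ V₁ V₂ : Type*} [CommSemiring k] [Group G₁] [Group G₂]
    [AddCommMonoid V₁] [Module k V₁] [AddCommMonoid V₂] [Module k V₂]
    (ρ₁ : Representation k G₁ V₁) (ρ₂ : Representation k G₂ V₂) :
    Representation k (G₁ × G₂) (V₁ ⊗[k] V₂) :=
  Representation.tprod (MonoidHom.comp ρ₁ (MonoidHom.fst G₁ G₂))
    (MonoidHom.comp ρ₂ (MonoidHom.snd G₁ G₂))

/-- The realification of a complex representation. -/
noncomputable def realify {G V : Type*} [Group G] [AddCommMonoid V] [Module ℂ V] [Module ℝ V]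
    [IsScalarTower ℝ ℂ V] (ρ : Representation ℂ G V) : Representation ℝ G V where
  toFun g := (ρ g).restrictScalars ℝ
  map_one' := by ext v; simp
  map_mul' g h := by ext v; simp

/-! ### The classical compact groups -/

/-- `SO(m)` -/
noncomputable abbrev SO (m : ℕ) := Matrix.specialOrthogonalGroup (Fin m) ℝ

/-- `U(m)` -/
noncomputable abbrev U (m : ℕ) := Matrix.unitaryGroup (Fin m) ℂ

/-- `Sp(n)`: quaternionic `n × n` matrices `A` with `A* A = A A* = 1`. -/
noncomputable abbrev Sp (n : ℕ) := unitary (Matrix (Fin n) (Fin n) ℍ[ℝ])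

/-- `U(1)`: complex numbers of modulus one. -/
noncomputable abbrev U1 := unitary ℂ

/-- `Sp(1)`: quaternions of norm one. -/
noncomputable abbrev Sp1 := unitary ℍ[ℝ]

instance (m : ℕ) : IsTopologicalGroup (SO m) where
  continuous_mul := by
    refine Continuous.subtype_mk ?_ _
    exact (continuous_subtype_val.comp continuous_fst).matrix_mul
      (continuous_subtype_val.comp continuous_snd)
  continuous_inv := by
    refine Continuous.subtype_mk ?_ _
    exact (continuous_subtype_val (p := fun A => A ∈ SO m)).matrix_transpose

/-- The subgroup `{(1, 1), (-1, -1)}` of `A × B`. -/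
def diagNeg (A B : Type*) [Group A] [HasDistribNeg A] [Group B] [HasDistribNeg B] :
    Subgroup (A × B) :=
  Subgroup.zpowers (-1, -1)

instance (A B : Type*) [Group A] [HasDistribNeg A] [Group B] [HasDistribNeg B] :
    (diagNeg A B).Normal := by
  refine ⟨fun x hx g => ?_⟩
  obtain ⟨j, rfl⟩ := Subgroup.mem_zpowers_iff.mp hx
  have h : Commute g ((-1, -1) : A × B) := by ext <;> simp
  rw [(h.zpow_right j).eq, mul_inv_cancel_right]
  exact hx

/-- The product `A · B = (A × B) / {(1, 1), (-1, -1)}`. -/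
abbrev CentralProduct (A B : Type*) [Group A] [HasDistribNeg A] [Group B] [HasDistribNeg B] :=
  (A × B) ⧸ diagNeg A B

/-- `U(1)Sp(n)` -/
abbrev U1Sp (n : ℕ) := CentralProduct U1 (Sp n)

/-- `Sp(1)Sp(n)` -/
abbrev Sp1Sp (n : ℕ) := CentralProduct Sp1 (Sp n)

/-! ### The space `ℍⁿ = ℂ²ⁿ = ℝ⁴ⁿ` -/

/-- The complex structure of `ℍ` given by right multiplication: `z • x = x z`. -/
noncomputable instance : Module ℂ ℍ[ℝ] where
  smul z x := x * (z : ℍ[ℝ])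
  one_smul x := by change x * ((1 : ℂ) : ℍ[ℝ]) = x; simp
  mul_smul z w x := by
    change x * ((z * w : ℂ) : ℍ[ℝ]) = (x * (w : ℍ[ℝ])) * (z : ℍ[ℝ])
    rw [mul_comm z w, Quaternion.coeComplex_mul, mul_assoc]
  smul_zero z := zero_mul (z : ℍ[ℝ])
  smul_add z x y := add_mul x y (z : ℍ[ℝ])
  add_smul z w x := by
    change x * ((z + w : ℂ) : ℍ[ℝ]) = x * (z : ℍ[ℝ]) + x * (w : ℍ[ℝ])
    rw [Quaternion.coeComplex_add, mul_add]
  zero_smul x := by change x * ((0 : ℂ) : ℍ[ℝ]) = 0; simp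

theorem complex_smul_def (z : ℂ) (x : ℍ[ℝ]) : z • x = x * (z : ℍ[ℝ]) := rfl

instance : IsScalarTower ℝ ℂ ℍ[ℝ] where
  smul_assoc r z x := by
    have h : ((r • z : ℂ) : ℍ[ℝ]) = r • (z : ℍ[ℝ]) := by ext <;> simp
    rw [complex_smul_def, complex_smul_def, h, mul_smul_comm]

/-- `ℍⁿ`, as a right quaternionic vector space. Underlying it are the real vector space `ℝ⁴ⁿ` and,
with complex numbers multiplying from the right, the complex vector space `ℂ²ⁿ`. -/
abbrev HVec (n : ℕ) : Type := Fin n → ℍ[ℝ]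

/-! ### The standard representations -/

/-- `(SO(m), ℝᵐ)` -/
noncomputable def stdSO (m : ℕ) : Representation ℝ (SO m) (Fin m → ℝ) where
  toFun g := Matrix.toLin' (g : Matrix (Fin m) (Fin m) ℝ)
  map_one' := by ext; simp
  map_mul' g h := by ext; simp

/-- `(U(m), ℂᵐ)` -/
noncomputable def stdU (m : ℕ) : Representation ℂ (U m) (Fin m → ℂ) where
  toFun g := Matrix.toLin' (g : Matrix (Fin m) (Fin m) ℂ)
  map_one' := by ext; simp
  map_mul' g h := by ext; simp

/-- The action of `U(1) × Sp(n)` on `ℂ²ⁿ = ℍⁿ`: `(z, g) · x = g x z`. -/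
noncomputable def prodU1Sp (n : ℕ) : Representation ℂ (U1 × Sp n) (HVec n) where
  toFun a :=
    { toFun := fun x i => ((a.2 : Matrix (Fin n) (Fin n) ℍ[ℝ]) *ᵥ x) i * ((a.1 : ℂ) : ℍ[ℝ])
      map_add' := by
        intro x y
        funext i
        simp only [Matrix.mulVec_add, Pi.add_apply, add_mul]
      map_smul' := by
        intro z x
        funext i
        simp only [Matrix.mulVec, dotProduct, Pi.smul_apply, complex_smul_def, RingHom.id_apply,
          ← mul_assoc, ← Finset.sum_mul]
        rw [mul_assoc, mul_assoc, ← Quaternion.coeComplex_mul, ← Quaternion.coeComplex_mul,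
          mul_comm z] }
  map_one' := by
    refine LinearMap.ext fun x => funext fun i => ?_
    change ((1 : Matrix (Fin n) (Fin n) ℍ[ℝ]) *ᵥ x) i * ((1 : ℂ) : ℍ[ℝ]) = x i
    rw [Matrix.one_mulVec, Quaternion.coeComplex_one, mul_one]
  map_mul' a b := by
    refine LinearMap.ext fun x => funext fun i => ?_
    change (((a.2 : Matrix (Fin n) (Fin n) ℍ[ℝ]) * (b.2 : Matrix (Fin n) (Fin n) ℍ[ℝ])) *ᵥ x) i
        * (((a.1 : ℂ) * (b.1 : ℂ) : ℂ) : ℍ[ℝ])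
      = ((a.2 : Matrix (Fin n) (Fin n) ℍ[ℝ]) *ᵥ
          fun j => ((b.2 : Matrix (Fin n) (Fin n) ℍ[ℝ]) *ᵥ x) j * ((b.1 : ℂ) : ℍ[ℝ])) i
        * ((a.1 : ℂ) : ℍ[ℝ])
    rw [← Matrix.mulVec_mulVec, mul_comm (a.1 : ℂ), Quaternion.coeComplex_mul, ← mul_assoc]
    simp only [Matrix.mulVec, dotProduct, ← mul_assoc, ← Finset.sum_mul]

/-- The action of `Sp(1) × Sp(n)` on `ℝ⁴ⁿ = ℍⁿ`: `(q, g) · x = g x q̄`. -/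
noncomputable def prodSp1Sp (n : ℕ) : Representation ℝ (Sp1 × Sp n) (HVec n) where
  toFun a :=
    { toFun := fun x i => ((a.2 : Matrix (Fin n) (Fin n) ℍ[ℝ]) *ᵥ x) i * star (a.1 : ℍ[ℝ])
      map_add' := by
        intro x y
        funext i
        simp only [Matrix.mulVec_add, Pi.add_apply, add_mul]
      map_smul' := by
        intro r x
        funext i
        simp only [Matrix.mulVec_smul, Pi.smul_apply, smul_mul_assoc, RingHom.id_apply] }
  map_one' := by
    refine LinearMap.ext fun x => funext fun i => ?_
    change ((1 : Matrix (Fin n) (Fin n) ℍ[ℝ]) *ᵥ x) i * star (1 : ℍ[ℝ]) = x i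
    rw [Matrix.one_mulVec, star_one, mul_one]
  map_mul' a b := by
    refine LinearMap.ext fun x => funext fun i => ?_
    change (((a.2 : Matrix (Fin n) (Fin n) ℍ[ℝ]) * (b.2 : Matrix (Fin n) (Fin n) ℍ[ℝ])) *ᵥ x) i
        * star ((a.1 : ℍ[ℝ]) * (b.1 : ℍ[ℝ]))
      = ((a.2 : Matrix (Fin n) (Fin n) ℍ[ℝ]) *ᵥ
          fun j => ((b.2 : Matrix (Fin n) (Fin n) ℍ[ℝ]) *ᵥ x) j * star (b.1 : ℍ[ℝ])) i
        * star (a.1 : ℍ[ℝ])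
    rw [← Matrix.mulVec_mulVec, star_mul, ← mul_assoc]
    simp only [Matrix.mulVec, dotProduct, ← mul_assoc, ← Finset.sum_mul]

/-- `(Sp(n), ℍⁿ)`, a complex representation of `Sp(n)` on `ℂ²ⁿ`: `g · x = g x`. -/
noncomputable def stdSp (n : ℕ) : Representation ℂ (Sp n) (HVec n) :=
  MonoidHom.comp (prodU1Sp n) (MonoidHom.inr U1 (Sp n))

/-- `(U(1)Sp(n), ℂ²ⁿ)` -/
noncomputable def stdU1Sp (n : ℕ) : Representation ℂ (U1Sp n) (HVec n) :=
  QuotientGroup.lift (diagNeg U1 (Sp n)) (prodU1Sp n) (by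
    intro a ha
    have h : diagNeg U1 (Sp n) ≤ (prodU1Sp n).ker := by
      rw [diagNeg, Subgroup.zpowers_le, MonoidHom.mem_ker]
      refine LinearMap.ext fun x => funext fun i => ?_
      change ((-1 : Matrix (Fin n) (Fin n) ℍ[ℝ]) *ᵥ x) i * ((-1 : ℂ) : ℍ[ℝ]) = x i
      have h1 : ((-1 : ℂ) : ℍ[ℝ]) = -1 := by ext <;> simp
      rw [h1, Matrix.neg_mulVec, Matrix.one_mulVec]
      simp
    exact h ha)

/-- `(Sp(1)Sp(n), ℝ⁴ⁿ)` -/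
noncomputable def stdSp1Sp (n : ℕ) : Representation ℝ (Sp1Sp n) (HVec n) :=
  QuotientGroup.lift (diagNeg Sp1 (Sp n)) (prodSp1Sp n) (by
    intro a ha
    have h : diagNeg Sp1 (Sp n) ≤ (prodSp1Sp n).ker := by
      rw [diagNeg, Subgroup.zpowers_le, MonoidHom.mem_ker]
      refine LinearMap.ext fun x => funext fun i => ?_
      change ((-1 : Matrix (Fin n) (Fin n) ℍ[ℝ]) *ᵥ x) i * star (-1 : ℍ[ℝ]) = x i
      rw [Matrix.neg_mulVec, Matrix.one_mulVec]
      simp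
    exact h ha)

/-! ### The eight families of tensor products -/

/-- `(SO(m) × U(n), ℝᵐ ⊗_ℝ ℂⁿ)` -/
noncomputable def repSOU (m n : ℕ) :
    Representation ℝ (SO m × U n) ((Fin m → ℝ) ⊗[ℝ] (Fin n → ℂ)) :=
  outerTensor (stdSO m) (realify (stdU n))

/-- `(SO(m) × Sp(n), ℝᵐ ⊗_ℝ ℍⁿ)` -/
noncomputable def repSOSp (m n : ℕ) :
    Representation ℝ (SO m × Sp n) ((Fin m → ℝ) ⊗[ℝ] HVec n) :=
  outerTensor (stdSO m) (realify (stdSp n))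

/-- `(SO(m) × Sp(1)Sp(n), ℝᵐ ⊗_ℝ ℝ⁴ⁿ)` -/
noncomputable def repSOSp1Sp (m n : ℕ) :
    Representation ℝ (SO m × Sp1Sp n) ((Fin m → ℝ) ⊗[ℝ] HVec n) :=
  outerTensor (stdSO m) (stdSp1Sp n)

/-- `(SO(m) × U(1)Sp(n), ℝᵐ ⊗_ℝ ℂ²ⁿ)` -/
noncomputable def repSOU1Sp (m n : ℕ) :
    Representation ℝ (SO m × U1Sp n) ((Fin m → ℝ) ⊗[ℝ] HVec n) :=
  outerTensor (stdSO m) (realify (stdU1Sp n))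

/-- `(U(m) × Sp(1)Sp(n), ℂᵐ ⊗_ℝ ℝ⁴ⁿ)` -/
noncomputable def repUSp1Sp (m n : ℕ) :
    Representation ℝ (U m × Sp1Sp n) ((Fin m → ℂ) ⊗[ℝ] HVec n) :=
  outerTensor (realify (stdU m)) (stdSp1Sp n)

/-- `(Sp(1)Sp(m) × Sp(1)Sp(n), ℝ⁴ᵐ ⊗_ℝ ℝ⁴ⁿ)` -/
noncomputable def repSp1SpSp1Sp (m n : ℕ) :
    Representation ℝ (Sp1Sp m × Sp1Sp n) (HVec m ⊗[ℝ] HVec n) :=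
  outerTensor (stdSp1Sp m) (stdSp1Sp n)

/-- `(U(m) × Sp(n), ℂᵐ ⊗_ℂ ℍⁿ)`: the realification has the same points and isotropy groups. -/
noncomputable def repUSp (m n : ℕ) :
    Representation ℂ (U m × Sp n) ((Fin m → ℂ) ⊗[ℂ] HVec n) :=
  outerTensor (stdU m) (stdSp n)

/-- `(Sp(m) × U(1)Sp(n), ℍᵐ ⊗_ℂ ℂ²ⁿ)` -/
noncomputable def repSpU1Sp (m n : ℕ) :
    Representation ℂ (Sp m × U1Sp n) (HVec m ⊗[ℂ] HVec n) :=
  outerTensor (stdSp m) (stdU1Sp n)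

end TensorIsotropy

open TensorIsotropy

/-!
Identity components of principal isotropy groups of tensor products of classical representations.

*Comparison.* Suppose that every isotropy group of a compact group `G` contains a conjugate of a
compact connected subgroup `K`, and that some isotropy group `G_w` is contained in `K` up to finite
index. A principal isotropy group `G_v` is conjugate to a subgroup of `G_w` and contains a conjugate
of `K`; so its identity component lies in a conjugate of `K`, and equality follows because a closed
subgroup of a compact group that contains a conjugate of itself is equal to it. This is
`isotropyZero_equiv_of_comparison`. In each family it thus suffices to guess `K`, to exhibit one
vector `w`, and to move arbitrary vectors into the fixed space of `K`.

*The vector.* Take `w = ∑ (i + 1) aᵢ ⊗ bᵢ` for orthonormal families `a` and `b`. As the singular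
values of `w` are distinct, an element `(g₁, g₂)` fixing `w` acts by scalars, `g₁ aᵢ = sᵢ aᵢ` and
`g₂ bᵢ = s̄ᵢ bᵢ` (`exists_eigenvalues_of_mem_isotropy`). Over `ℝ` the scalars are signs, so that up
to finite index `g₁` fixes all `aᵢ` and `g₂` fixes all `bᵢ`. It remains to choose the families with
small pointwise stabilizer. In `ℍⁿ` the vectors `εₖ + ε₀ cₖ`, with imaginary quaternions `cₖ`, force
the scalar factor in `Sp(1)` or `U(1)` to commute with the `cₖ`, hence to be a sign if the `cₖ`
include enough of `i` and `j` (`exists_frame_HVec`). Two vectors only allow for one `cₖ`, and a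
circle survives: this is the representation of `SO(2) × Sp(1)Sp(n)`. Over `ℂ` the scalars in `Sp(n)`
are signs for a unitary frame with sufficiently many non-zero values of the invariant symplectic
form, since `ω(bᵢ, bₖ) ≠ 0` forces `sᵢ sₖ = 1`; a triangle of such pairs suffices, and therefore
three vectors are needed (`exists_frame_stdSp`). With one or two vectors a circle survives:
these are the exceptional representations of `U(m) × Sp(n)`.

*Absorption.* If the smaller factor has dimension `r`, then a tensor is given by `r` vectors of the
larger one, and the `QR` decomposition over `ℝ`, `ℂ` or `ℍ` moves these to vectors with only the
first `r` coordinates, which the block subgroup of size `n - r` fixes. The truncated subtraction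
makes this uniform: the block subgroup is trivial if `n ≤ r`. In the exceptional cases the tensor is
first diagonalized by `U(m)`, with the spectral theorem for the Gram matrix
(`exists_outerTensor_stdU_eq`), or the two vectors are first rotated by `Sp(1)`
(`fixesUpToConj_diagonalEmbedding`).

*Connectedness.* The `QR` decomposition also shows that `SO(n)`, `U(n)` and `Sp(n)` are connected,
because the quasi-reflections it uses can be taken from the identity component.
-/

/-! ### Principal isotropy groups by comparison -/

/-- In a compact group, a closed subgroup that contains a conjugate of itself equals it. -/
theorem Subgroup.conj_mem_of_isClosed_of_forall_conj_mem {G : Type*} [Group G] [TopologicalSpace G]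
    [IsTopologicalGroup G] [CompactSpace G] {K : Subgroup G} (hK : IsClosed (K : Set G)) {g : G}
    (hg : ∀ k ∈ K, g * k * g⁻¹ ∈ K) {k : G} (hk : k ∈ K) : g⁻¹ * k * g ∈ K := by
  have hpow : ∀ n : ℕ, g ^ n * k * (g ^ n)⁻¹ ∈ K := by
    intro n
    induction n with
    | zero => simpa using hk
    | succ n ih =>
      have := hg _ ih
      have e : g ^ (n + 1) * k * (g ^ (n + 1))⁻¹ = g * (g ^ n * k * (g ^ n)⁻¹) * g⁻¹ := by
        rw [pow_succ']; group
      rwa [e]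
  have hc : IsClosed {x : G | x * k * x⁻¹ ∈ K} := by
    have : Continuous fun x : G => x * k * x⁻¹ := by fun_prop
    exact hK.preimage this
  -- the inverse of `g` is a limit of positive powers of `g`
  have h1 : MapClusterPt g⁻¹ Filter.atTop (g ^ · : ℕ → G) :=
    mapClusterPt_inv_atTop_pow.mpr (mapClusterPt_self_atTop_pow g)
  have h2 := hc.mem_of_mapClusterPt h1 (Filter.Eventually.of_forall hpow)
  simpa using h2

/-- If `K` is compact and connected and meets `isotropy ρ w` in a subgroup of finite index, and
every isotropy group contains a conjugate of `K`, then the identity component of a principal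
isotropy group is a conjugate of `K`. Here `K` is given as the image of a homomorphism `ι`. The
finiteness of the index is expressed by a function `F` that separates the cosets and has finitely
many values. -/
theorem exists_isotropyZero_eq_conj {k G V L X : Type*} [CommSemiring k] [Group G] [AddCommMonoid V]
    [Module k V] [TopologicalSpace G] [IsTopologicalGroup G] [CompactSpace G] [T2Space G]
    [Group L] [TopologicalSpace L] [CompactSpace L] [ConnectedSpace L] [Finite X]
    (ρ : Representation k G V) (ι : L →* G) (hι : Continuous ι)
    (habs : ∀ v, ∃ g, ∀ l, g * ι l * g⁻¹ ∈ isotropy ρ v)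
    (w : V) (F : G → X)
    (hF : ∀ g ∈ isotropy ρ w, ∀ h ∈ isotropy ρ w, F g = F h → g⁻¹ * h ∈ ι.range)
    (v : V) (hv : IsPrincipal ρ v) :
    ∃ g : G, (∀ l, g * ι l * g⁻¹ ∈ isotropy ρ v) ∧
      ∀ x : isotropy ρ v, x ∈ isotropyZero ρ v ↔ ∃ l, (x : G) = g * ι l * g⁻¹ := by
  obtain ⟨g, hg⟩ := habs v
  obtain ⟨h, hh⟩ := hv w
  have hKc : IsClosed (ι.range : Set G) := by
    rw [MonoidHom.coe_range]; exact (isCompact_range hι).isClosed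
  -- the subgroup of `isotropy ρ v` conjugated into `ι.range` by `h` is clopen
  let c : isotropy ρ v →* G := (MulAut.conj h).toMonoidHom.comp (isotropy ρ v).subtype
  have hc : ∀ x, c x = h * x * h⁻¹ := fun x => rfl
  have hcc : Continuous c := by
    have : Continuous fun x : isotropy ρ v => h * (x : G) * h⁻¹ := by fun_prop
    exact this
  let M : Subgroup (isotropy ρ v) := ι.range.comap c
  have hMc : IsClosed (M : Set (isotropy ρ v)) := hKc.preimage hcc
  have hMf : M.FiniteIndex := by
    have : Finite (isotropy ρ v ⧸ M) := by
      refine Finite.of_injective (fun q => F (c q.out)) fun p q hpq => ?_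
      rw [← p.out_eq', ← q.out_eq']
      refine QuotientGroup.eq.mpr ?_
      have := hF _ (hh _ p.out.2) _ (hh _ q.out.2) hpq
      change c (p.out⁻¹ * q.out) ∈ ι.range
      rw [map_mul, map_inv]
      exact this
    exact Subgroup.finiteIndex_of_finite_quotient
  have hMo : IsOpen (M : Set (isotropy ρ v)) := M.isOpen_of_isClosed_of_finiteIndex hMc
  have h1 : ∀ x ∈ isotropyZero ρ v, h * (x : G) * h⁻¹ ∈ ι.range := by
    intro x hx
    have : connectedComponent (1 : isotropy ρ v) ⊆ M :=
      (IsClopen.connectedComponent_subset ⟨hMc, hMo⟩ M.one_mem)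
    exact this hx
  have h2 : ∀ l, (⟨g * ι l * g⁻¹, hg l⟩ : isotropy ρ v) ∈ isotropyZero ρ v := by
    intro l
    have hcont : Continuous fun l => (⟨g * ι l * g⁻¹, hg l⟩ : isotropy ρ v) := by
      refine Continuous.subtype_mk ?_ _
      fun_prop
    have := (isPreconnected_range hcont).subset_connectedComponent (x := 1)
      ⟨1, by ext; simp⟩
    exact this ⟨l, rfl⟩
  refine ⟨g, hg, fun x => ⟨fun hx => ?_, ?_⟩⟩
  · have h3 : ∀ k ∈ ι.range, (h * g) * k * (h * g)⁻¹ ∈ ι.range := by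
      rintro _ ⟨l, rfl⟩
      have := h1 _ (h2 l)
      simpa [mul_assoc] using this
    have h4 := Subgroup.conj_mem_of_isClosed_of_forall_conj_mem hKc h3 (h1 x hx)
    obtain ⟨l, hl⟩ := h4
    refine ⟨l, ?_⟩
    rw [hl]; group
  · rintro ⟨l, hl⟩
    have : x = ⟨g * ι l * g⁻¹, hg l⟩ := Subtype.ext hl
    rw [this]; exact h2 l

/-- The comparison principle: if every isotropy group contains a conjugate of a given copy of `L`,
and some isotropy group is contained in this copy up to finite index, then the identity component of
a principal isotropy group is isomorphic to `L` and lies in a conjugate of the copy. -/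
theorem isotropyZero_equiv_of_comparison {k G V L X : Type*} [CommSemiring k] [Group G]
    [AddCommMonoid V]
    [Module k V] [TopologicalSpace G] [IsTopologicalGroup G] [CompactSpace G] [T2Space G]
    [Group L] [TopologicalSpace L] [CompactSpace L] [ConnectedSpace L] [Finite X]
    (ρ : Representation k G V) (ι : L →* G) (hι : Continuous ι) (hinj : Function.Injective ι)
    (habs : ∀ v, ∃ g, ∀ l, g * ι l * g⁻¹ ∈ isotropy ρ v)
    (w : V) (F : G → X)
    (hF : ∀ g ∈ isotropy ρ w, ∀ h ∈ isotropy ρ w, F g = F h → g⁻¹ * h ∈ ι.range)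
    (v : V) (hv : IsPrincipal ρ v) :
    (∃ g : G, ∀ x ∈ isotropyZero ρ v, ∃ l, (x : G) = g * ι l * g⁻¹) ∧
      Nonempty (isotropyZero ρ v ≃ₜ* L) := by
  obtain ⟨g, hmem, hg⟩ := exists_isotropyZero_eq_conj ρ ι hι habs w F hF v hv
  refine ⟨⟨g, fun x => (hg x).mp⟩, ?_⟩
  let f : L →* isotropyZero ρ v :=
    { toFun := fun l => ⟨⟨g * ι l * g⁻¹, hmem l⟩, (hg _).mpr ⟨l, rfl⟩⟩
      map_one' := by ext; simp
      map_mul' := by intro a b; ext; simp }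
  have hf : Continuous f := by
    refine Continuous.subtype_mk (Continuous.subtype_mk ?_ _) _
    fun_prop
  have hb : Function.Bijective f := by
    refine ⟨fun a b hab => ?_, fun x => ?_⟩
    · have : g * ι a * g⁻¹ = g * ι b * g⁻¹ :=
        congrArg (fun y : isotropyZero ρ v => ((y : isotropy ρ v) : G)) hab
      exact hinj (by simpa using this)
    · obtain ⟨l, hl⟩ := (hg x.1).mp x.2
      exact ⟨l, Subtype.ext (Subtype.ext hl.symm)⟩
  let e := MulEquiv.ofBijective f hb
  have he : Continuous e.toEquiv := hf
  let h := he.homeoOfEquivCompactToT2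
  exact ⟨ContinuousMulEquiv.symm { e with
    continuous_toFun := h.continuous
    continuous_invFun := h.symm.continuous }⟩

/-! ### Vectors of a tensor product with distinct singular values -/

section SingularValues

variable {𝕜 V₁ V₂ G₁ G₂ : Type*} [RCLike 𝕜] [Group G₁] [Group G₂]

section

variable [NormedAddCommGroup V₁] [InnerProductSpace 𝕜 V₁]
  [NormedAddCommGroup V₂] [InnerProductSpace 𝕜 V₂]

/-- Contraction `a ⊗ b ↦ ⟪x, a⟫ b` of a tensor with a vector of the first factor. -/
noncomputable def innerContractLeft (x : V₁) : V₁ ⊗[𝕜] V₂ →ₗ[𝕜] V₂ :=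
  (TensorProduct.lid 𝕜 V₂).toLinearMap ∘ₗ (innerₛₗ 𝕜 x).rTensor V₂

/-- Contraction `a ⊗ b ↦ ⟪y, b⟫ a` of a tensor with a vector of the second factor. -/
noncomputable def innerContractRight (y : V₂) : V₁ ⊗[𝕜] V₂ →ₗ[𝕜] V₁ :=
  (TensorProduct.rid 𝕜 V₁).toLinearMap ∘ₗ (innerₛₗ 𝕜 y).lTensor V₁

@[simp]
theorem innerContractLeft_tmul (x a : V₁) (b : V₂) :
    innerContractLeft x (a ⊗ₜ[𝕜] b) = inner 𝕜 x a • b := by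
  simp [innerContractLeft]

@[simp]
theorem innerContractRight_tmul (y b : V₂) (a : V₁) :
    innerContractRight y (a ⊗ₜ[𝕜] b) = inner 𝕜 y b • a := by
  simp [innerContractRight]

theorem outerTensor_tmul {k G₁ G₂ V₁ V₂ : Type*} [CommSemiring k] [Group G₁] [Group G₂]
    [AddCommMonoid V₁] [Module k V₁] [AddCommMonoid V₂] [Module k V₂]
    (ρ₁ : Representation k G₁ V₁) (ρ₂ : Representation k G₂ V₂) (g : G₁ × G₂) (a : V₁) (b : V₂) :
    outerTensor ρ₁ ρ₂ g (a ⊗ₜ[k] b) = ρ₁ g.1 a ⊗ₜ[k] ρ₂ g.2 b := rfl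

theorem innerContractLeft_outerTensor (ρ₁ : Representation 𝕜 G₁ V₁) (ρ₂ : Representation 𝕜 G₂ V₂)
    (h₁ : ∀ g x y, inner 𝕜 (ρ₁ g x) (ρ₁ g y) = inner 𝕜 x y) (g : G₁ × G₂) (x : V₁)
    (t : V₁ ⊗[𝕜] V₂) :
    innerContractLeft (ρ₁ g.1 x) (outerTensor ρ₁ ρ₂ g t) = ρ₂ g.2 (innerContractLeft x t) := by
  induction t with
  | zero => simp
  | tmul a b => rw [outerTensor_tmul]; simp [h₁]
  | add s t hs ht => simp only [map_add, hs, ht]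

theorem innerContractRight_outerTensor (ρ₁ : Representation 𝕜 G₁ V₁) (ρ₂ : Representation 𝕜 G₂ V₂)
    (h₂ : ∀ g x y, inner 𝕜 (ρ₂ g x) (ρ₂ g y) = inner 𝕜 x y) (g : G₁ × G₂) (y : V₂)
    (t : V₁ ⊗[𝕜] V₂) :
    innerContractRight (ρ₂ g.2 y) (outerTensor ρ₁ ρ₂ g t) = ρ₁ g.1 (innerContractRight y t) := by
  induction t with
  | zero => simp
  | tmul a b => rw [outerTensor_tmul]; simp [h₂]
  | add s t hs ht => simp only [map_add, hs, ht]

/-- The vector `∑ (i + 1) aᵢ ⊗ bᵢ`; for orthonormal families `a` and `b` it has distinct singular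
values. -/
noncomputable def singularVector (𝕜 : Type*) [RCLike 𝕜] {V₁ V₂ : Type*} [AddCommGroup V₁]
    [Module 𝕜 V₁] [AddCommGroup V₂] [Module 𝕜 V₂] {r : ℕ} (a : Fin r → V₁) (b : Fin r → V₂) :
    V₁ ⊗[𝕜] V₂ :=
  ∑ i : Fin r, ((i : ℕ) + 1 : 𝕜) • (a i ⊗ₜ[𝕜] b i)

theorem exists_eigenvalues_of_mem_isotropy' (ρ₁ : Representation 𝕜 G₁ V₁)
    (ρ₂ : Representation 𝕜 G₂ V₂)
    (h₁ : ∀ g x y, inner 𝕜 (ρ₁ g x) (ρ₁ g y) = inner 𝕜 x y)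
    (h₂ : ∀ g x y, inner 𝕜 (ρ₂ g x) (ρ₂ g y) = inner 𝕜 x y)
    {r : ℕ} {a : Fin r → V₁} {b : Fin r → V₂}
    (ha : Orthonormal 𝕜 a) (hb : Orthonormal 𝕜 b) {g : G₁ × G₂}
    (hg : g ∈ isotropy (outerTensor ρ₁ ρ₂) (singularVector 𝕜 a b)) :
    ∃ s : Fin r → 𝕜, (∀ i, star (s i) * s i = 1) ∧ (∀ i, ρ₁ g.1 (a i) = s i • a i) ∧
      ∀ i, ρ₂ g.2 (b i) = star (s i) • b i := by
  set w := singularVector 𝕜 a b with hw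
  have hg' : outerTensor ρ₁ ρ₂ g w = w := hg
  have hL : ∀ x, innerContractLeft (ρ₁ g.1 x) w = ρ₂ g.2 (innerContractLeft x w) := by
    intro x
    conv_lhs => rw [← hg']
    exact innerContractLeft_outerTensor ρ₁ ρ₂ h₁ g x w
  have hR : ∀ y, innerContractRight (ρ₂ g.2 y) w = ρ₁ g.1 (innerContractRight y w) := by
    intro x
    conv_lhs => rw [← hg']
    exact innerContractRight_outerTensor ρ₁ ρ₂ h₂ g x w
  have cL : ∀ x, innerContractLeft x w
      = ∑ i : Fin r, (((i : ℕ) + 1 : 𝕜) * inner 𝕜 x (a i)) • b i := by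
    intro x; simp [hw, singularVector, mul_smul]
  have cR : ∀ x, innerContractRight x w
      = ∑ i : Fin r, (((i : ℕ) + 1 : 𝕜) * inner 𝕜 x (b i)) • a i := by
    intro x; simp [hw, singularVector, mul_smul]
  -- contracting twice is the operator `A* A`, with eigenvectors `a i`; it commutes with `ρ₁ g.1`
  have cc : ∀ x, innerContractRight (innerContractLeft x w) w
      = ∑ i : Fin r, (((i : ℕ) + 1 : 𝕜) ^ 2 * inner 𝕜 (a i) x) • a i := by
    intro x
    rw [cR]
    refine Finset.sum_congr rfl fun i _ => ?_
    rw [cL, sum_inner]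
    congr 1
    rw [Finset.sum_eq_single i]
    · rw [inner_smul_left, orthonormal_iff_ite.mp hb]
      simp
      ring
    · intro j _ hj
      rw [inner_smul_left, orthonormal_iff_ite.mp hb]
      simp [hj]
    · simp
  have key : ∀ i, ∑ j : Fin r, (((j : ℕ) + 1 : 𝕜) ^ 2 * inner 𝕜 (a j) (ρ₁ g.1 (a i))) • a j
      = (((i : ℕ) + 1 : 𝕜) ^ 2) • ρ₁ g.1 (a i) := by
    intro i
    rw [← cc, hL, hR, cc, Finset.sum_eq_single i]
    · rw [orthonormal_iff_ite.mp ha]; simp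
    · intro j _ hj
      rw [orthonormal_iff_ite.mp ha]; simp [hj]
    · simp
  have hne : ∀ i : Fin r, (((i : ℕ) + 1 : 𝕜)) ≠ 0 := fun i => by exact_mod_cast Nat.succ_ne_zero i
  have hoff : ∀ i j, j ≠ i → inner 𝕜 (a j) (ρ₁ g.1 (a i)) = 0 := by
    intro i j hj
    have h := congrArg (inner 𝕜 (a j)) (key i)
    rw [inner_sum, Finset.sum_eq_single j, inner_smul_right, inner_smul_right,
      orthonormal_iff_ite.mp ha] at h
    · have hd : (((j : ℕ) + 1 : 𝕜) ^ 2 - ((i : ℕ) + 1 : 𝕜) ^ 2) ≠ 0 := by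
        rw [sub_ne_zero]
        intro h'
        have h'' : ((j : ℕ) + 1) ^ 2 = ((i : ℕ) + 1) ^ 2 := by exact_mod_cast h'
        have := Nat.pow_left_injective (n := 2) (by norm_num) h''
        exact hj (Fin.ext (by simpa using this))
      have h3 : (((j : ℕ) + 1 : 𝕜) ^ 2 - ((i : ℕ) + 1 : 𝕜) ^ 2)
          * inner 𝕜 (a j) (ρ₁ g.1 (a i)) = 0 := by
        simp only [if_true, mul_one] at h
        rw [sub_mul, h, sub_self]
      exact (mul_eq_zero.mp h3).resolve_left hd
    · intro l _ hl
      rw [inner_smul_right, orthonormal_iff_ite.mp ha]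
      simp [hl.symm]
    · simp
  have hs : ∀ i, ρ₁ g.1 (a i) = inner 𝕜 (a i) (ρ₁ g.1 (a i)) • a i := by
    intro i
    have h := key i
    rw [Finset.sum_eq_single i] at h
    · rw [mul_smul] at h
      exact (smul_right_injective _ (pow_ne_zero 2 (hne i)) h).symm
    · intro j _ hj
      rw [hoff i j hj]; simp
    · simp
  refine ⟨fun i => inner 𝕜 (a i) (ρ₁ g.1 (a i)), fun i => ?_, hs, fun i => ?_⟩
  · have h := h₁ g.1 (a i) (a i)
    rw [hs i, inner_smul_left, inner_smul_right, orthonormal_iff_ite.mp ha] at h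
    simpa using h
  · have hLi : ∀ c : 𝕜, innerContractLeft (c • a i) w = (((i : ℕ) + 1 : 𝕜) * star c) • b i := by
      intro c
      rw [cL, Finset.sum_eq_single i]
      · rw [inner_smul_left, orthonormal_iff_ite.mp ha]; simp
      · intro j _ hj
        rw [inner_smul_left, orthonormal_iff_ite.mp ha]; simp [hj.symm]
      · simp
    have h := hL (a i)
    have h1 := hLi 1
    rw [hs i, hLi, ← one_smul 𝕜 (a i), h1] at h
    simp only [one_smul, star_one, mul_one, map_smul] at h
    rw [mul_smul] at h
    exact (smul_right_injective _ (hne i) h).symm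

/-- A finite sequence of non-zero orthogonal vectors extends, up to scalars, to an orthonormal
basis. -/
theorem exists_orthonormal_extension' [FiniteDimensional 𝕜 V₁] {N : ℕ}
    (hN : Module.finrank 𝕜 V₁ = N) {t : ℕ} (f : ℕ → V₁)
    (hf : ∀ i < t, ∀ j < t, i ≠ j → inner 𝕜 (f i) (f j) = 0) (hf0 : ∀ i < t, f i ≠ 0) :
    ∃ b : Fin N → V₁, Orthonormal 𝕜 b ∧ (∀ x, (∀ i, inner 𝕜 (b i) x = 0) → x = 0) ∧
      ∀ i : Fin N, (i : ℕ) < t → ∃ c : 𝕜, c ≠ 0 ∧ f i = c • b i := by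
  let v : Fin N → V₁ := fun i => ((‖f i‖ : 𝕜)⁻¹) • f i
  let s : Set (Fin N) := {i | (i : ℕ) < t}
  have hv : Orthonormal 𝕜 (s.domRestrict v) := by
    refine ⟨fun i => ?_, fun i j hij => ?_⟩
    · exact norm_smul_inv_norm (hf0 _ i.2)
    · have := hf _ i.2 _ j.2 (fun h => hij (Subtype.ext (Fin.ext h)))
      change inner 𝕜 (_ • _) (_ • _) = (0 : 𝕜)
      rw [inner_smul_left, inner_smul_right, this]; simp
  obtain ⟨b, hb⟩ := hv.exists_orthonormalBasis_extension_of_card_eq (by simpa using hN)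
  refine ⟨b, b.orthonormal, fun x hx => ?_, fun i hi => ⟨(‖f i‖ : 𝕜), ?_, ?_⟩⟩
  · rw [← b.sum_repr' x]; simp [hx]
  · simpa using hf0 i hi
  · rw [hb i hi, smul_smul, mul_inv_cancel₀, one_smul]
    simpa using hf0 i hi

end

section

variable [AddCommGroup V₁] [Module 𝕜 V₁] [AddCommGroup V₂] [Module 𝕜 V₂]

/-- Orthonormality with respect to an inner product that is not an instance. -/
def OrthonormalFor (c : InnerProductSpace.Core 𝕜 V₁) {r : ℕ} (a : Fin r → V₁) : Prop :=
  ∀ i j, c.inner (a i) (a j) = if i = j then 1 else 0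

/-- The representation preserves the inner product. -/
def IsUnitaryFor {G : Type*} [Group G] (c : InnerProductSpace.Core 𝕜 V₁)
    (ρ : Representation 𝕜 G V₁) : Prop :=
  ∀ g x y, c.inner (ρ g x) (ρ g y) = c.inner x y

/-- An element of the isotropy group of a vector with distinct singular values acts diagonally on
the singular vectors: `g₂⁻¹ ∘ A ∘ g₁ = A`, for the map `A` from `V₁` to `V₂` given by the tensor,
and `g₁` commutes with `A* A`, which has simple non-zero eigenvalues. -/
theorem exists_eigenvalues_of_mem_isotropy (c₁ : InnerProductSpace.Core 𝕜 V₁)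
    (c₂ : InnerProductSpace.Core 𝕜 V₂) {ρ₁ : Representation 𝕜 G₁ V₁}
    {ρ₂ : Representation 𝕜 G₂ V₂} (h₁ : IsUnitaryFor c₁ ρ₁) (h₂ : IsUnitaryFor c₂ ρ₂)
    {r : ℕ} {a : Fin r → V₁} {b : Fin r → V₂} (ha : OrthonormalFor c₁ a) (hb : OrthonormalFor c₂ b)
    {g : G₁ × G₂} (hg : g ∈ isotropy (outerTensor ρ₁ ρ₂) (singularVector 𝕜 a b)) :
    ∃ s : Fin r → 𝕜, (∀ i, star (s i) * s i = 1) ∧ (∀ i, ρ₁ g.1 (a i) = s i • a i) ∧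
      ∀ i, ρ₂ g.2 (b i) = star (s i) • b i := by
  let _ : NormedAddCommGroup V₁ := c₁.toNormedAddCommGroup
  let _ : InnerProductSpace 𝕜 V₁ := InnerProductSpace.ofCore c₁.toCore
  let _ : NormedAddCommGroup V₂ := c₂.toNormedAddCommGroup
  let _ : InnerProductSpace 𝕜 V₂ := InnerProductSpace.ofCore c₂.toCore
  exact exists_eigenvalues_of_mem_isotropy' ρ₁ ρ₂ h₁ h₂ (orthonormal_iff_ite.mpr ha)
    (orthonormal_iff_ite.mpr hb) hg

/-- A finite sequence of non-zero orthogonal vectors extends, up to scalars, to an orthonormal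
basis. -/
theorem exists_orthonormalFor_extension (c : InnerProductSpace.Core 𝕜 V₁)
    [FiniteDimensional 𝕜 V₁] {N : ℕ}
    (hN : Module.finrank 𝕜 V₁ = N) {t : ℕ} (f : ℕ → V₁)
    (hf : ∀ i < t, ∀ j < t, i ≠ j → c.inner (f i) (f j) = 0) (hf0 : ∀ i < t, f i ≠ 0) :
    ∃ b : Fin N → V₁, OrthonormalFor c b ∧ (∀ x, (∀ i, c.inner (b i) x = 0) → x = 0) ∧
      ∀ i : Fin N, (i : ℕ) < t → ∃ c : 𝕜, c ≠ 0 ∧ f i = c • b i := by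
  let _ : NormedAddCommGroup V₁ := c.toNormedAddCommGroup
  let _ : InnerProductSpace 𝕜 V₁ := InnerProductSpace.ofCore c.toCore
  obtain ⟨b, hb, h⟩ := exists_orthonormal_extension' (𝕜 := 𝕜) hN f hf hf0
  exact ⟨b, orthonormal_iff_ite.mp hb, h⟩

end

end SingularValues

/-! ### The comparison principle for tensor products -/

section Comparison

variable {𝕜 V₁ V₂ G₁ G₂ L : Type*} [RCLike 𝕜] [Group G₁] [Group G₂]
  [AddCommGroup V₁] [Module 𝕜 V₁] [AddCommGroup V₂] [Module 𝕜 V₂] [Group L]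

/-- The eigenvalues of `ρ` on vectors of the family `a` that happen to be eigenvectors are `±1`. -/
def HasSignEigenvalues {V G : Type*} [AddCommGroup V] [Module 𝕜 V] [Group G]
    (ρ : Representation 𝕜 G V) {r : ℕ} (a : Fin r → V) : Prop :=
  ∀ (g : G) (s : Fin r → 𝕜), (∀ i, ρ g (a i) = s i • a i) → ∀ i, s i = 1 ∨ s i = -1

/-- The pointwise stabilizer of the family `a` is contained in the image of `κ`. -/
def StabilizerIn {V G : Type*} [AddCommGroup V] [Module 𝕜 V] [Group G]
    (ρ : Representation 𝕜 G V) {r : ℕ} (a : Fin r → V) (κ : L →* G) : Prop :=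
  ∀ g : G, (∀ i, ρ g (a i) = a i) → g ∈ κ.range

/-- Any `N` vectors of `V` are fixed by some conjugate of the image of `κ`. -/
def FixesUpToConj {V G : Type*} [AddCommGroup V] [Module 𝕜 V] [Group G]
    (ρ : Representation 𝕜 G V) (N : ℕ) (κ : L →* G) : Prop :=
  ∀ x : Fin N → V, ∃ g : G, ∀ l i, ρ (g * κ l * g⁻¹) (x i) = x i

theorem OrthonormalFor.ne_zero {c : InnerProductSpace.Core 𝕜 V₁} {r : ℕ} {a : Fin r → V₁}
    (ha : OrthonormalFor c a) (i : Fin r) : a i ≠ 0 := by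
  intro h
  have h1 := ha i i
  rw [h, if_pos rfl] at h1
  have := c.smul_left 0 0 0
  rw [zero_smul, h1] at this
  simp at this

/-- A tensor is given by as many vectors of the first space as the second has dimensions. -/
theorem FixesUpToConj.exists_conj_mem_isotropy_left [FiniteDimensional 𝕜 V₂]
    {ρ₁ : Representation 𝕜 G₁ V₁}
    (ρ₂ : Representation 𝕜 G₂ V₂) {κ : L →* G₁} (h : FixesUpToConj ρ₁ (Module.finrank 𝕜 V₂) κ)
    (v : V₁ ⊗[𝕜] V₂) :
    ∃ g : G₁ × G₂, ∀ l, g * (MonoidHom.inl G₁ G₂).comp κ l * g⁻¹ ∈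
      isotropy (outerTensor ρ₁ ρ₂) v := by
  obtain ⟨x, rfl⟩ := TensorProduct.eq_repr_basis_right (Module.finBasis 𝕜 V₂) v
  obtain ⟨g, hg⟩ := h x
  refine ⟨(g, 1), fun l => ?_⟩
  change outerTensor ρ₁ ρ₂ _ _ = _
  rw [Finsupp.sum, map_sum]
  refine Finset.sum_congr rfl fun i _ => ?_
  rw [outerTensor_tmul]
  have := hg l i
  simp only [Prod.fst_mul, Prod.snd_mul, Prod.fst_inv, Prod.snd_inv, MonoidHom.coe_comp,
    Function.comp_apply, MonoidHom.inl_apply, mul_one, inv_one, map_one, Module.End.one_apply]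
  rw [this]

theorem FixesUpToConj.exists_conj_mem_isotropy_right [FiniteDimensional 𝕜 V₁]
    (ρ₁ : Representation 𝕜 G₁ V₁)
    {ρ₂ : Representation 𝕜 G₂ V₂} {κ : L →* G₂} (h : FixesUpToConj ρ₂ (Module.finrank 𝕜 V₁) κ)
    (v : V₁ ⊗[𝕜] V₂) :
    ∃ g : G₁ × G₂, ∀ l, g * (MonoidHom.inr G₁ G₂).comp κ l * g⁻¹ ∈
      isotropy (outerTensor ρ₁ ρ₂) v := by
  obtain ⟨x, rfl⟩ := TensorProduct.eq_repr_basis_left (Module.finBasis 𝕜 V₁) v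
  obtain ⟨g, hg⟩ := h x
  refine ⟨(1, g), fun l => ?_⟩
  change outerTensor ρ₁ ρ₂ _ _ = _
  rw [Finsupp.sum, map_sum]
  refine Finset.sum_congr rfl fun i _ => ?_
  rw [outerTensor_tmul]
  have := hg l i
  simp only [Prod.fst_mul, Prod.snd_mul, Prod.fst_inv, Prod.snd_inv, MonoidHom.coe_comp,
    Function.comp_apply, MonoidHom.inr_apply, mul_one, inv_one, map_one, Module.End.one_apply]
  rw [this]

/-- An orthogonal transformation has only the real eigenvalues `±1`. -/
theorem IsUnitaryFor.hasSignEigenvalues {V : Type*} [AddCommGroup V] [Module ℝ V]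
    {c : InnerProductSpace.Core ℝ V} {ρ : Representation ℝ G₁ V} (h : IsUnitaryFor c ρ)
    {r : ℕ} {a : Fin r → V} (ha : OrthonormalFor c a) : HasSignEigenvalues ρ a := by
  intro g s hs i
  have h1 := h g (a i) (a i)
  rw [hs i, c.smul_left, ← c.conj_inner_symm (a i), c.smul_left, ha i i] at h1
  simp at h1
  exact mul_self_eq_one_iff.mp h1

variable [TopologicalSpace G₁] [IsTopologicalGroup G₁] [CompactSpace G₁] [T2Space G₁]
  [TopologicalSpace G₂] [IsTopologicalGroup G₂] [CompactSpace G₂] [T2Space G₂]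
  [TopologicalSpace L] [CompactSpace L] [ConnectedSpace L]

/-- The comparison principle for a tensor product and a vector with distinct singular values: when
the elements of its isotropy group have only the eigenvalues `±1` on the singular vectors, the
pointwise stabilizer of these has finite index. -/
theorem isotropyZero_equiv_of_singularVector (c₁ : InnerProductSpace.Core 𝕜 V₁)
    (c₂ : InnerProductSpace.Core 𝕜 V₂) {ρ₁ : Representation 𝕜 G₁ V₁}
    {ρ₂ : Representation 𝕜 G₂ V₂} (h₁ : IsUnitaryFor c₁ ρ₁) (h₂ : IsUnitaryFor c₂ ρ₂)
    {r : ℕ} {a : Fin r → V₁} {b : Fin r → V₂} (ha : OrthonormalFor c₁ a) (hb : OrthonormalFor c₂ b)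
    (hs : HasSignEigenvalues ρ₁ a ∨ HasSignEigenvalues ρ₂ b)
    (ι : L →* G₁ × G₂) (hι : Continuous ι) (hinj : Function.Injective ι)
    (hker : ∀ g : G₁ × G₂, (∀ i, ρ₁ g.1 (a i) = a i) → (∀ i, ρ₂ g.2 (b i) = b i) → g ∈ ι.range)
    (habs : ∀ v, ∃ g, ∀ l, g * ι l * g⁻¹ ∈ isotropy (outerTensor ρ₁ ρ₂) v)
    (v : V₁ ⊗[𝕜] V₂) (hv : IsPrincipal (outerTensor ρ₁ ρ₂) v) :
    (∃ g : G₁ × G₂, ∀ x ∈ isotropyZero (outerTensor ρ₁ ρ₂) v,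
      ∃ l, (x : G₁ × G₂) = g * ι l * g⁻¹) ∧
      Nonempty (isotropyZero (outerTensor ρ₁ ρ₂) v ≃ₜ* L) := by
  have key : ∀ g ∈ isotropy (outerTensor ρ₁ ρ₂) (singularVector 𝕜 a b), ∀ i,
      (ρ₁ g.1 (a i) = a i ∧ ρ₂ g.2 (b i) = b i) ∨
        (ρ₁ g.1 (a i) = -a i ∧ ρ₂ g.2 (b i) = -b i) := by
    intro g hg i
    obtain ⟨s, hs1, hsa, hsb⟩ := exists_eigenvalues_of_mem_isotropy c₁ c₂ h₁ h₂ ha hb hg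
    have : s i = 1 ∨ s i = -1 := by
      rcases hs with hs | hs
      · exact hs _ s hsa i
      · rcases hs _ _ hsb i with h | h
        · left; rw [← star_star (s i), h, star_one]
        · right; rw [← star_star (s i), h, star_neg, star_one]
    rw [hsa, hsb]
    rcases this with h | h <;> simp [h]
  refine isotropyZero_equiv_of_comparison (X := Fin r → Prop) _ ι hι hinj habs
    (singularVector 𝕜 a b) (fun g i => ρ₁ g.1 (a i) = a i) (fun g hg h hh hgh => ?_) v hv
  have hne : ∀ i, ¬ (-a i = a i) := fun i hi => by
    have h2 : (2 : 𝕜) • a i = 0 := by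
      rw [two_smul]; nth_rewrite 1 [← hi]; simp
    exact ha.ne_zero i ((smul_eq_zero.mp h2).resolve_left two_ne_zero)
  have heq : ∀ i, ρ₁ g.1 (a i) = ρ₁ h.1 (a i) ∧ ρ₂ g.2 (b i) = ρ₂ h.2 (b i) := by
    intro i
    have hi : (ρ₁ g.1 (a i) = a i) = (ρ₁ h.1 (a i) = a i) := congrFun hgh i
    rcases key g hg i with ⟨h1, h2⟩ | ⟨h1, h2⟩ <;> rcases key h hh i with ⟨h3, h4⟩ | ⟨h3, h4⟩
    · simp [h1, h2, h3, h4]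
    · rw [h1, h3] at hi; exact absurd (hi.mp rfl) (hne i)
    · rw [h1, h3] at hi; exact absurd (hi.mpr rfl) (hne i)
    · simp [h1, h2, h3, h4]
  refine hker _ (fun i => ?_) fun i => ?_
  · change ρ₁ (g.1⁻¹ * h.1) (a i) = a i
    rw [map_mul, Module.End.mul_apply, ← (heq i).1]
    exact ρ₁.inv_self_apply _ _
  · change ρ₂ (g.2⁻¹ * h.2) (b i) = b i
    rw [map_mul, Module.End.mul_apply, ← (heq i).2]
    exact ρ₂.inv_self_apply _ _

/-- The identity component of a principal isotropy group lies in the first factor if the singular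
vectors span the second space. -/
theorem isotropyZero_equiv_left [FiniteDimensional 𝕜 V₂] (c₁ : InnerProductSpace.Core 𝕜 V₁)
    (c₂ : InnerProductSpace.Core 𝕜 V₂) {ρ₁ : Representation 𝕜 G₁ V₁}
    {ρ₂ : Representation 𝕜 G₂ V₂} (h₁ : IsUnitaryFor c₁ ρ₁) (h₂ : IsUnitaryFor c₂ ρ₂)
    {r : ℕ} (hr : Module.finrank 𝕜 V₂ = r) {a : Fin r → V₁} {b : Fin r → V₂}
    (ha : OrthonormalFor c₁ a) (hb : OrthonormalFor c₂ b)
    (hs : HasSignEigenvalues ρ₁ a ∨ HasSignEigenvalues ρ₂ b)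
    {κ : L →* G₁} (hκ : Continuous κ) (hinj : Function.Injective κ)
    (hfix : StabilizerIn ρ₁ a κ) (habs : FixesUpToConj ρ₁ r κ)
    (hfaith : ∀ g, (∀ i, ρ₂ g (b i) = b i) → g = 1)
    (v : V₁ ⊗[𝕜] V₂) (hv : IsPrincipal (outerTensor ρ₁ ρ₂) v) :
    Nonempty (isotropyZero (outerTensor ρ₁ ρ₂) v ≃ₜ* L) := by
  subst hr
  refine (isotropyZero_equiv_of_singularVector c₁ c₂ h₁ h₂ ha hb hs
    ((MonoidHom.inl G₁ G₂).comp κ) ?_ ?_ ?_ (habs.exists_conj_mem_isotropy_left ρ₂) v hv).2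
  · exact (Continuous.prodMk continuous_id continuous_const).comp hκ
  · intro x y hxy
    exact hinj (congrArg Prod.fst hxy)
  · rintro ⟨g₁, g₂⟩ hg₁ hg₂
    obtain ⟨l, hl⟩ := hfix g₁ hg₁
    exact ⟨l, Prod.ext hl (hfaith _ hg₂).symm⟩

/-- The identity component of a principal isotropy group lies in the second factor if the singular
vectors span the first space. -/
theorem isotropyZero_equiv_right [FiniteDimensional 𝕜 V₁] (c₁ : InnerProductSpace.Core 𝕜 V₁)
    (c₂ : InnerProductSpace.Core 𝕜 V₂) {ρ₁ : Representation 𝕜 G₁ V₁}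
    {ρ₂ : Representation 𝕜 G₂ V₂} (h₁ : IsUnitaryFor c₁ ρ₁) (h₂ : IsUnitaryFor c₂ ρ₂)
    {r : ℕ} (hr : Module.finrank 𝕜 V₁ = r) {a : Fin r → V₁} {b : Fin r → V₂}
    (ha : OrthonormalFor c₁ a) (hb : OrthonormalFor c₂ b)
    (hs : HasSignEigenvalues ρ₁ a ∨ HasSignEigenvalues ρ₂ b)
    {κ : L →* G₂} (hκ : Continuous κ) (hinj : Function.Injective κ)
    (hfix : StabilizerIn ρ₂ b κ) (habs : FixesUpToConj ρ₂ r κ)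
    (hfaith : ∀ g, (∀ i, ρ₁ g (a i) = a i) → g = 1)
    (v : V₁ ⊗[𝕜] V₂) (hv : IsPrincipal (outerTensor ρ₁ ρ₂) v) :
    (∀ x ∈ isotropyZero (outerTensor ρ₁ ρ₂) v, (x : G₁ × G₂).1 = 1) ∧
      Nonempty (isotropyZero (outerTensor ρ₁ ρ₂) v ≃ₜ* L) := by
  subst hr
  refine And.imp_left ?_ (isotropyZero_equiv_of_singularVector c₁ c₂ h₁ h₂ ha hb hs
    ((MonoidHom.inr G₁ G₂).comp κ) ?_ ?_ ?_ (habs.exists_conj_mem_isotropy_right ρ₁) v hv)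
  · rintro ⟨g, hg⟩ x hx
    obtain ⟨l, hl⟩ := hg x hx
    rw [hl]; simp
  · exact (Continuous.prodMk continuous_const continuous_id).comp hκ
  · intro x y hxy
    exact hinj (congrArg Prod.snd hxy)
  · rintro ⟨g₁, g₂⟩ hg₁ hg₂
    obtain ⟨l, hl⟩ := hfix g₂ hg₂
    exact ⟨l, Prod.ext (hfaith _ hg₁).symm hl⟩

end Comparison

/-! ### Unitary groups over the real numbers, the complex numbers and the quaternions -/

/-- A normed division algebra with involution over the real numbers in which `star x * x` is the
real number `‖x‖²`; the three instances below are `ℝ`, `ℂ` and `ℍ`. -/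
class RealNormed (D : Type*) [NormedDivisionRing D] [StarRing D] [NormedAlgebra ℝ D] : Prop where
  star_mul_self' : ∀ x : D, star x * x = algebraMap ℝ D (‖x‖ ^ 2)
  star_algebraMap : ∀ r : ℝ, star (algebraMap ℝ D r) = algebraMap ℝ D r

instance : RealNormed ℝ where
  star_mul_self' x := by simp [pow_two]
  star_algebraMap r := by simp

instance : RealNormed ℂ where
  star_mul_self' x := by
    rw [mul_comm]
    change x * (starRingEnd ℂ) x = _
    rw [Complex.mul_conj, Complex.normSq_eq_norm_sq]; rfl
  star_algebraMap r := by simp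

instance : RealNormed ℍ[ℝ] where
  star_mul_self' x := by
    rw [Quaternion.star_mul_self, Quaternion.normSq_eq_norm_mul_self, pow_two]; rfl
  star_algebraMap r := Quaternion.star_coe r

section Unitary

set_option linter.unusedSectionVars false

variable {D : Type*} [NormedDivisionRing D] [StarRing D] [NormedAlgebra ℝ D] [RealNormed D]
  {n : ℕ}

theorem norm_star_of_realNormed (x : D) : ‖star x‖ = ‖x‖ := by
  by_cases hx : x = 0
  · simp [hx]
  · have h := congrArg norm (RealNormed.star_mul_self' x)
    rw [norm_mul, norm_algebraMap', Real.norm_of_nonneg (by positivity), pow_two] at h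
    exact mul_right_cancel₀ (norm_ne_zero_iff.mpr hx) h

theorem self_mul_star' (x : D) : x * star x = algebraMap ℝ D (‖x‖ ^ 2) := by
  have := RealNormed.star_mul_self' (star x)
  rwa [star_star, norm_star_of_realNormed] at this

theorem star_real_smul (r : ℝ) (x : D) : star (r • x) = r • star x := by
  rw [Algebra.smul_def, star_mul, RealNormed.star_algebraMap, Algebra.smul_def,
    Algebra.commutes]

theorem mem_unitary_of_norm_eq_one {q : D} (hq : ‖q‖ = 1) : q ∈ unitary D := by
  rw [Unitary.mem_iff, RealNormed.star_mul_self', self_mul_star', hq]; simp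

theorem norm_eq_one_of_mem_unitary {q : D} (hq : q ∈ unitary D) : ‖q‖ = 1 := by
  have h := congrArg norm (Unitary.star_mul_self_of_mem hq)
  rw [norm_mul, norm_star_of_realNormed, norm_one] at h
  nlinarith [norm_nonneg q]

/-- The squared norm `∑ ‖uᵢ‖²`. -/
noncomputable def sqNorm (u : Fin n → D) : ℝ := ∑ i, ‖u i‖ ^ 2

theorem star_dotProduct_self (u : Fin n → D) : star u ⬝ᵥ u = algebraMap ℝ D (sqNorm u) := by
  simp [dotProduct, sqNorm, RealNormed.star_mul_self']

theorem sqNorm_nonneg (u : Fin n → D) : 0 ≤ sqNorm u :=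
  Finset.sum_nonneg fun _ _ => by positivity

theorem sqNorm_eq_zero {u : Fin n → D} : sqNorm u = 0 ↔ u = 0 := by
  rw [sqNorm, Finset.sum_eq_zero_iff_of_nonneg fun _ _ => by positivity]
  simp [funext_iff]

theorem star_star_dotProduct (x y : Fin n → D) : star (star x ⬝ᵥ y) = star y ⬝ᵥ x := by
  simp [dotProduct, star_sum, star_mul]

/-- Unitary matrices preserve the Hermitian form `star x ⬝ᵥ y`. -/
theorem star_mulVec_dotProduct_mulVec {R : Type*} [Ring R] [StarRing R]
    {A : Matrix (Fin n) (Fin n) R} (hA : A ∈ unitary (Matrix (Fin n) (Fin n) R))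
    (x y : Fin n → R) : star (A *ᵥ x) ⬝ᵥ (A *ᵥ y) = star x ⬝ᵥ y := by
  rw [Matrix.star_mulVec, Matrix.dotProduct_mulVec, Matrix.vecMul_vecMul,
    ← Matrix.star_eq_conjTranspose, Unitary.star_mul_self_of_mem hA, Matrix.vecMul_one]

/-- The transformation that is the identity on the orthogonal complement of `u` and maps `u` to
`u q`. -/
noncomputable def quasiReflection (u : Fin n → D) (q : D) : Matrix (Fin n) (Fin n) D :=
  1 - (sqNorm u)⁻¹ • Matrix.of fun i j => u i * (1 - q) * star (u j)

theorem quasiReflection_mulVec (u : Fin n → D) (q : D) (z : Fin n → D) :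
    quasiReflection u q *ᵥ z
      = fun i => z i - (sqNorm u)⁻¹ • (u i * (1 - q) * (star u ⬝ᵥ z)) := by
  funext i
  rw [quasiReflection, Matrix.sub_mulVec, Matrix.one_mulVec, Matrix.smul_mulVec]
  simp [Matrix.mulVec, dotProduct, Finset.mul_sum, mul_assoc]

theorem quasiReflection_one (u : Fin n → D) : quasiReflection u 1 = 1 := by
  ext i j; simp [quasiReflection]

theorem star_quasiReflection (u : Fin n → D) (q : D) :
    star (quasiReflection u q) = quasiReflection u (star q) := by
  ext i j
  simp [quasiReflection, Matrix.star_apply, star_real_smul, mul_assoc, Matrix.one_apply, eq_comm,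
    apply_ite (star : D → D)]

theorem quasiReflection_mul_star {u : Fin n → D} (hu : u ≠ 0) {q : D} (hq : ‖q‖ = 1) :
    quasiReflection u q * quasiReflection u (star q) = 1 := by
  have hN : sqNorm u ≠ 0 := fun h => hu (sqNorm_eq_zero.mp h)
  refine Matrix.ext_of_mulVec_single fun k => ?_
  rw [← Matrix.mulVec_mulVec, Matrix.one_mulVec, quasiReflection_mulVec, quasiReflection_mulVec]
  funext i
  set z : Fin n → D := Pi.single k 1
  have h1 : star u ⬝ᵥ (fun i => z i - (sqNorm u)⁻¹ • (u i * (1 - star q) * (star u ⬝ᵥ z)))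
      = star q * (star u ⬝ᵥ z) := by
    have : (fun i => z i - (sqNorm u)⁻¹ • (u i * (1 - star q) * (star u ⬝ᵥ z)))
        = z - fun i => u i * ((sqNorm u)⁻¹ • ((1 - star q) * (star u ⬝ᵥ z))) := by
      funext i; simp [mul_assoc]
    rw [this, dotProduct_sub]
    have h2 : star u ⬝ᵥ (fun i => u i * ((sqNorm u)⁻¹ • ((1 - star q) * (star u ⬝ᵥ z))))
        = (star u ⬝ᵥ u) * ((sqNorm u)⁻¹ • ((1 - star q) * (star u ⬝ᵥ z))) := by
      simp only [dotProduct, Finset.sum_mul, mul_assoc]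
    rw [h2, star_dotProduct_self, ← Algebra.smul_def, smul_smul, mul_inv_cancel₀ hN, one_smul]
    noncomm_ring
  rw [h1]
  have h3 : (1 - star q) + (1 - q) * star q = 0 := by
    rw [sub_mul, self_mul_star', hq]; simp
  have h4 : (sqNorm u)⁻¹ • (u i * (1 - star q) * (star u ⬝ᵥ z))
      + (sqNorm u)⁻¹ • (u i * (1 - q) * (star q * (star u ⬝ᵥ z))) = 0 := by
    rw [← smul_add]
    have : u i * (1 - star q) * (star u ⬝ᵥ z) + u i * (1 - q) * (star q * (star u ⬝ᵥ z))
        = u i * ((1 - star q) + (1 - q) * star q) * (star u ⬝ᵥ z) := by noncomm_ring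
    rw [this, h3]; simp
  rw [sub_sub, h4, sub_zero]

theorem quasiReflection_mem_unitary {u : Fin n → D} (hu : u ≠ 0) {q : D} (hq : ‖q‖ = 1) :
    quasiReflection u q ∈ unitary (Matrix (Fin n) (Fin n) D) := by
  rw [Unitary.mem_iff, star_quasiReflection]
  refine ⟨?_, quasiReflection_mul_star hu hq⟩
  have := quasiReflection_mul_star hu (q := star q) (by rw [norm_star_of_realNormed, hq])
  rwa [star_star] at this

/-- A quasi-reflection can move the coordinates of `y` with index at least `k` to a multiple of the
`k`-th unit vector, without changing the coordinates below `k`. -/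
theorem exists_quasiReflection (k : Fin n) (y : Fin n → D) :
    ∃ (u : Fin n → D) (q : D), ‖q‖ = 1 ∧ (u = 0 → q = 1) ∧ (∀ j < k, u j = 0) ∧
      (∀ j, k < j → (quasiReflection u q *ᵥ y) j = 0) ∧
      ∃ r : ℝ, 0 ≤ r ∧ (quasiReflection u q *ᵥ y) k = algebraMap ℝ D r := by
  let t : Fin n → D := fun j => if k ≤ j then y j else 0
  let r : ℝ := Real.sqrt (sqNorm t)
  have hr : r * r = sqNorm t := Real.mul_self_sqrt (sqNorm_nonneg t)
  let e : Fin n → D := Pi.single k (algebraMap ℝ D r)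
  let u : Fin n → D := t - e
  have htail : ∀ j, k ≤ j → y j = t j := fun j hj => by simp [t, hj]
  have huj : ∀ j < k, u j = 0 := fun j hj => by
    simp [u, t, e, not_le.mpr hj, hj.ne]
  by_cases hu : u = 0
  · refine ⟨0, 1, norm_one, fun _ => rfl, fun _ _ => rfl, fun j hj => ?_, r, Real.sqrt_nonneg _, ?_⟩
    · rw [quasiReflection_one, Matrix.one_mulVec, htail j hj.le, sub_eq_zero.mp hu]
      simp [e, hj.ne']
    · rw [quasiReflection_one, Matrix.one_mulVec, htail k le_rfl, sub_eq_zero.mp hu]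
      simp [e]
  have hN : sqNorm u ≠ 0 := fun h => hu (sqNorm_eq_zero.mp h)
  set h := star u ⬝ᵥ t with hh
  have hee : star e ⬝ᵥ e = star t ⬝ᵥ t := by
    rw [star_dotProduct_self t, ← hr]
    simp [e, dotProduct, Pi.single_apply, apply_ite (star : D → D), RealNormed.star_algebraMap]
  have hsum : h + star h = algebraMap ℝ D (sqNorm u) := by
    rw [← star_dotProduct_self, hh, star_star_dotProduct]
    have h1 : star u ⬝ᵥ u = star u ⬝ᵥ t - star u ⬝ᵥ e := by rw [← dotProduct_sub]
    have h2 : star u ⬝ᵥ e = star t ⬝ᵥ e - star e ⬝ᵥ e := by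
      rw [show star u = star t - star e from star_sub _ _, sub_dotProduct]
    have h3 : star t ⬝ᵥ u = star t ⬝ᵥ t - star t ⬝ᵥ e := by rw [← dotProduct_sub]
    rw [h1, h2, h3, hee]; abel
  have hne : h ≠ 0 := by
    intro h0
    rw [h0] at hsum
    rw [star_zero, add_zero, ← map_zero (algebraMap ℝ D)] at hsum
    exact hN ((algebraMap ℝ D).injective hsum).symm
  have huy : star u ⬝ᵥ y = h := by
    rw [hh]
    refine Finset.sum_congr rfl fun j _ => ?_
    by_cases hj : k ≤ j
    · rw [htail j hj]
    · simp [huj j (not_le.mp hj)]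
  -- this `q` makes `(1 - q) h` the squared norm of `u`
  have hq : (1 - -(star h * h⁻¹)) * h = algebraMap ℝ D (sqNorm u) := by
    rw [← hsum, sub_neg_eq_add, add_mul, one_mul, mul_assoc, inv_mul_cancel₀ hne, mul_one]
  have hmap : ∀ j, (quasiReflection u (-(star h * h⁻¹)) *ᵥ y) j = y j - u j := by
    intro j
    rw [quasiReflection_mulVec]
    simp only
    rw [huy, mul_assoc, hq, ← Algebra.commutes, ← Algebra.smul_def, smul_smul, inv_mul_cancel₀ hN,
      one_smul]
  refine ⟨u, -(star h * h⁻¹), ?_, fun h => absurd h hu, huj, fun j hj => ?_, r,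
    Real.sqrt_nonneg _, ?_⟩
  · rw [norm_neg, norm_mul, norm_star_of_realNormed, norm_inv, mul_inv_cancel₀]
    exact norm_ne_zero_iff.mpr hne
  · rw [hmap, htail j hj.le]
    simp [u, e, hj.ne']
  · rw [hmap, htail k le_rfl]
    simp [u, e]

theorem quasiReflection_mulVec_of_forall {u z : Fin n → D} {k : Fin n} (q : D)
    (hu : ∀ j < k, u j = 0) (hz : ∀ j, k ≤ j → z j = 0) : quasiReflection u q *ᵥ z = z := by
  have : star u ⬝ᵥ z = 0 := by
    refine Finset.sum_eq_zero fun j _ => ?_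
    rcases lt_or_ge j k with hj | hj
    · simp [hu j hj]
    · simp [hz j hj]
  rw [quasiReflection_mulVec, this]; simp

/-- The subgroup `S` of the unitary group contains transformations as in the `QR` algorithm: for
`k < N` it can move the coordinates of a vector from index `k` on to a non-negative multiple of the
`k`-th unit vector, fixing the vectors that only have coordinates below `k`. -/
def ClearsBelow (S : Subgroup (unitary (Matrix (Fin n) (Fin n) D))) (N : ℕ) : Prop :=
  ∀ k : Fin n, (k : ℕ) < N → ∀ y : Fin n → D, ∃ s ∈ S,
    (∀ z : Fin n → D, (∀ j, k ≤ j → z j = 0) → (s : Matrix (Fin n) (Fin n) D) *ᵥ z = z) ∧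
    (∀ j, k < j → ((s : Matrix (Fin n) (Fin n) D) *ᵥ y) j = 0) ∧
    ∃ r : ℝ, 0 ≤ r ∧ ((s : Matrix (Fin n) (Fin n) D) *ᵥ y) k = algebraMap ℝ D r

/-- The `QR` decomposition. -/
theorem ClearsBelow.exists_upperTriangular {S : Subgroup (unitary (Matrix (Fin n) (Fin n) D))}
    {N : ℕ} (hS : ClearsBelow S N) (x : ℕ → Fin n → D) (M : ℕ) (hM : ∀ i < M, i < n → i < N) :
    ∃ g ∈ S, ∀ i < M, ∀ j : Fin n,
      (i < j → ((g : Matrix (Fin n) (Fin n) D) *ᵥ x i) j = 0) ∧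
      (i = j → ∃ r : ℝ, 0 ≤ r ∧ ((g : Matrix (Fin n) (Fin n) D) *ᵥ x i) j = algebraMap ℝ D r) := by
  induction M with
  | zero => exact ⟨1, S.one_mem, by simp⟩
  | succ M ih =>
    obtain ⟨g, hg, hgx⟩ := ih fun i hi => hM i (hi.trans M.lt_succ_self)
    by_cases hMn : M < n
    · obtain ⟨s, hs, hs1, hs2, hs3⟩ := hS ⟨M, hMn⟩ (hM M M.lt_succ_self hMn)
        ((g : Matrix (Fin n) (Fin n) D) *ᵥ x M)
      refine ⟨s * g, S.mul_mem hs hg, fun i hi => ?_⟩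
      rcases Nat.lt_succ_iff_lt_or_eq.mp hi with hi | rfl
      · have : ((s * g : unitary (Matrix (Fin n) (Fin n) D)) : Matrix (Fin n) (Fin n) D) *ᵥ x i
            = (g : Matrix (Fin n) (Fin n) D) *ᵥ x i := by
          rw [Submonoid.coe_mul, ← Matrix.mulVec_mulVec]
          refine hs1 _ fun j hj => (hgx i hi j).1 (lt_of_lt_of_le hi hj)
        rw [this]
        exact hgx i hi
      · rw [Submonoid.coe_mul, ← Matrix.mulVec_mulVec]
        intro j
        refine ⟨fun hj => hs2 j hj, fun hj => ?_⟩
        have : j = ⟨i, hMn⟩ := Fin.ext hj.symm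
        rw [this]; exact hs3
    · refine ⟨g, hg, fun i hi => ?_⟩
      rcases Nat.lt_succ_iff_lt_or_eq.mp hi with hi | rfl
      · exact hgx i hi
      · exact fun j => ⟨fun h => absurd (h.trans j.2) hMn, fun h => absurd (h ▸ j.2) hMn⟩

/-- A unitary matrix is the identity on the first `N` unit vectors if its first `N` columns are
upper triangular with non-negative diagonal. -/
theorem mulVec_single_of_upperTriangular {A : Matrix (Fin n) (Fin n) D}
    (hA : A ∈ unitary (Matrix (Fin n) (Fin n) D)) {N : ℕ}
    (h : ∀ i : Fin n, (i : ℕ) < N → ∀ j, (i < j → A j i = 0) ∧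
      (i = j → ∃ r : ℝ, 0 ≤ r ∧ A j i = algebraMap ℝ D r)) (i : Fin n) (hi : (i : ℕ) < N) :
    A *ᵥ Pi.single i 1 = Pi.single i 1 := by
  obtain ⟨i, hin⟩ := i
  induction i using Nat.strong_induction_on with
  | _ i ih =>
    have hoff : ∀ j : Fin n, j ≠ ⟨i, hin⟩ → A j ⟨i, hin⟩ = 0 := by
      intro j hj
      rcases lt_or_gt_of_ne hj with hlt | hgt
      · have h1 := star_mulVec_dotProduct_mulVec hA (Pi.single j 1) (Pi.single ⟨i, hin⟩ 1)
        rw [ih j hlt j.2 (lt_trans hlt hi)] at h1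
        have e1 : star (Pi.single j (1 : D)) = (Pi.single j 1 : Fin n → D) := by
          funext l; simp [Pi.single_apply, apply_ite (star : D → D)]
        rw [e1, single_one_dotProduct, single_one_dotProduct, Matrix.mulVec_single_one] at h1
        simpa [Pi.single_apply, hj] using h1
      · exact (h ⟨i, hin⟩ hi j).1 hgt
    obtain ⟨r, hr0, hr⟩ := (h ⟨i, hin⟩ hi ⟨i, hin⟩).2 rfl
    have hcol : A *ᵥ Pi.single ⟨i, hin⟩ 1 = Pi.single ⟨i, hin⟩ (algebraMap ℝ D r) := by
      funext j
      rw [Matrix.mulVec_single_one]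
      by_cases hj : j = ⟨i, hin⟩
      · subst hj; simpa using hr
      · simpa [Pi.single_apply, hj] using hoff j hj
    have h1 := star_mulVec_dotProduct_mulVec hA (Pi.single ⟨i, hin⟩ 1) (Pi.single ⟨i, hin⟩ 1)
    rw [hcol, star_dotProduct_self, star_dotProduct_self] at h1
    have h2 : sqNorm (Pi.single (⟨i, hin⟩ : Fin n) (algebraMap ℝ D r))
        = sqNorm (Pi.single (⟨i, hin⟩ : Fin n) (1 : D)) :=
      (algebraMap ℝ D).injective h1
    have h3 : ∀ d : D, sqNorm (Pi.single (⟨i, hin⟩ : Fin n) d) = ‖d‖ ^ 2 := by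
      intro d
      rw [sqNorm, Finset.sum_eq_single ⟨i, hin⟩]
      · simp
      · intro j _ hj; simp [hj]
      · simp
    rw [h3, h3, norm_algebraMap', norm_one, Real.norm_of_nonneg hr0] at h2
    have : r = 1 := by nlinarith
    rw [hcol, this, map_one]

end Unitary

/-! ### Compactness and connectedness of the classical groups -/

section Topology

set_option linter.unusedSectionVars false

variable {D : Type*} [NormedDivisionRing D] [StarRing D] [NormedAlgebra ℝ D] [RealNormed D]
  [ContinuousStar D] {n : ℕ}

theorem sqNorm_mulVec_of_mem_unitary {A : Matrix (Fin n) (Fin n) D}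
    (hA : A ∈ unitary (Matrix (Fin n) (Fin n) D)) (x : Fin n → D) :
    sqNorm (A *ᵥ x) = sqNorm x := by
  have h := star_mulVec_dotProduct_mulVec hA x x
  rw [star_dotProduct_self, star_dotProduct_self] at h
  exact (algebraMap ℝ D).injective h

theorem sqNorm_single (i : Fin n) (d : D) : sqNorm (Pi.single i d : Fin n → D) = ‖d‖ ^ 2 := by
  rw [sqNorm, Finset.sum_eq_single i]
  · simp
  · intro j _ hj; simp [hj]
  · simp

theorem norm_apply_le_one_of_mem_unitary {A : Matrix (Fin n) (Fin n) D}
    (hA : A ∈ unitary (Matrix (Fin n) (Fin n) D)) (i j : Fin n) : ‖A i j‖ ≤ 1 := by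
  have h := sqNorm_mulVec_of_mem_unitary hA (Pi.single j 1)
  rw [sqNorm_single, norm_one, one_pow, sqNorm] at h
  have h1 := Finset.single_le_sum (f := fun l => ‖(A *ᵥ Pi.single j 1) l‖ ^ 2)
    (fun _ _ => by positivity) (Finset.mem_univ i)
  rw [h, Matrix.mulVec_single_one] at h1
  have h2 : ‖A i j‖ ^ 2 ≤ 1 := h1
  nlinarith [norm_nonneg (A i j)]

instance [FiniteDimensional ℝ D] : CompactSpace (unitary (Matrix (Fin n) (Fin n) D)) := by
  have : ProperSpace D := FiniteDimensional.proper ℝ D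
  refine isCompact_iff_compactSpace.mp ?_
  have hc : IsCompact (Set.pi Set.univ fun _ : Fin n => Set.pi Set.univ fun _ : Fin n =>
      Metric.closedBall (0 : D) 1) :=
    isCompact_univ_pi fun _ => isCompact_univ_pi fun _ => isCompact_closedBall _ _
  refine IsCompact.of_isClosed_subset (X := Matrix (Fin n) (Fin n) D) hc (isClosed_unitary) ?_
  intro A hA i _ j _
  simpa using norm_apply_le_one_of_mem_unitary hA i j

instance [FiniteDimensional ℝ D] : CompactSpace (unitary D) := by
  have : ProperSpace D := FiniteDimensional.proper ℝ D
  refine isCompact_iff_compactSpace.mp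
    (IsCompact.of_isClosed_subset (isCompact_closedBall 0 1) (isClosed_unitary) ?_)
  intro q hq
  simpa using (norm_eq_one_of_mem_unitary hq).le

theorem coe_unitary_eq_sphere : (unitary D : Set D) = Metric.sphere 0 1 := by
  ext q
  simp only [SetLike.mem_coe, mem_sphere_iff_norm, sub_zero]
  exact ⟨norm_eq_one_of_mem_unitary, mem_unitary_of_norm_eq_one⟩

theorem connectedSpace_unitary (hD : 1 < Module.rank ℝ D) : ConnectedSpace (unitary D) := by
  refine isConnected_iff_connectedSpace.mp ?_
  rw [coe_unitary_eq_sphere]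
  exact isConnected_sphere hD 0 zero_le_one

/-- Over `ℂ` and `ℍ` the quasi-reflections, hence all upper triangular forms, can be found in the
identity component. -/
theorem clearsBelow_connectedComponentOfOne (hD : 1 < Module.rank ℝ D) :
    ClearsBelow (Subgroup.connectedComponentOfOne (unitary (Matrix (Fin n) (Fin n) D))) n := by
  intro k _ y
  obtain ⟨u, q, hq, huq, hu, h1, h2⟩ := exists_quasiReflection k y
  by_cases hu0 : u = 0
  · rw [huq hu0, quasiReflection_one] at h1 h2
    exact ⟨1, Subgroup.one_mem _, fun z _ => Matrix.one_mulVec z, h1, h2⟩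
  refine ⟨⟨_, quasiReflection_mem_unitary hu0 hq⟩, ?_,
    fun z hz => quasiReflection_mulVec_of_forall q hu hz, h1, h2⟩
  have := connectedSpace_unitary hD
  have hcont : Continuous fun p : unitary D =>
      (⟨_, quasiReflection_mem_unitary hu0 (norm_eq_one_of_mem_unitary p.2)⟩ :
        unitary (Matrix (Fin n) (Fin n) D)) := by
    refine Continuous.subtype_mk ?_ _
    unfold quasiReflection
    fun_prop
  exact (isPreconnected_range hcont).subset_connectedComponent (x := 1)
    ⟨1, Subtype.ext (quasiReflection_one u)⟩ ⟨⟨q, mem_unitary_of_norm_eq_one hq⟩, rfl⟩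

theorem connectedSpace_of_connectedComponentOfOne_eq_top {G : Type*} [TopologicalSpace G] [Group G]
    [IsTopologicalGroup G] (h : ∀ g, g ∈ Subgroup.connectedComponentOfOne G) :
    ConnectedSpace G := by
  refine connectedSpace_iff_connectedComponent.mpr ⟨1, ?_⟩
  exact Set.eq_univ_of_forall h

theorem eq_one_of_mulVec_single {R : Type*} [Semiring R] {A : Matrix (Fin n) (Fin n) R}
    (h : ∀ i, A *ᵥ Pi.single i 1 = Pi.single i 1) : A = 1 :=
  Matrix.ext_of_mulVec_single fun i => by rw [h, Matrix.one_mulVec]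

/-- Unitary groups over `ℂ` and `ℍ` are connected. -/
theorem connectedSpace_unitary_matrix (hD : 1 < Module.rank ℝ D) :
    ConnectedSpace (unitary (Matrix (Fin n) (Fin n) D)) := by
  refine connectedSpace_of_connectedComponentOfOne_eq_top fun g => ?_
  obtain ⟨h, hh, hx⟩ := (clearsBelow_connectedComponentOfOne (n := n) hD).exists_upperTriangular
    (fun i => if hi : i < n then (g : Matrix (Fin n) (Fin n) D) *ᵥ Pi.single ⟨i, hi⟩ 1 else 0) n
    (fun i hi _ => hi)
  have h1 : ((h * g : unitary (Matrix (Fin n) (Fin n) D)) : Matrix (Fin n) (Fin n) D) = 1 := by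
    refine eq_one_of_mulVec_single fun i => ?_
    refine mulVec_single_of_upperTriangular (h * g).2 (N := n) (fun i hi j => ?_) i i.2
    have := hx i i.2 j
    rw [dif_pos i.2, Matrix.mulVec_mulVec, Matrix.mulVec_single_one] at this
    exact ⟨fun h => this.1 h, fun h => this.2 (congrArg _ h)⟩
  have h2 : h * g = 1 := Subtype.ext h1
  rw [eq_inv_of_mul_eq_one_right h2]
  exact Subgroup.inv_mem _ hh

end Topology

section SpecialOrthogonal

variable {n : ℕ}

/-- The inclusion of `SO(n)` in the orthogonal group. -/
def SO.toUnitary (n : ℕ) : SO n →* unitary (Matrix (Fin n) (Fin n) ℝ) where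
  toFun g := ⟨g, g.2.1⟩
  map_one' := rfl
  map_mul' _ _ := rfl

theorem SO.mem_iff {A : Matrix (Fin n) (Fin n) ℝ} :
    A ∈ SO n ↔ A ∈ unitary (Matrix (Fin n) (Fin n) ℝ) ∧ A.det = 1 :=
  Matrix.mem_specialOrthogonalGroup_iff

instance : CompactSpace (SO n) := by
  have h : IsCompact (unitary (Matrix (Fin n) (Fin n) ℝ) : Set (Matrix (Fin n) (Fin n) ℝ)) :=
    isCompact_iff_compactSpace.mpr
      (inferInstanceAs (CompactSpace (unitary (Matrix (Fin n) (Fin n) ℝ))))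
  refine isCompact_iff_compactSpace.mp
    (h.of_isClosed_subset (t := SO n) ?_ fun A hA => (SO.mem_iff.mp hA).1)
  have : (SO n : Set (Matrix (Fin n) (Fin n) ℝ))
      = (unitary (Matrix (Fin n) (Fin n) ℝ) : Set _) ∩ {A | Matrix.det A = 1} := by
    ext A; exact SO.mem_iff
  rw [this]
  exact (isClosed_unitary).inter (isClosed_eq (by fun_prop) continuous_const)

theorem det_quasiReflection_neg_one {u : Fin n → ℝ} (hu : u ≠ 0) :
    (quasiReflection u (-1)).det = -1 := by
  have hN : sqNorm u ≠ 0 := fun h => hu (sqNorm_eq_zero.mp h)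
  have : quasiReflection u (-1)
      = 1 + Matrix.replicateCol Unit (fun i => -((sqNorm u)⁻¹ * 2) * u i)
        * Matrix.replicateRow Unit u := by
    ext i j
    simp [quasiReflection, Matrix.mul_apply]
    ring
  rw [this, Matrix.det_one_add_replicateCol_mul_replicateRow]
  have h2 : u ⬝ᵥ u = sqNorm u := by simpa using star_dotProduct_self u
  have h3 : u ⬝ᵥ (fun i => -((sqNorm u)⁻¹ * 2) * u i) = -((sqNorm u)⁻¹ * 2) * (u ⬝ᵥ u) := by
    simp only [dotProduct, Finset.mul_sum]
    exact Finset.sum_congr rfl fun i _ => by ring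
  rw [h3, h2]
  field_simp
  norm_num

/-- In the identity component of `SO(n)` all but the last column can be brought into upper
triangular form, by products of two reflections. -/
theorem clearsBelow_SO :
    ClearsBelow ((Subgroup.connectedComponentOfOne (SO n)).map (SO.toUnitary n)) (n - 1) := by
  intro k hk y
  obtain ⟨u, q, hq, huq, hu, h1, h2⟩ := exists_quasiReflection k y
  have hq' : q = 1 ∨ q = -1 := by
    rw [Real.norm_eq_abs] at hq
    exact eq_or_eq_neg_of_abs_eq hq
  rcases hq' with rfl | rfl
  · rw [quasiReflection_one] at h1 h2
    exact ⟨1, Subgroup.one_mem _, fun z _ => Matrix.one_mulVec z, h1, h2⟩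
  have hu0 : u ≠ 0 := fun h => by have := huq h; norm_num at this
  -- the reflection in the next unit vector corrects the determinant
  let k' : Fin n := ⟨k + 1, by omega⟩
  have hkk' : k < k' := Fin.lt_def.mpr (Nat.lt_succ_self _)
  let e : Fin n → ℝ := Pi.single k' 1
  have he : e ≠ 0 := by simp [e]
  have hmem : ∀ v : Fin n → ℝ, v ≠ 0 → quasiReflection e (-1) * quasiReflection v (-1) ∈ SO n := by
    intro v hv
    refine SO.mem_iff.mpr ⟨mul_mem (quasiReflection_mem_unitary he (by simp))
      (quasiReflection_mem_unitary hv (by simp)), ?_⟩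
    rw [Matrix.det_mul, det_quasiReflection_neg_one he, det_quasiReflection_neg_one hv]; norm_num
  have hez : ∀ z : Fin n → ℝ, (∀ j, k < j → z j = 0) → quasiReflection e (-1) *ᵥ z = z := by
    intro z hz
    refine quasiReflection_mulVec_of_forall (k := k') _ (fun j hj => ?_) fun j hj => ?_
    · simp [e, hj.ne]
    · exact hz j (lt_of_lt_of_le hkk' hj)
  have hey : (quasiReflection e (-1) * quasiReflection u (-1)) *ᵥ y
      = quasiReflection u (-1) *ᵥ y := by
    rw [← Matrix.mulVec_mulVec, hez _ h1]
  refine ⟨SO.toUnitary n ⟨_, hmem u hu0⟩, ⟨_, ?_, rfl⟩, fun z hz => ?_, ?_, ?_⟩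
  -- moving `u` to `e` through non-zero vectors connects the product of reflections to the identity
  · have hrank : 1 < Module.rank ℝ (Fin n → ℝ) := by
      rw [rank_fin_fun]
      exact_mod_cast (by omega : 1 < n)
    have hconn : ConnectedSpace ({0}ᶜ : Set (Fin n → ℝ)) :=
      isConnected_iff_connectedSpace.mp (isConnected_compl_singleton_of_one_lt_rank hrank 0)
    have hcont : Continuous fun v : ({0}ᶜ : Set (Fin n → ℝ)) => (⟨_, hmem v v.2⟩ : SO n) := by
      refine Continuous.subtype_mk ?_ _
      refine continuous_const.mul ?_
      have hN : ∀ v : ({0}ᶜ : Set (Fin n → ℝ)), sqNorm (v : Fin n → ℝ) ≠ 0 := fun v h =>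
        v.2 (sqNorm_eq_zero.mp h)
      have hNc : Continuous fun v : ({0}ᶜ : Set (Fin n → ℝ)) => (sqNorm (v : Fin n → ℝ))⁻¹ := by
        refine Continuous.inv₀ ?_ hN
        exact continuous_finsetSum _ fun i _ =>
          (((continuous_apply i).comp continuous_subtype_val).norm.pow 2)
      unfold quasiReflection
      refine continuous_const.sub (hNc.smul ?_)
      refine continuous_matrix fun i j => ?_
      have hc : ∀ l, Continuous fun v : ({0}ᶜ : Set (Fin n → ℝ)) => (v : Fin n → ℝ) l :=
        fun l => (continuous_apply l).comp continuous_subtype_val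
      exact ((hc i).mul continuous_const).mul (hc j).star
    refine (isPreconnected_range hcont).subset_connectedComponent (x := 1)
      ⟨⟨e, he⟩, Subtype.ext ?_⟩ ⟨⟨u, hu0⟩, rfl⟩
    have := quasiReflection_mul_star he (q := (-1 : ℝ)) (by simp)
    simpa using this
  · change (quasiReflection e (-1) * quasiReflection u (-1)) *ᵥ z = z
    rw [← Matrix.mulVec_mulVec, quasiReflection_mulVec_of_forall _ hu hz,
      hez _ fun j hj => hz j hj.le]
  · intro j hj
    exact (congrFun hey j).trans (h1 j hj)
  · obtain ⟨r, hr, h⟩ := h2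
    exact ⟨r, hr, (congrFun hey k).trans h⟩

/-- `SO(n)` is connected. -/
instance : ConnectedSpace (SO n) := by
  refine connectedSpace_of_connectedComponentOfOne_eq_top fun g => ?_
  obtain ⟨_, ⟨h, hh, rfl⟩, hx⟩ := (clearsBelow_SO (n := n)).exists_upperTriangular
    (fun i => if hi : i < n then (g : Matrix (Fin n) (Fin n) ℝ) *ᵥ Pi.single ⟨i, hi⟩ 1 else 0)
    (n - 1) (fun i hi _ => hi)
  set A : Matrix (Fin n) (Fin n) ℝ := ((h * g : SO n) : Matrix (Fin n) (Fin n) ℝ) with hA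
  have hAu : A ∈ unitary (Matrix (Fin n) (Fin n) ℝ) := (SO.mem_iff.mp (h * g).2).1
  have hAd : A.det = 1 := (SO.mem_iff.mp (h * g).2).2
  have htri : ∀ i : Fin n, (i : ℕ) < n - 1 → ∀ j, (i < j → A j i = 0) ∧
      (i = j → ∃ r : ℝ, 0 ≤ r ∧ A j i = algebraMap ℝ ℝ r) := by
    intro i hi j
    have := hx i hi j
    rw [dif_pos i.2, Matrix.mulVec_mulVec, Matrix.mulVec_single_one] at this
    exact ⟨fun h => this.1 h, fun h => this.2 (congrArg _ h)⟩
  have hcol := mulVec_single_of_upperTriangular hAu htri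
  have hent : ∀ i j : Fin n, (i : ℕ) < n - 1 → A j i = if j = i then 1 else 0 := by
    intro i j hi
    have := congrFun (hcol i hi) j
    rwa [Matrix.mulVec_single_one, Matrix.col_apply, Pi.single_apply] at this
  have h1 : A = 1 := by
    refine eq_one_of_mulVec_single fun i => ?_
    refine mulVec_single_of_upperTriangular hAu (N := n) (fun i _ j => ?_) i i.2
    by_cases hi : (i : ℕ) < n - 1
    · exact htri i hi j
    refine ⟨fun hij => ?_, ?_⟩
    · have := j.2; have := Fin.lt_def.mp hij; omega
    -- the last diagonal entry is the determinant, as `A` is upper triangular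
    rintro rfl
    have htriA : A.BlockTriangular id := by
      intro a b hab
      have hb : (b : ℕ) < n - 1 := by
        have := a.2; have := Fin.lt_def.mp hab; simp only [id] at this; omega
      rw [hent b a hb, if_neg (show a ≠ b from ne_of_gt hab)]
    rw [Matrix.det_of_isUpperTriangular htriA, Finset.prod_eq_single i] at hAd
    · exact ⟨1, zero_le_one, by simpa using hAd⟩
    · intro b _ hb
      have hb' : (b : ℕ) < n - 1 := by
        have := b.2; have := i.2
        have : (b : ℕ) ≠ i := fun h => hb (Fin.ext h)
        omega
      rw [hent b b hb', if_pos rfl]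
    · simp
  have h2 : h * g = 1 := Subtype.ext h1
  rw [eq_inv_of_mul_eq_one_right h2]
  exact Subgroup.inv_mem _ hh

end SpecialOrthogonal

instance (n : ℕ) : ConnectedSpace (U n) :=
  connectedSpace_unitary_matrix (D := ℂ) (by simp)

theorem one_lt_rank_quaternion : 1 < Module.rank ℝ ℍ[ℝ] := by
  rw [Quaternion.rank_eq_four]; norm_num

instance (n : ℕ) : ConnectedSpace (Sp n) :=
  connectedSpace_unitary_matrix one_lt_rank_quaternion

instance : ConnectedSpace U1 := connectedSpace_unitary (by simp)

instance : ConnectedSpace Sp1 := connectedSpace_unitary one_lt_rank_quaternion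

instance (n : ℕ) : CompactSpace (U n) :=
  inferInstanceAs (CompactSpace (unitary (Matrix (Fin n) (Fin n) ℂ)))

section CentralProduct

variable (A B : Type*) [Group A] [HasDistribNeg A] [Group B] [HasDistribNeg B]
  [TopologicalSpace A] [TopologicalSpace B] [T2Space A] [T2Space B]

theorem diagNeg_eq (A B : Type*) [Group A] [HasDistribNeg A] [Group B] [HasDistribNeg B]
    {x : A × B} : x ∈ diagNeg A B ↔ x = 1 ∨ x = -1 := by
  constructor
  · intro hx
    obtain ⟨j, rfl⟩ := Subgroup.mem_zpowers_iff.mp hx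
    have h2 : ((-1, -1) : A × B) ^ (2 : ℤ) = 1 := by
      ext <;> simp
    rcases Int.even_or_odd' j with ⟨i, rfl | rfl⟩
    · left; rw [zpow_mul, h2, one_zpow]
    · right; rw [zpow_add, zpow_mul, h2, one_zpow, one_mul, zpow_one]; rfl
  · rintro (rfl | rfl)
    · exact one_mem _
    · exact Subgroup.mem_zpowers _

instance isClosed_diagNeg : IsClosed (diagNeg A B : Set (A × B)) := by
  have : (diagNeg A B : Set (A × B)) = {1, -1} := by
    ext x; simpa using diagNeg_eq A B
  rw [this]
  exact (Set.toFinite _).isClosed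

end CentralProduct

instance (n : ℕ) : ConnectedSpace (U1Sp n) :=
  (QuotientGroup.mk_surjective (s := diagNeg U1 (Sp n))).connectedSpace QuotientGroup.continuous_mk

/-! ### Block subgroups -/

section Block

variable {D : Type*} [NormedDivisionRing D] [StarRing D] {n : ℕ}

/-- The indices from `r` on are a copy of `Fin (n - r)`. -/
def upperIndexEquiv (r n : ℕ) : Fin (n - r) ≃ {i : Fin n // ¬ (i : ℕ) < r} where
  toFun j := ⟨⟨(j : ℕ) + r, by omega⟩, by simp⟩
  invFun i := ⟨(i.1 : ℕ) - r, by have := i.1.2; have := i.2; omega⟩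
  left_inv j := by ext; simp
  right_inv i := by ext; have := i.2; simp; omega

/-- `Fin n` is the disjoint union of the indices below `r` and a copy of `Fin (n - r)`. -/
def blockEquiv (r n : ℕ) : {i : Fin n // (i : ℕ) < r} ⊕ Fin (n - r) ≃ Fin n :=
  (Equiv.sumCongr (Equiv.refl _) (upperIndexEquiv r n)).trans
    (Equiv.sumCompl fun i : Fin n => (i : ℕ) < r)

theorem blockEquiv_inl (r n : ℕ) (i : {i : Fin n // (i : ℕ) < r}) :
    blockEquiv r n (Sum.inl i) = i := rfl

theorem le_blockEquiv_inr (r n : ℕ) (j : Fin (n - r)) : r ≤ (blockEquiv r n (Sum.inr j) : ℕ) :=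
  Nat.le_add_left r j

/-- The block matrix with diagonal entries `d i` for `i < r` and lower right block `B`. -/
def blockMatrix {R : Type*} [Zero R] (r : ℕ) (d : Fin n → R)
    (B : Matrix (Fin (n - r)) (Fin (n - r)) R) : Matrix (Fin n) (Fin n) R :=
  Matrix.reindex (blockEquiv r n) (blockEquiv r n)
    (Matrix.fromBlocks (Matrix.diagonal fun i => d i) 0 0 B)

section

variable {R : Type*} [Ring R] {r : ℕ}

theorem blockMatrix_mul (d d' : Fin n → R) (B B' : Matrix (Fin (n - r)) (Fin (n - r)) R) :
    blockMatrix r d B * blockMatrix r d' B' = blockMatrix r (d * d') (B * B') := by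
  simp [blockMatrix, Matrix.fromBlocks_multiply]

theorem blockMatrix_one : blockMatrix r (1 : Fin n → R) 1 = 1 := by
  simp only [blockMatrix, Pi.one_apply, Matrix.diagonal_one, Matrix.fromBlocks_one]
  simp

theorem star_blockMatrix [StarRing R] (d : Fin n → R) (B : Matrix (Fin (n - r)) (Fin (n - r)) R) :
    star (blockMatrix r d B) = blockMatrix r (star d) (star B) := by
  simp [blockMatrix, Matrix.star_eq_conjTranspose, Matrix.fromBlocks_conjTranspose,
    Matrix.diagonal_conjTranspose]
  rfl

theorem blockMatrix_apply (d : Fin n → R) (B : Matrix (Fin (n - r)) (Fin (n - r)) R) (i j : Fin n)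
    (h : (i : ℕ) < r ∨ (j : ℕ) < r) : blockMatrix r d B i j = if i = j then d i else 0 := by
  obtain ⟨i, rfl⟩ := (blockEquiv r n).surjective i
  obtain ⟨j, rfl⟩ := (blockEquiv r n).surjective j
  rcases i with i | i <;> rcases j with j | j
  · rw [blockMatrix, Matrix.reindex_apply, Matrix.submatrix_apply, Equiv.symm_apply_apply,
      Equiv.symm_apply_apply, Matrix.fromBlocks_apply₁₁, Matrix.diagonal_apply, blockEquiv_inl,
      blockEquiv_inl]
    simp only [Subtype.ext_iff]
  · simp [blockMatrix]
  · simp [blockMatrix]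
  · exact absurd h (by have := le_blockEquiv_inr r n i; have := le_blockEquiv_inr r n j; omega)

theorem blockMatrix_mulVec (d : Fin n → R) (B : Matrix (Fin (n - r)) (Fin (n - r)) R)
    {z : Fin n → R} (hz : ∀ j : Fin n, r ≤ j → z j = 0) :
    blockMatrix r d B *ᵥ z = d * z := by
  funext i
  simp only [Matrix.mulVec, dotProduct, Pi.mul_apply]
  rw [Finset.sum_eq_single i]
  · by_cases hi : (i : ℕ) < r
    · rw [blockMatrix_apply _ _ _ _ (Or.inl hi), if_pos rfl]
    · rw [hz i (not_lt.mp hi)]; simp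
  · intro j _ hj
    by_cases hjr : (j : ℕ) < r
    · rw [blockMatrix_apply _ _ _ _ (Or.inr hjr), if_neg hj.symm, zero_mul]
    · rw [hz j (not_lt.mp hjr)]; simp
  · simp

theorem exists_eq_blockMatrix (d : Fin n → R) {A : Matrix (Fin n) (Fin n) R}
    (hA : ∀ i j : Fin n, (i : ℕ) < r ∨ (j : ℕ) < r → A i j = if i = j then d i else 0) :
    ∃ B, A = blockMatrix r d B := by
  refine ⟨Matrix.of fun i j => A (blockEquiv r n (Sum.inr i)) (blockEquiv r n (Sum.inr j)), ?_⟩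
  ext i j
  by_cases h : (i : ℕ) < r ∨ (j : ℕ) < r
  · rw [hA i j h, blockMatrix_apply _ _ _ _ h]
  · obtain ⟨i, rfl⟩ := (blockEquiv r n).surjective i
    obtain ⟨j, rfl⟩ := (blockEquiv r n).surjective j
    rcases i with i | i <;> rcases j with j | j
    · exact absurd (Or.inl (blockEquiv_inl r n i ▸ i.2)) h
    · exact absurd (Or.inl (blockEquiv_inl r n i ▸ i.2)) h
    · exact absurd (Or.inr (blockEquiv_inl r n j ▸ j.2)) h
    · simp [blockMatrix]

theorem blockMatrix_inj {d d' : Fin n → R} {B B' : Matrix (Fin (n - r)) (Fin (n - r)) R}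
    (h : blockMatrix r d B = blockMatrix r d' B') : B = B' :=
  (Matrix.fromBlocks_inj.mp ((Matrix.reindex _ _).injective h)).2.2.2

theorem det_blockMatrix {R : Type*} [CommRing R] (B : Matrix (Fin (n - r)) (Fin (n - r)) R) :
    (blockMatrix r (1 : Fin n → R) B).det = B.det := by
  rw [blockMatrix, Matrix.det_reindex_self, Matrix.det_fromBlocks_zero₂₁]
  simp

theorem blockMatrix_mem_unitary [StarRing R] {d : Fin n → R} (hd : ∀ i, d i ∈ unitary R)
    {B : Matrix (Fin (n - r)) (Fin (n - r)) R} (hB : B ∈ unitary (Matrix _ _ R)) :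
    blockMatrix r d B ∈ unitary (Matrix (Fin n) (Fin n) R) := by
  have h1 : star d * d = 1 := funext fun i => Unitary.star_mul_self_of_mem (hd i)
  have h2 : d * star d = 1 := funext fun i => Unitary.mul_star_self_of_mem (hd i)
  rw [Unitary.mem_iff, star_blockMatrix, blockMatrix_mul, blockMatrix_mul, h1, h2,
    Unitary.star_mul_self_of_mem hB, Unitary.mul_star_self_of_mem hB, blockMatrix_one]
  exact ⟨rfl, rfl⟩

theorem blockMatrix_mem_unitary_iff [StarRing R] {d : Fin n → R}
    {B : Matrix (Fin (n - r)) (Fin (n - r)) R}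
    (h : blockMatrix r d B ∈ unitary (Matrix (Fin n) (Fin n) R)) : B ∈ unitary (Matrix _ _ R) := by
  obtain ⟨h1, h2⟩ := Unitary.mem_iff.mp h
  rw [star_blockMatrix, blockMatrix_mul, ← blockMatrix_one] at h1 h2
  exact Unitary.mem_iff.mpr ⟨blockMatrix_inj h1, blockMatrix_inj h2⟩

/-- The block diagonal embedding. The entries `d i` with `r ≤ i` do not matter. -/
def blockHom (R : Type*) [Ring R] [StarRing R] (r n : ℕ) :
    (Fin n → unitary R) × unitary (Matrix (Fin (n - r)) (Fin (n - r)) R) →*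
      unitary (Matrix (Fin n) (Fin n) R) where
  toFun p := ⟨blockMatrix r (fun i => (p.1 i : R)) p.2,
    blockMatrix_mem_unitary (fun i => (p.1 i).2) p.2.2⟩
  map_one' := Subtype.ext blockMatrix_one
  map_mul' p q := Subtype.ext (by
    rw [Submonoid.coe_mul]
    exact (blockMatrix_mul (fun i => (p.1 i : R)) (fun i => (q.1 i : R))
      (p.2 : Matrix (Fin (n - r)) (Fin (n - r)) R) q.2).symm)

theorem continuous_blockHom [StarRing R] [TopologicalSpace R] : Continuous (blockHom R r n) := by
  refine Continuous.subtype_mk ?_ _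
  unfold blockMatrix
  refine Continuous.matrix_submatrix (Continuous.matrix_fromBlocks ?_ continuous_const
    continuous_const ?_) _ _
  · refine Continuous.matrix_diagonal (continuous_pi fun i => ?_)
    exact continuous_subtype_val.comp ((continuous_apply _).comp continuous_fst)
  · exact continuous_subtype_val.comp continuous_snd

/-- A unitary matrix that multiplies the first `r` unit vectors by scalars `d i` is block
diagonal. -/
theorem exists_eq_blockHom [StarRing R] {g : unitary (Matrix (Fin n) (Fin n) R)}
    (d : Fin n → unitary R)
    (h : ∀ i : Fin n, (i : ℕ) < r →
      (g : Matrix (Fin n) (Fin n) R) *ᵥ Pi.single i 1 = Pi.single i (d i : R)) :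
    ∃ B, g = blockHom R r n (d, B) := by
  have hcol : ∀ i j : Fin n, (j : ℕ) < r → (g : Matrix (Fin n) (Fin n) R) i j
      = if i = j then (d i : R) else 0 := by
    intro i j hj
    have := congrFun (h j hj) i
    rw [Matrix.mulVec_single_one, Matrix.col_apply, Pi.single_apply] at this
    rw [this]
    split_ifs with hij
    · rw [hij]
    · rfl
  have hrow : ∀ i j : Fin n, (i : ℕ) < r → (g : Matrix (Fin n) (Fin n) R) i j
      = if i = j then (d i : R) else 0 := by
    intro i j hi
    by_cases hij : i = j
    · rw [hcol i j (hij ▸ hi)]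
    -- the inverse multiplies the unit vectors by the inverse scalars, and is the adjoint
    have h1 := congrArg (fun z => star (g : Matrix (Fin n) (Fin n) R) *ᵥ z) (h i hi)
    simp only [Matrix.mulVec_mulVec] at h1
    rw [Unitary.coe_star_mul_self, Matrix.one_mulVec] at h1
    have h2 := congrFun h1 j
    rw [Matrix.mulVec_single, Pi.single_apply, if_neg (Ne.symm hij)] at h2
    have h3 : star ((g : Matrix (Fin n) (Fin n) R) i j) * (d i : R) = 0 := by
      simpa [Matrix.star_apply] using h2.symm
    have h4 : star ((g : Matrix (Fin n) (Fin n) R) i j) = 0 := by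
      have := congrArg (· * star (d i : R)) h3
      simpa [mul_assoc] using this
    rw [if_neg hij, ← star_star ((g : Matrix (Fin n) (Fin n) R) i j), h4, star_zero]
  obtain ⟨B, hB⟩ := exists_eq_blockMatrix (r := r) (fun i => (d i : R))
    (A := (g : Matrix (Fin n) (Fin n) R))
    (fun i j hij => hij.elim (hrow i j) (hcol i j))
  exact ⟨⟨B, blockMatrix_mem_unitary_iff (hB ▸ g.2)⟩, Subtype.ext hB⟩

/-- The embedding of a smaller unitary group as the subgroup fixing the first `r` unit vectors. It
is trivial if `n ≤ r`. -/
def lowerBlock (R : Type*) [Ring R] [StarRing R] (r n : ℕ) :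
    unitary (Matrix (Fin (n - r)) (Fin (n - r)) R) →* unitary (Matrix (Fin n) (Fin n) R) :=
  (blockHom R r n).comp (MonoidHom.inr _ _)

theorem coe_lowerBlock [StarRing R] (B : unitary (Matrix (Fin (n - r)) (Fin (n - r)) R)) :
    (lowerBlock R r n B : Matrix (Fin n) (Fin n) R) = blockMatrix r 1 B := rfl

theorem continuous_lowerBlock [StarRing R] [TopologicalSpace R] :
    Continuous (lowerBlock R r n) :=
  continuous_blockHom.comp (Continuous.prodMk continuous_const continuous_id)

theorem lowerBlock_injective [StarRing R] : Function.Injective (lowerBlock R r n) := by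
  intro A B h
  have h' := congrArg Subtype.val h
  rw [coe_lowerBlock, coe_lowerBlock] at h'
  exact Subtype.ext (blockMatrix_inj h')

theorem mem_range_lowerBlock [StarRing R] {g : unitary (Matrix (Fin n) (Fin n) R)}
    (h : ∀ i : Fin n, (i : ℕ) < r →
      (g : Matrix (Fin n) (Fin n) R) *ᵥ Pi.single i 1 = Pi.single i 1) :
    g ∈ (lowerBlock R r n).range := by
  obtain ⟨B, hB⟩ := exists_eq_blockHom (r := r) (1 : Fin n → unitary R) (g := g) (by simpa using h)
  exact ⟨B, hB.symm⟩

end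

/-- Any `r` vectors are fixed by a conjugate of the block subgroup. -/
theorem ClearsBelow.exists_conj_fixes {S : Subgroup (unitary (Matrix (Fin n) (Fin n) D))} {N : ℕ}
    [NormedAlgebra ℝ D] [RealNormed D] (hS : ClearsBelow S N) {r : ℕ} (hr : ∀ i < r, i < n → i < N)
    (x : Fin r → Fin n → D) :
    ∃ g ∈ S, ∀ (B : Matrix (Fin (n - r)) (Fin (n - r)) D) (i : Fin r),
      (g : Matrix (Fin n) (Fin n) D) *ᵥ (blockMatrix r 1 B *ᵥ
        ((g⁻¹ : unitary (Matrix (Fin n) (Fin n) D)) : Matrix (Fin n) (Fin n) D) *ᵥ x i) = x i := by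
  obtain ⟨g, hg, h⟩ := hS.exists_upperTriangular
    (fun i => if hi : i < r then x ⟨i, hi⟩ else 0) r hr
  refine ⟨g⁻¹, S.inv_mem hg, fun B i => ?_⟩
  rw [inv_inv, blockMatrix_mulVec, one_mul, Matrix.mulVec_mulVec, ← Submonoid.coe_mul,
    inv_mul_cancel, OneMemClass.coe_one, Matrix.one_mulVec]
  intro j hj
  have := (h i i.2 j).1 (lt_of_lt_of_le i.2 hj)
  rwa [dif_pos i.2] at this

end Block

/-- The block subgroup of `SO(n)` fixing the first `r` unit vectors. -/
def lowerBlockSO (r n : ℕ) : SO (n - r) →* SO n where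
  toFun B := ⟨blockMatrix r 1 (B : Matrix (Fin (n - r)) (Fin (n - r)) ℝ), SO.mem_iff.mpr
    ⟨blockMatrix_mem_unitary (fun _ => one_mem _) (SO.mem_iff.mp B.2).1,
      by rw [det_blockMatrix, (SO.mem_iff.mp B.2).2]⟩⟩
  map_one' := Subtype.ext blockMatrix_one
  map_mul' A B := Subtype.ext (by
    have := blockMatrix_mul (r := r) (1 : Fin n → ℝ) 1 (A : Matrix (Fin (n - r)) (Fin (n - r)) ℝ) B
    rw [one_mul] at this
    exact this.symm)

theorem lowerBlockSO_injective {r n : ℕ} : Function.Injective (lowerBlockSO r n) := by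
  intro A B h
  have h' : blockMatrix r (1 : Fin n → ℝ) (A : Matrix (Fin (n - r)) (Fin (n - r)) ℝ)
    = blockMatrix r 1 B := congrArg Subtype.val h
  exact Subtype.ext (blockMatrix_inj h')

theorem continuous_lowerBlockSO {r n : ℕ} : Continuous (lowerBlockSO r n) := by
  have h1 : Continuous (SO.toUnitary (n - r)) := Continuous.subtype_mk continuous_subtype_val _
  have h2 := continuous_subtype_val.comp
    ((continuous_lowerBlock (R := ℝ) (r := r) (n := n)).comp h1)
  exact Continuous.subtype_mk h2 _

theorem mem_range_lowerBlockSO {r n : ℕ} {g : SO n}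
    (h : ∀ i : Fin n, (i : ℕ) < r →
      (g : Matrix (Fin n) (Fin n) ℝ) *ᵥ Pi.single i 1 = Pi.single i 1) :
    g ∈ (lowerBlockSO r n).range := by
  obtain ⟨B, hB⟩ := mem_range_lowerBlock (R := ℝ) (r := r) (g := SO.toUnitary n g) h
  have hB' : blockMatrix r 1 (B : Matrix (Fin (n - r)) (Fin (n - r)) ℝ)
    = (g : Matrix (Fin n) (Fin n) ℝ) := congrArg Subtype.val hB
  have hdet : (B : Matrix (Fin (n - r)) (Fin (n - r)) ℝ).det = 1 := by
    rw [← det_blockMatrix, hB', (SO.mem_iff.mp g.2).2]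
  exact ⟨⟨B, SO.mem_iff.mpr ⟨B.2, hdet⟩⟩, Subtype.ext hB'⟩

/-! ### Invariant inner products on the standard representations -/

/-- The inner product `π (∑ star (xᵢ) yᵢ)` on `Dⁿ`, for a projection `π` of `D` to the scalars. -/
@[reducible]
def coreOfProjection {𝕜 D : Type*} [RCLike 𝕜] [Ring D] [StarRing D] [Module 𝕜 D] (n : ℕ)
    (π : D →+ 𝕜) (hstar : ∀ x, π (star x) = star (π x))
    (hnonneg : ∀ x, 0 ≤ RCLike.re (π (star x * x)))
    (hdef : ∀ x, RCLike.re (π (star x * x)) = 0 → x = 0)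
    (hsmul : ∀ (c : 𝕜) (x y : D), π (star (c • x) * y) = star c * π (star x * y)) :
    InnerProductSpace.Core 𝕜 (Fin n → D) where
  inner x y := π (star x ⬝ᵥ y)
  conj_inner_symm x y := by
    rw [starRingEnd_apply, ← hstar]
    simp [dotProduct, star_sum, star_mul]
  re_inner_nonneg x := by
    simp only [dotProduct, map_sum]
    exact Finset.sum_nonneg fun i _ => hnonneg (x i)
  add_left x y z := by
    rw [star_add, add_dotProduct, map_add]
  smul_left x y c := by
    simp only [dotProduct, map_sum, Finset.mul_sum, Pi.star_apply, Pi.smul_apply]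
    exact Finset.sum_congr rfl fun i _ => hsmul c _ _
  definite x hx := by
    have h : RCLike.re (π (star x ⬝ᵥ x)) = 0 := by rw [hx, map_zero]
    simp only [dotProduct, map_sum, Pi.star_apply] at h
    rw [Finset.sum_eq_zero_iff_of_nonneg fun i _ => hnonneg (x i)] at h
    exact funext fun i => hdef _ (h i (Finset.mem_univ i))

/-- The standard inner product of `ℝⁿ`. -/
@[reducible]
noncomputable def realCore (n : ℕ) : InnerProductSpace.Core ℝ (Fin n → ℝ) :=
  coreOfProjection n (AddMonoidHom.id ℝ) (fun _ => rfl) (fun x => by simpa using mul_self_nonneg x)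
    (fun x => by simp) (fun c x y => by simp [mul_assoc])

/-- The standard Hermitian inner product of `ℂⁿ`. -/
@[reducible]
noncomputable def complexCore (n : ℕ) : InnerProductSpace.Core ℂ (Fin n → ℂ) :=
  coreOfProjection n (AddMonoidHom.id ℂ) (fun _ => rfl)
    (fun x => by simpa using add_nonneg (mul_self_nonneg x.re) (mul_self_nonneg x.im))
    (fun x h => by
      have : x.re * x.re + x.im * x.im = 0 := by simpa using h
      apply Complex.ext <;> simp <;> nlinarith)
    (fun c x y => by simp [mul_assoc])

/-- The standard inner product of `ℂⁿ = ℝ²ⁿ`. -/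
@[reducible]
noncomputable def complexRealCore (n : ℕ) : InnerProductSpace.Core ℝ (Fin n → ℂ) :=
  coreOfProjection n Complex.reCLM.toLinearMap.toAddMonoidHom (fun _ => by simp)
    (fun x => by simpa using add_nonneg (mul_self_nonneg x.re) (mul_self_nonneg x.im))
    (fun x h => by
      have : x.re * x.re + x.im * x.im = 0 := by simpa using h
      apply Complex.ext <;> simp <;> nlinarith)
    (fun c x y => by simp; ring)

/-- The real part of a quaternion, as an additive map. -/
def quaternionRe : ℍ[ℝ] →+ ℝ where
  toFun q := q.re
  map_zero' := rfl
  map_add' _ _ := rfl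

/-- The complex number `z` in the decomposition `z + j w` of a quaternion. -/
def complexPart : ℍ[ℝ] →+ ℂ where
  toFun q := ⟨q.re, q.imI⟩
  map_zero' := rfl
  map_add' _ _ := rfl

@[simp]
theorem quaternionRe_apply (q : ℍ[ℝ]) : quaternionRe q = q.re := rfl

@[simp]
theorem complexPart_re (q : ℍ[ℝ]) : (complexPart q).re = q.re := rfl

@[simp]
theorem complexPart_im (q : ℍ[ℝ]) : (complexPart q).im = q.imI := rfl

theorem quaternion_eq_zero_of_normSq {x : ℍ[ℝ]}
    (h : x.re * x.re + x.imI * x.imI + x.imJ * x.imJ + x.imK * x.imK = 0) : x = 0 := by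
  rw [← Quaternion.normSq_eq_zero, Quaternion.normSq_def']
  nlinarith

/-- The standard inner product of `ℍⁿ = ℝ⁴ⁿ`. -/
@[reducible]
noncomputable def quaternionRealCore (n : ℕ) : InnerProductSpace.Core ℝ (HVec n) :=
  coreOfProjection n quaternionRe (fun _ => by simp)
    (fun x => by simp; nlinarith [mul_self_nonneg x.re, mul_self_nonneg x.imI,
      mul_self_nonneg x.imJ, mul_self_nonneg x.imK])
    (fun x h => quaternion_eq_zero_of_normSq (by simp at h; linarith))
    (fun c x y => by simp)

/-- The standard Hermitian inner product of `ℍⁿ = ℂ²ⁿ`. -/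
@[reducible]
noncomputable def quaternionCore (n : ℕ) : InnerProductSpace.Core ℂ (HVec n) :=
  coreOfProjection n complexPart
    (fun _ => by apply Complex.ext <;> simp)
    (fun x => by simp; nlinarith [mul_self_nonneg x.re, mul_self_nonneg x.imI,
      mul_self_nonneg x.imJ, mul_self_nonneg x.imK])
    (fun x h => quaternion_eq_zero_of_normSq (by simp at h; linarith))
    (fun c x y => by
      rw [complex_smul_def]
      apply Complex.ext <;> simp <;> ring)

theorem realCore_inner {n : ℕ} (x y : Fin n → ℝ) : (realCore n).inner x y = star x ⬝ᵥ y := rfl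

theorem complexCore_inner {n : ℕ} (x y : Fin n → ℂ) : (complexCore n).inner x y = star x ⬝ᵥ y := rfl

theorem complexRealCore_inner {n : ℕ} (x y : Fin n → ℂ) :
    (complexRealCore n).inner x y = (star x ⬝ᵥ y).re := rfl

theorem quaternionRealCore_inner {n : ℕ} (x y : HVec n) :
    (quaternionRealCore n).inner x y = (star x ⬝ᵥ y).re := rfl

theorem quaternionCore_inner {n : ℕ} (x y : HVec n) :
    (quaternionCore n).inner x y = complexPart (star x ⬝ᵥ y) := rfl

/-! ### The standard representations -/

section Standard

variable {n : ℕ}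

theorem stdSO_apply (g : SO n) (x : Fin n → ℝ) :
    stdSO n g x = (g : Matrix (Fin n) (Fin n) ℝ) *ᵥ x := rfl

theorem stdU_apply (g : U n) (x : Fin n → ℂ) :
    stdU n g x = (g : Matrix (Fin n) (Fin n) ℂ) *ᵥ x := rfl

theorem realify_apply {G V : Type*} [Group G] [AddCommMonoid V] [Module ℂ V] [Module ℝ V]
    [IsScalarTower ℝ ℂ V] (ρ : Representation ℂ G V) (g : G) (x : V) : realify ρ g x = ρ g x := rfl

theorem stdSp_apply (g : Sp n) (x : HVec n) :
    stdSp n g x = (g : Matrix (Fin n) (Fin n) ℍ[ℝ]) *ᵥ x := by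
  funext i
  change ((g : Matrix (Fin n) (Fin n) ℍ[ℝ]) *ᵥ x) i * ((1 : ℂ) : ℍ[ℝ]) = _
  rw [Quaternion.coeComplex_one, mul_one]

theorem stdU1Sp_mk (z : U1) (g : Sp n) (x : HVec n) :
    stdU1Sp n (QuotientGroup.mk (z, g)) x
      = fun i => ((g : Matrix (Fin n) (Fin n) ℍ[ℝ]) *ᵥ x) i * ((z : ℂ) : ℍ[ℝ]) := rfl

theorem stdSp1Sp_mk (q : Sp1) (g : Sp n) (x : HVec n) :
    stdSp1Sp n (QuotientGroup.mk (q, g)) x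
      = fun i => ((g : Matrix (Fin n) (Fin n) ℍ[ℝ]) *ᵥ x) i * star (q : ℍ[ℝ]) := rfl

theorem isUnitaryFor_stdSO : IsUnitaryFor (realCore n) (stdSO n) := by
  intro g x y
  rw [stdSO_apply, stdSO_apply, realCore_inner, realCore_inner]
  exact star_mulVec_dotProduct_mulVec (SO.mem_iff.mp g.2).1 x y

theorem isUnitaryFor_stdU : IsUnitaryFor (complexCore n) (stdU n) := by
  intro g x y
  rw [stdU_apply, stdU_apply, complexCore_inner, complexCore_inner]
  exact star_mulVec_dotProduct_mulVec g.2 x y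

theorem isUnitaryFor_realify_stdU : IsUnitaryFor (complexRealCore n) (realify (stdU n)) := by
  intro g x y
  rw [realify_apply, realify_apply, stdU_apply, stdU_apply, complexRealCore_inner,
    complexRealCore_inner, star_mulVec_dotProduct_mulVec g.2 x y]

theorem isUnitaryFor_stdSp : IsUnitaryFor (quaternionCore n) (stdSp n) := by
  intro g x y
  rw [stdSp_apply, stdSp_apply, quaternionCore_inner, quaternionCore_inner,
    star_mulVec_dotProduct_mulVec g.2 x y]

theorem isUnitaryFor_realify_stdSp : IsUnitaryFor (quaternionRealCore n) (realify (stdSp n)) := by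
  intro g x y
  rw [realify_apply, realify_apply, stdSp_apply, stdSp_apply, quaternionRealCore_inner,
    quaternionRealCore_inner, star_mulVec_dotProduct_mulVec g.2 x y]

theorem star_mul_right_dotProduct (x y : HVec n) (p q : ℍ[ℝ]) :
    star (fun i => x i * p) ⬝ᵥ (fun i => y i * q) = star p * (star x ⬝ᵥ y) * q := by
  simp [dotProduct, Finset.mul_sum, Finset.sum_mul, mul_assoc]

theorem star_coeComplex (z : ℂ) : star (z : ℍ[ℝ]) = ((star z : ℂ) : ℍ[ℝ]) := by
  ext <;> simp

theorem coeComplex_mem_unitary (z : U1) : ((z : ℂ) : ℍ[ℝ]) ∈ unitary ℍ[ℝ] := by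
  rw [Unitary.mem_iff, star_coeComplex, ← Quaternion.coeComplex_mul, ← Quaternion.coeComplex_mul,
    Unitary.star_mul_self_of_mem z.2, Unitary.mul_star_self_of_mem z.2]
  exact ⟨Quaternion.coeComplex_one, Quaternion.coeComplex_one⟩

theorem complexPart_conj (z : U1) (h : ℍ[ℝ]) :
    complexPart (star ((z : ℂ) : ℍ[ℝ]) * h * ((z : ℂ) : ℍ[ℝ])) = complexPart h := by
  have h1 : ∀ (w : ℂ) (p : ℍ[ℝ]), complexPart (p * w) = complexPart p * w := fun w p => by
    apply Complex.ext <;> simp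
  have h2 : ∀ (w : ℂ) (p : ℍ[ℝ]), complexPart (w * p) = w * complexPart p := fun w p => by
    apply Complex.ext <;> simp
  rw [h1, star_coeComplex, h2, mul_right_comm, Unitary.coe_star_mul_self, one_mul]

theorem re_conj {q : ℍ[ℝ]} (hq : q ∈ unitary ℍ[ℝ]) (h : ℍ[ℝ]) : (star q * h * q).re = h.re := by
  have h1 : ∀ a b : ℍ[ℝ], (a * b).re = (b * a).re := fun a b => by simp; ring
  rw [h1, ← mul_assoc, Unitary.mul_star_self_of_mem hq, one_mul]

theorem isUnitaryFor_stdU1Sp : IsUnitaryFor (quaternionCore n) (stdU1Sp n) := by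
  intro g x y
  obtain ⟨⟨z, g⟩, rfl⟩ := QuotientGroup.mk_surjective g
  rw [stdU1Sp_mk, stdU1Sp_mk, quaternionCore_inner, quaternionCore_inner,
    star_mul_right_dotProduct, star_mulVec_dotProduct_mulVec g.2 x y, complexPart_conj]

theorem isUnitaryFor_realify_stdU1Sp :
    IsUnitaryFor (quaternionRealCore n) (realify (stdU1Sp n)) := by
  intro g x y
  obtain ⟨⟨z, g⟩, rfl⟩ := QuotientGroup.mk_surjective g
  rw [realify_apply, realify_apply, stdU1Sp_mk, stdU1Sp_mk, quaternionRealCore_inner,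
    quaternionRealCore_inner, star_mul_right_dotProduct, star_mulVec_dotProduct_mulVec g.2 x y,
    re_conj (coeComplex_mem_unitary z)]

theorem isUnitaryFor_stdSp1Sp : IsUnitaryFor (quaternionRealCore n) (stdSp1Sp n) := by
  intro g x y
  obtain ⟨⟨q, g⟩, rfl⟩ := QuotientGroup.mk_surjective g
  rw [stdSp1Sp_mk, stdSp1Sp_mk, quaternionRealCore_inner,
    quaternionRealCore_inner, star_mul_right_dotProduct, star_mulVec_dotProduct_mulVec g.2 x y,
    re_conj (Unitary.star_mem q.2)]

theorem finrank_real_complex_pi : Module.finrank ℝ (Fin n → ℂ) = 2 * n := by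
  simp [Module.finrank_pi_fintype, mul_comm]

theorem finrank_real_HVec : Module.finrank ℝ (HVec n) = 4 * n := by
  simp [Module.finrank_pi_fintype, Quaternion.finrank_eq_four, mul_comm]

instance : FiniteDimensional ℂ ℍ[ℝ] := Module.Finite.of_restrictScalars_finite ℝ ℂ ℍ[ℝ]

theorem finrank_complex_HVec : Module.finrank ℂ (HVec n) = 2 * n := by
  have h := Module.finrank_mul_finrank ℝ ℂ ℍ[ℝ]
  rw [Complex.finrank_real_complex, Quaternion.finrank_eq_four] at h
  have h2 : Module.finrank ℂ ℍ[ℝ] = 2 := by omega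
  rw [Module.finrank_pi_fintype]
  simp [h2, mul_comm]

/-- The embedding of `Sp(n)` in `U(1)Sp(n)`. -/
noncomputable def spToU1Sp (n : ℕ) : Sp n →* U1Sp n :=
  (QuotientGroup.mk' _).comp (MonoidHom.inr U1 (Sp n))

/-- The embedding of `Sp(n)` in `Sp(1)Sp(n)`. -/
noncomputable def spToSp1Sp (n : ℕ) : Sp n →* Sp1Sp n :=
  (QuotientGroup.mk' _).comp (MonoidHom.inr Sp1 (Sp n))

theorem centralProduct_mk_eq {A B : Type*} [Group A] [HasDistribNeg A] [Group B] [HasDistribNeg B]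
    {x y : A × B} : (QuotientGroup.mk x : CentralProduct A B) = QuotientGroup.mk y ↔
      y = x ∨ y = -x := by
  have h : x * -1 = -x := Prod.ext (mul_neg_one _) (mul_neg_one _)
  rw [QuotientGroup.eq, diagNeg_eq, inv_mul_eq_iff_eq_mul, inv_mul_eq_iff_eq_mul, mul_one, h]

theorem U1.one_ne_neg_one : (1 : U1) ≠ -1 := fun h => by
  have h' : (1 : ℂ) = -1 := congrArg Subtype.val h
  norm_num at h'

theorem Sp1.one_ne_neg_one : (1 : Sp1) ≠ -1 := fun h => by
  have h' : (1 : ℍ[ℝ]) = -1 := congrArg Subtype.val h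
  have := congrArg (fun q : ℍ[ℝ] => q.re) h'
  norm_num at this

theorem spToU1Sp_injective : Function.Injective (spToU1Sp n) := by
  intro A B h
  rcases centralProduct_mk_eq.mp h with h | h
  · exact (congrArg Prod.snd h).symm
  · exact absurd (congrArg Prod.fst h) U1.one_ne_neg_one

theorem spToSp1Sp_injective : Function.Injective (spToSp1Sp n) := by
  intro A B h
  rcases centralProduct_mk_eq.mp h with h | h
  · exact (congrArg Prod.snd h).symm
  · exact absurd (congrArg Prod.fst h) Sp1.one_ne_neg_one

theorem continuous_spToU1Sp : Continuous (spToU1Sp n) :=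
  QuotientGroup.continuous_mk.comp (Continuous.prodMk continuous_const continuous_id)

theorem continuous_spToSp1Sp : Continuous (spToSp1Sp n) :=
  QuotientGroup.continuous_mk.comp (Continuous.prodMk continuous_const continuous_id)

theorem stdU1Sp_spToU1Sp (g : Sp n) (x : HVec n) :
    stdU1Sp n (spToU1Sp n g) x = stdSp n g x := rfl

theorem stdSp1Sp_spToSp1Sp (g : Sp n) (x : HVec n) :
    stdSp1Sp n (spToSp1Sp n g) x = stdSp n g x := by
  rw [stdSp_apply]
  funext i
  change ((g : Matrix (Fin n) (Fin n) ℍ[ℝ]) *ᵥ x) i * star (1 : ℍ[ℝ]) = _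
  rw [star_one, mul_one]

theorem fixesUpToConj_stdSO (r : ℕ) : FixesUpToConj (stdSO n) r (lowerBlockSO r n) := by
  intro x
  by_cases hr : r < n
  · obtain ⟨_, ⟨g, _, rfl⟩, h⟩ := (clearsBelow_SO (n := n)).exists_conj_fixes (r := r)
      (fun i hi _ => by omega) x
    refine ⟨g, fun l i => ?_⟩
    rw [map_mul, map_mul, Module.End.mul_apply, Module.End.mul_apply]
    exact h l i
  · -- the block subgroup is trivial
    refine ⟨1, fun l i => ?_⟩
    have : Subsingleton (Matrix (Fin (n - r)) (Fin (n - r)) ℝ) := by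
      rw [Nat.sub_eq_zero_of_le (not_lt.mp hr)]; infer_instance
    have hl : l = 1 := Subtype.ext (Subsingleton.elim _ _)
    rw [hl, map_one]; simp

theorem fixesUpToConj_stdU (r : ℕ) : FixesUpToConj (stdU n) r (lowerBlock ℂ r n) := by
  intro x
  obtain ⟨g, _, h⟩ := (clearsBelow_connectedComponentOfOne (D := ℂ) (n := n)
    (by simp)).exists_conj_fixes (r := r) (fun i _ hi => hi) x
  refine ⟨g, fun l i => ?_⟩
  rw [map_mul, map_mul, Module.End.mul_apply, Module.End.mul_apply]
  exact h l i

theorem fixesUpToConj_stdSp (r : ℕ) : FixesUpToConj (stdSp n) r (lowerBlock ℍ[ℝ] r n) := by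
  intro x
  obtain ⟨g, _, h⟩ := (clearsBelow_connectedComponentOfOne (D := ℍ[ℝ]) (n := n)
    one_lt_rank_quaternion).exists_conj_fixes (r := r) (fun i _ hi => hi) x
  refine ⟨g, fun l i => ?_⟩
  rw [map_mul, map_mul, Module.End.mul_apply, Module.End.mul_apply, stdSp_apply, stdSp_apply,
    stdSp_apply]
  exact h l i

theorem FixesUpToConj.comp {k k' G H L V : Type*} [RCLike k] [RCLike k'] [AddCommGroup V]
    [Module k V] [Module k' V] [Group G] [Group H] [Group L] {ρ : Representation k H V}
    {σ : Representation k' G V} (j : H →* G) (hj : ∀ h x, σ (j h) x = ρ h x) {r : ℕ} {κ : L →* H}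
    (hκ : FixesUpToConj ρ r κ) : FixesUpToConj σ r (j.comp κ) := by
  intro x
  obtain ⟨g, hg⟩ := hκ x
  refine ⟨j g, fun l i => ?_⟩
  have := hj (g * κ l * g⁻¹) (x i)
  rw [map_mul j, map_mul j, map_inv j] at this
  exact this.trans (hg l i)

end Standard

/-! ### Orthonormal families with small stabilizers -/

section Frames

variable {n r : ℕ}

theorem StabilizerIn.eq_one {𝕜 V G L : Type*} [RCLike 𝕜] [AddCommGroup V] [Module 𝕜 V] [Group G]
    [Group L] [Subsingleton L] {ρ : Representation 𝕜 G V} {a : Fin r → V} {κ : L →* G}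
    (h : StabilizerIn ρ a κ) (g : G) (hg : ∀ i, ρ g (a i) = a i) : g = 1 := by
  obtain ⟨l, rfl⟩ := h g hg
  rw [Subsingleton.elim l 1, map_one]

theorem subsingleton_matrix_sub {R : Type*} (h : n ≤ r) :
    Subsingleton (Matrix (Fin (n - r)) (Fin (n - r)) R) := by
  rw [Nat.sub_eq_zero_of_le h]; infer_instance

theorem subsingleton_unitary_sub {R : Type*} [Ring R] [StarRing R] (h : n ≤ r) :
    Subsingleton (unitary (Matrix (Fin (n - r)) (Fin (n - r)) R)) :=
  have := subsingleton_matrix_sub (R := R) h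
  inferInstance

theorem orthonormalFor_single {𝕜 D : Type*} [RCLike 𝕜] [Ring D] [StarRing D] [Module 𝕜 D]
    {c : InnerProductSpace.Core 𝕜 (Fin n → D)} (π : D →+ 𝕜) (hπ : π 1 = 1)
    (hc : ∀ x y, c.inner x y = π (star x ⬝ᵥ y)) (h : r ≤ n) :
    OrthonormalFor c fun i : Fin r => (Pi.single (Fin.castLE h i) 1 : Fin n → D) := by
  intro i j
  rw [hc]
  have e1 : star (Pi.single (Fin.castLE h i) (1 : D))
      = (Pi.single (Fin.castLE h i) 1 : Fin n → D) := by
    funext l; simp [Pi.single_apply, apply_ite (star : D → D)]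
  simp only [e1, single_one_dotProduct, Pi.single_apply]
  by_cases hij : i = j
  · simp [hij, hπ]
  · rw [if_neg hij, if_neg (fun h' => hij (Fin.castLE_injective h h')), map_zero]

theorem orthonormalFor_single_real (h : r ≤ n) : OrthonormalFor (realCore n)
    fun i : Fin r => (Pi.single (Fin.castLE h i) 1 : Fin n → ℝ) :=
  orthonormalFor_single (AddMonoidHom.id ℝ) rfl (fun _ _ => rfl) h

theorem orthonormalFor_single_complex (h : r ≤ n) : OrthonormalFor (complexCore n)
    fun i : Fin r => (Pi.single (Fin.castLE h i) 1 : Fin n → ℂ) :=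
  orthonormalFor_single (AddMonoidHom.id ℂ) rfl (fun _ _ => rfl) h

theorem stabilizerIn_stdSO (h : r ≤ n) : StabilizerIn (stdSO n)
    (fun i : Fin r => (Pi.single (Fin.castLE h i) 1 : Fin n → ℝ)) (lowerBlockSO r n) :=
  fun _ hg => mem_range_lowerBlockSO fun i hi => hg ⟨i, hi⟩

theorem stabilizerIn_stdU (h : r ≤ n) : StabilizerIn (stdU n)
    (fun i : Fin r => (Pi.single (Fin.castLE h i) 1 : Fin n → ℂ)) (lowerBlock ℂ r n) :=
  fun _ hg => mem_range_lowerBlock fun i hi => hg ⟨i, hi⟩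

/-- The stabilizer in `SO(n)` of the standard basis is trivial. -/
theorem stdSO_eq_one (g : SO n)
    (hg : ∀ i : Fin n, stdSO n g (Pi.single (Fin.castLE le_rfl i) 1) =
      Pi.single (Fin.castLE le_rfl i) 1) : g = 1 :=
  have := subsingleton_matrix_sub (R := ℝ) (le_refl n)
  have : Subsingleton (SO (n - n)) := inferInstance
  (stabilizerIn_stdSO le_rfl).eq_one g hg

/-- An orthonormal basis of `ℂⁿ = ℝ²ⁿ` that starts with the unit vectors. -/
theorem exists_frame_realify_stdU (hr : r ≤ 2 * n) : ∃ a : Fin r → Fin n → ℂ,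
    OrthonormalFor (complexRealCore n) a ∧
      StabilizerIn (realify (stdU n)) a (lowerBlock ℂ r n) := by
  let f : ℕ → Fin n → ℂ := fun k => if hk : k < n then Pi.single ⟨k, hk⟩ 1 else 0
  obtain ⟨b, hb, -, hbf⟩ := exists_orthonormalFor_extension (complexRealCore n)
    finrank_real_complex_pi (t := n) f
    (fun i hi j hj hij => by
      simp only [f, dif_pos hi, dif_pos hj]
      have := orthonormalFor_single (c := complexRealCore n)
        Complex.reCLM.toLinearMap.toAddMonoidHom rfl (fun _ _ => rfl) le_rfl ⟨i, hi⟩ ⟨j, hj⟩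
      rw [if_neg (fun h => hij (congrArg Fin.val h))] at this
      exact this)
    (fun i hi => by simp [f, hi])
  refine ⟨fun i => b (Fin.castLE hr i), fun i j => ?_, fun g hg => ?_⟩
  · rw [hb]; simp
  refine mem_range_lowerBlock fun i hi => ?_
  obtain ⟨c, -, hc⟩ := hbf (Fin.castLE hr ⟨i, hi⟩) i.2
  have hfi : f i = Pi.single i 1 := by simp [f]
  have h1 : realify (stdU n) g (f i) = f i := by
    have := hg ⟨i, hi⟩
    change f i = _ at hc
    rw [hc, map_smul, this]
  rw [hfi] at h1
  exact h1

/-- The unit vector with index `k` if `k < n`, and zero otherwise. -/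
noncomputable def unitVec (n k : ℕ) : HVec n := if h : k < n then Pi.single ⟨k, h⟩ 1 else 0

theorem unitVec_coe (i : Fin n) : unitVec n i = Pi.single i 1 := by simp [unitVec]

theorem unitVec_apply (k : ℕ) (i : Fin n) : unitVec n k i = if (i : ℕ) = k then 1 else 0 := by
  unfold unitVec
  split_ifs with h h' h'
  · simp [Pi.single_apply, Fin.ext_iff, h']
  · simp [Fin.ext_iff, h']
  · exact absurd (h' ▸ i.2) h
  · rfl

theorem star_unitVec_dotProduct (k : ℕ) (x : HVec n) :
    star (unitVec n k) ⬝ᵥ x = if h : k < n then x ⟨k, h⟩ else 0 := by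
  split_ifs with h
  · rw [dotProduct, Finset.sum_eq_single ⟨k, h⟩]
    · simp [unitVec_apply]
    · intro i _ hi
      have : (i : ℕ) ≠ k := fun h' => hi (Fin.ext h')
      simp [unitVec_apply, this]
    · simp
  · refine Finset.sum_eq_zero fun i _ => ?_
    have : (i : ℕ) ≠ k := fun h' => h (h' ▸ i.2)
    simp [unitVec_apply, this]

theorem star_unitVec_dotProduct_unitVec (k l : ℕ) :
    star (unitVec n k) ⬝ᵥ unitVec n l = if k = l ∧ k < n then 1 else 0 := by
  rw [star_unitVec_dotProduct]
  split_ifs with h1 h2 h2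
  · simp [unitVec_apply, h2.1]
  · have : k ≠ l := fun h => h2 ⟨h, h1⟩
    simp [unitVec_apply, this]
  · exact absurd h2.2 h1
  · rfl

theorem star_op_smul_dotProduct (x y : HVec n) (p q : ℍ[ℝ]) :
    star (MulOpposite.op p • x) ⬝ᵥ (MulOpposite.op q • y) = star p * (star x ⬝ᵥ y) * q :=
  star_mul_right_dotProduct x y p q

/-- A unitary matrix `g` that maps `ε₀` to `ε₀ q` and `εₖ + ε₀ c` to `(εₖ + ε₀ c) q` maps `εₖ` to
`εₖ q`, and `q` commutes with `c`, because `g εₖ` is orthogonal to `g ε₀`. -/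
theorem commute_of_mulVec_unitVec {g : Matrix (Fin n) (Fin n) ℍ[ℝ]}
    (hg : g ∈ unitary (Matrix (Fin n) (Fin n) ℍ[ℝ])) (hn : 1 ≤ n) {k : ℕ} (hk : k ≠ 0)
    {q c : ℍ[ℝ]} (hq : q ∈ unitary ℍ[ℝ])
    (h0 : g *ᵥ unitVec n 0 = MulOpposite.op q • unitVec n 0)
    (h1 : g *ᵥ (unitVec n k + MulOpposite.op c • unitVec n 0)
      = MulOpposite.op q • (unitVec n k + MulOpposite.op c • unitVec n 0)) :
    c * q = q * c ∧ g *ᵥ unitVec n k = MulOpposite.op q • unitVec n k := by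
  rw [Matrix.mulVec_add, Matrix.mulVec_smul, h0, smul_add, smul_smul, smul_smul,
    ← MulOpposite.op_mul, ← MulOpposite.op_mul] at h1
  have h2 : g *ᵥ unitVec n k = MulOpposite.op q • unitVec n k
      + MulOpposite.op (c * q - q * c) • unitVec n 0 := by
    rw [MulOpposite.op_sub, sub_smul, add_sub, ← h1, add_sub_cancel_right]
  have h3 := star_mulVec_dotProduct_mulVec hg (unitVec n 0) (unitVec n k)
  rw [h2, h0, dotProduct_add, star_op_smul_dotProduct, star_op_smul_dotProduct,
    star_unitVec_dotProduct_unitVec, star_unitVec_dotProduct_unitVec, if_neg (fun h => hk h.1.symm),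
    if_pos ⟨rfl, hn⟩, mul_zero, zero_mul, zero_add, mul_one] at h3
  have h4 : c * q - q * c = 0 := by
    have := congrArg (q * ·) h3
    simpa only [← mul_assoc, Unitary.mul_star_self_of_mem hq, one_mul, mul_zero] using this
  refine ⟨sub_eq_zero.mp h4, ?_⟩
  rw [h2, h4]; simp

/-- An orthonormal family of `r` vectors in `ℍⁿ = ℝ⁴ⁿ` of which the `k`-th one is, up to a scalar,
`εₖ + ε₀ cₖ` for `k < t`, where the `cₖ` are orthogonal imaginary quaternions. Here `εₖ = 0` if
`n ≤ k`; for these `k` the quaternion `cₖ` must not vanish. If `x ↦ g x q̄` fixes the family, then `q`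
commutes with the `cₖ` and `g εₖ = εₖ q`. -/
theorem exists_frame_HVec (hn : 1 ≤ n) (hr : r ≤ 4 * n) (hr0 : 1 ≤ r) {t : ℕ} (hnt : n ≤ t)
    (c : ℕ → ℍ[ℝ])
    (hc0 : c 0 = 0) (hcre : ∀ k, (c k).re = 0) (hc : ∀ k l, k ≠ l → (star (c k) * c l).re = 0)
    (hct : ∀ k, n ≤ k → k < t → c k ≠ 0) :
    ∃ a : Fin r → HVec n, OrthonormalFor (quaternionRealCore n) a ∧
      ∀ g ∈ unitary (Matrix (Fin n) (Fin n) ℍ[ℝ]), ∀ q ∈ unitary ℍ[ℝ],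
        (∀ i, g *ᵥ a i = MulOpposite.op q • a i) →
          (∀ k < r, k < t → c k * q = q * c k) ∧
          ∀ k : ℕ, k < r → g *ᵥ unitVec n k = MulOpposite.op q • unitVec n k := by
  let f : ℕ → HVec n := fun k => unitVec n k + MulOpposite.op (c k) • unitVec n 0
  obtain ⟨b, hb, -, hbf⟩ := exists_orthonormalFor_extension (quaternionRealCore n)
    finrank_real_HVec (t := t) f
    (fun k _ l _ hkl => by
      rw [quaternionRealCore_inner]
      have e1 : ∀ x y z w : HVec n, star (x + y) ⬝ᵥ (z + w)
          = star x ⬝ᵥ z + star x ⬝ᵥ w + (star y ⬝ᵥ z + star y ⬝ᵥ w) := by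
        intro x y z w; rw [star_add, add_dotProduct, dotProduct_add, dotProduct_add]
      have e2 : ∀ (m : ℕ) (d : ℍ[ℝ]), star (unitVec n m) ⬝ᵥ (MulOpposite.op d • unitVec n 0)
          = (star (unitVec n m) ⬝ᵥ unitVec n 0) * d := by
        intro m d
        simp
      have e3 : ∀ (m : ℕ) (d : ℍ[ℝ]), star (MulOpposite.op d • unitVec n 0) ⬝ᵥ unitVec n m
          = star d * (star (unitVec n 0) ⬝ᵥ unitVec n m) := by
        intro m d
        simpa using star_op_smul_dotProduct (unitVec n 0) (unitVec n m) d 1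
      rw [e1, e2, e3, star_op_smul_dotProduct]
      simp only [star_unitVec_dotProduct_unitVec]
      rw [if_neg (fun h => hkl h.1)]
      have h4 := hc k l hkl
      have hl := hcre l
      have hk := hcre k
      split_ifs <;> simp_all)
    (fun k hk h => by
      rcases Nat.eq_zero_or_pos k with rfl | hk0
      · have := congrFun h ⟨0, hn⟩
        simp [f, hc0, unitVec_apply] at this
      rcases lt_or_ge k n with hkn | hkn
      · have := congrFun h ⟨k, hkn⟩
        simp [f, unitVec_apply, hk0.ne'] at this
      · have := congrFun h ⟨0, hn⟩
        simp [f, unitVec_apply, hk0.ne] at this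
        exact hct k hkn hk this)
  refine ⟨fun i => b (Fin.castLE hr i), fun i j => ?_, fun g hg q hq hgq => ?_⟩
  · rw [hb]; simp
  have hf : ∀ k, k < r → k < t → g *ᵥ f k = MulOpposite.op q • f k := by
    intro k hkr hkt
    obtain ⟨s, -, hs⟩ := hbf (Fin.castLE hr ⟨k, hkr⟩) hkt
    have h1 := hgq ⟨k, hkr⟩
    change f k = _ at hs
    rw [hs, Matrix.mulVec_smul, h1, smul_comm]
  have hf0 : g *ᵥ unitVec n 0 = MulOpposite.op q • unitVec n 0 := by
    have := hf 0 hr0 (by omega)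
    simpa [f, hc0] using this
  have key : ∀ k, k < r → k < t → c k * q = q * c k ∧
      g *ᵥ unitVec n k = MulOpposite.op q • unitVec n k := by
    intro k hkr hkt
    rcases Nat.eq_zero_or_pos k with rfl | hk0
    · exact ⟨by rw [hc0]; simp, hf0⟩
    · exact commute_of_mulVec_unitVec hg hn hk0.ne' hq hf0 (hf k hkr hkt)
  refine ⟨fun k hkr hkt => (key k hkr hkt).1, fun k hkr => ?_⟩
  rcases lt_or_ge k t with hkt | hkt
  · exact (key k hkr hkt).2
  · have : unitVec n k = 0 := by rw [unitVec, dif_neg (by omega)]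
    rw [this]; simp

theorem mem_range_lowerBlock_of_unitVec {g : Sp n}
    (h : ∀ k : ℕ, k < r → (g : Matrix (Fin n) (Fin n) ℍ[ℝ]) *ᵥ unitVec n k = unitVec n k) :
    g ∈ (lowerBlock ℍ[ℝ] r n).range :=
  mem_range_lowerBlock fun i hi => by simpa only [unitVec_coe] using h i hi

/-- The choice `cₖ = 0`. -/
theorem exists_frame_realify_stdSp (hn : 1 ≤ n) (hr : r ≤ 4 * n) (hr0 : 1 ≤ r) :
    ∃ a : Fin r → HVec n, OrthonormalFor (quaternionRealCore n) a ∧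
      StabilizerIn (realify (stdSp n)) a (lowerBlock ℍ[ℝ] r n) := by
  obtain ⟨a, ha, h⟩ := exists_frame_HVec hn hr hr0 (le_refl n) (fun _ => 0) rfl (fun _ => rfl)
    (fun _ _ _ => by simp) (fun k hk hk' => absurd hk' (not_lt.mpr hk))
  refine ⟨a, ha, fun g hg => mem_range_lowerBlock_of_unitVec fun k hk => ?_⟩
  have := (h g g.2 1 (one_mem _) fun i => by
    have := hg i
    rw [realify_apply, stdSp_apply] at this
    simpa using this).2 k hk
  simpa using this

/-- The imaginary unit `i`. -/
noncomputable def quatI : ℍ[ℝ] := ⟨0, 1, 0, 0⟩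

/-- The imaginary unit `j`. -/
noncomputable def quatJ : ℍ[ℝ] := ⟨0, 0, 1, 0⟩

@[simp] theorem quatI_re : quatI.re = 0 := rfl

@[simp] theorem quatI_imI : quatI.imI = 1 := rfl

@[simp] theorem quatI_imJ : quatI.imJ = 0 := rfl

@[simp] theorem quatI_imK : quatI.imK = 0 := rfl

@[simp] theorem quatJ_re : quatJ.re = 0 := rfl

@[simp] theorem quatJ_imI : quatJ.imI = 0 := rfl

@[simp] theorem quatJ_imJ : quatJ.imJ = 1 := rfl

@[simp] theorem quatJ_imK : quatJ.imK = 0 := rfl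

theorem eq_one_or_neg_one_of_re {q : ℍ[ℝ]} (hq : q ∈ unitary ℍ[ℝ]) (h1 : q.imI = 0)
    (h2 : q.imJ = 0) (h3 : q.imK = 0) : q = 1 ∨ q = -1 := by
  have h := Unitary.star_mul_self_of_mem hq
  have hre := congrArg (fun p : ℍ[ℝ] => p.re) h
  simp [h1, h2, h3] at hre
  rcases mul_self_eq_one_iff.mp hre with h | h
  · left; ext <;> simp [h, h1, h2, h3]
  · right; ext <;> simp [h, h1, h2, h3]

/-- A class `[±1, g]` of a central product lies in the block subgroup if `g` multiplies the first
unit vectors by the same sign. -/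
theorem mem_range_comp_lowerBlock {A : Type*} [Group A] [HasDistribNeg A] {e : A} {g : Sp n}
    (h : (e = 1 ∧ ∀ k : ℕ, k < r →
        (g : Matrix (Fin n) (Fin n) ℍ[ℝ]) *ᵥ unitVec n k = unitVec n k) ∨
      (e = -1 ∧ ∀ k : ℕ, k < r →
        (g : Matrix (Fin n) (Fin n) ℍ[ℝ]) *ᵥ unitVec n k = -unitVec n k)) :
    (QuotientGroup.mk (e, g) : CentralProduct A (Sp n)) ∈
      (((QuotientGroup.mk' (diagNeg A (Sp n))).comp (MonoidHom.inr A (Sp n))).comp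
        (lowerBlock ℍ[ℝ] r n)).range := by
  rcases h with ⟨rfl, h⟩ | ⟨rfl, h⟩
  · obtain ⟨B, hB⟩ := mem_range_lowerBlock_of_unitVec (g := g) h
    exact ⟨B, by rw [← hB]; rfl⟩
  · obtain ⟨B, hB⟩ := mem_range_lowerBlock_of_unitVec (g := -g) fun k hk => by
      change (-(g : Matrix (Fin n) (Fin n) ℍ[ℝ])) *ᵥ _ = _
      rw [Matrix.neg_mulVec, h k hk, neg_neg]
    refine ⟨B, centralProduct_mk_eq.mpr (Or.inr ?_)⟩
    change (-1, g) = -((1 : A), lowerBlock ℍ[ℝ] r n B)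
    rw [hB]
    exact Prod.ext rfl (neg_neg g).symm

theorem op_smul_of_mul_star {q : ℍ[ℝ]} (hq : q ∈ unitary ℍ[ℝ]) {x y : HVec n}
    (h : (fun i => x i * star q) = y) : x = MulOpposite.op q • y := by
  funext i
  rw [← h]
  simp [mul_assoc, Unitary.star_mul_self_of_mem hq]

theorem Sp1.coe_neg_one : ((-1 : Sp1) : ℍ[ℝ]) = -1 := rfl

/-- The choice `c₁ = i`, `c₂ = j`: only the real numbers commute with both. -/
theorem exists_frame_stdSp1Sp (hn : 1 ≤ n) (hr : r ≤ 4 * n) (hr3 : 3 ≤ r) :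
    ∃ a : Fin r → HVec n, OrthonormalFor (quaternionRealCore n) a ∧
      StabilizerIn (stdSp1Sp n) a ((spToSp1Sp n).comp (lowerBlock ℍ[ℝ] r n)) := by
  let c : ℕ → ℍ[ℝ] := fun k => if k = 1 then quatI else if k = 2 then quatJ else 0
  obtain ⟨a, ha, h⟩ := exists_frame_HVec hn hr (by omega) (le_max_left n 3) c rfl
    (fun k => by simp only [c]; split_ifs <;> rfl)
    (fun k l hkl => by simp only [c]; split_ifs <;> simp_all)
    (fun k hk hk' h => by
      have : k = 1 ∨ k = 2 := by rcases lt_max_iff.mp hk' with h | h <;> omega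
      rcases this with rfl | rfl
      · have := congrArg (fun q : ℍ[ℝ] => q.imI) h
        simp [c] at this
      · have := congrArg (fun q : ℍ[ℝ] => q.imJ) h
        simp [c] at this)
  refine ⟨a, ha, fun g hg => ?_⟩
  obtain ⟨⟨q, g⟩, rfl⟩ := QuotientGroup.mk_surjective g
  obtain ⟨h1, h2⟩ := h g g.2 q q.2 fun i => op_smul_of_mul_star q.2 (hg i)
  have hI := h1 1 (by omega) (by simp)
  have hJ := h1 2 (by omega) (by simp)
  have hq : (q : ℍ[ℝ]) = 1 ∨ (q : ℍ[ℝ]) = -1 := by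
    refine eq_one_or_neg_one_of_re q.2 ?_ ?_ ?_
    · have := congrArg (fun q : ℍ[ℝ] => q.imK) hJ
      simp [c] at this; linarith
    · have := congrArg (fun q : ℍ[ℝ] => q.imK) hI
      simp [c] at this; linarith
    · have := congrArg (fun q : ℍ[ℝ] => q.imJ) hI
      simp [c] at this; linarith
  refine mem_range_comp_lowerBlock (hq.imp (fun h => ⟨Subtype.ext h, fun k hk => ?_⟩)
    fun h => ⟨Subtype.ext h, fun k hk => ?_⟩) <;> rw [h2 k hk, h] <;> funext i <;>
    simp [Sp1.coe_neg_one]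

theorem U1.coe_neg_one : ((-1 : U1) : ℂ) = -1 := rfl

/-- The choice `c₁ = j`: among the complex numbers only the real ones commute with it. -/
theorem exists_frame_realify_stdU1Sp (hn : 1 ≤ n) (hr : r ≤ 4 * n) (hr2 : 2 ≤ r) :
    ∃ a : Fin r → HVec n, OrthonormalFor (quaternionRealCore n) a ∧
      StabilizerIn (realify (stdU1Sp n)) a ((spToU1Sp n).comp (lowerBlock ℍ[ℝ] r n)) := by
  let c : ℕ → ℍ[ℝ] := fun k => if k = 1 then quatJ else 0
  obtain ⟨a, ha, h⟩ := exists_frame_HVec hn hr (by omega) (le_max_left n 2) c rfl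
    (fun k => by simp only [c]; split_ifs <;> rfl)
    (fun k l hkl => by simp only [c]; split_ifs <;> simp_all)
    (fun k hk hk' h => by
      have : k = 1 := by rcases lt_max_iff.mp hk' with h | h <;> omega
      subst this
      have := congrArg (fun q : ℍ[ℝ] => q.imJ) h
      simp [c] at this)
  refine ⟨a, ha, fun g hg => ?_⟩
  obtain ⟨⟨z, g⟩, rfl⟩ := QuotientGroup.mk_surjective g
  have hz := Unitary.star_mem (coeComplex_mem_unitary z)
  obtain ⟨h1, h2⟩ := h g g.2 _ hz fun i => op_smul_of_mul_star hz (by rw [star_star]; exact hg i)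
  have hJ := h1 1 (by omega) (by simp)
  have hq : star ((z : ℂ) : ℍ[ℝ]) = 1 ∨ star ((z : ℂ) : ℍ[ℝ]) = -1 := by
    refine eq_one_or_neg_one_of_re hz ?_ ?_ ?_
    · have := congrArg (fun q : ℍ[ℝ] => q.imK) hJ
      simp [c] at this; simp; linarith
    · simp
    · simp
  have hq' : z = 1 ∨ z = -1 := by
    rcases hq with hq | hq
    · left
      have hre := congrArg (fun q : ℍ[ℝ] => q.re) hq
      have him := congrArg (fun q : ℍ[ℝ] => q.imI) hq
      simp at hre him
      exact Subtype.ext (Complex.ext (by simpa using hre) (by simpa using him))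
    · right
      have hre := congrArg (fun q : ℍ[ℝ] => q.re) hq
      have him := congrArg (fun q : ℍ[ℝ] => q.imI) hq
      simp at hre him
      exact Subtype.ext (Complex.ext (by simpa [U1.coe_neg_one] using hre)
        (by simpa [U1.coe_neg_one] using him))
  have hneg : star (((-1 : U1) : ℂ) : ℍ[ℝ]) = -1 := by ext <;> simp [U1.coe_neg_one]
  refine mem_range_comp_lowerBlock (hq'.imp (fun h => ⟨h, fun k hk => ?_⟩)
    fun h => ⟨h, fun k hk => ?_⟩) <;> rw [h2 k hk, h]
  · simp
  · rw [hneg]; funext i; simp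

end Frames

/-! ### The real tensor products -/

section RealCases

variable {m n : ℕ}

theorem repSOU_of_le (hnm : 2 * n ≤ m) (v : (Fin m → ℝ) ⊗[ℝ] (Fin n → ℂ))
    (hv : IsPrincipal (repSOU m n) v) :
    Nonempty (isotropyZero (repSOU m n) v ≃ₜ* SO (m - 2 * n)) := by
  obtain ⟨b, hb, hst⟩ := exists_frame_realify_stdU (le_refl (2 * n))
  have := subsingleton_unitary_sub (R := ℂ) (n := n) (r := 2 * n) (by omega)
  exact isotropyZero_equiv_left (realCore m) (complexRealCore n) isUnitaryFor_stdSO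
    isUnitaryFor_realify_stdU finrank_real_complex_pi (orthonormalFor_single_real hnm) hb
    (Or.inr (isUnitaryFor_realify_stdU.hasSignEigenvalues hb)) continuous_lowerBlockSO
    lowerBlockSO_injective (stabilizerIn_stdSO hnm) (fixesUpToConj_stdSO _) hst.eq_one v hv

theorem repSOU_of_ge (hmn : m ≤ 2 * n) (v : (Fin m → ℝ) ⊗[ℝ] (Fin n → ℂ))
    (hv : IsPrincipal (repSOU m n) v) :
    Nonempty (isotropyZero (repSOU m n) v ≃ₜ* U (n - m)) := by
  obtain ⟨b, hb, hst⟩ := exists_frame_realify_stdU hmn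
  exact (isotropyZero_equiv_right (realCore m) (complexRealCore n) isUnitaryFor_stdSO
    isUnitaryFor_realify_stdU (Module.finrank_fin_fun ℝ) (orthonormalFor_single_real le_rfl) hb
    (Or.inr (isUnitaryFor_realify_stdU.hasSignEigenvalues hb)) continuous_lowerBlock
    lowerBlock_injective hst
    ((fixesUpToConj_stdU m).comp (MonoidHom.id (U n)) fun _ _ => rfl) stdSO_eq_one v hv).2

theorem repSOSp_of_le (hn : 1 ≤ n) (hnm : 4 * n ≤ m) (v : (Fin m → ℝ) ⊗[ℝ] HVec n)
    (hv : IsPrincipal (repSOSp m n) v) :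
    Nonempty (isotropyZero (repSOSp m n) v ≃ₜ* SO (m - 4 * n)) := by
  obtain ⟨b, hb, hst⟩ := exists_frame_realify_stdSp hn (le_refl (4 * n)) (by omega)
  have := subsingleton_unitary_sub (R := ℍ[ℝ]) (n := n) (r := 4 * n) (by omega)
  exact isotropyZero_equiv_left (realCore m) (quaternionRealCore n) isUnitaryFor_stdSO
    isUnitaryFor_realify_stdSp finrank_real_HVec (orthonormalFor_single_real hnm) hb
    (Or.inr (isUnitaryFor_realify_stdSp.hasSignEigenvalues hb)) continuous_lowerBlockSO
    lowerBlockSO_injective (stabilizerIn_stdSO hnm) (fixesUpToConj_stdSO _) hst.eq_one v hv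

theorem repSOSp_of_ge (hm : 1 ≤ m) (hn : 1 ≤ n) (hmn : m ≤ 4 * n) (v : (Fin m → ℝ) ⊗[ℝ] HVec n)
    (hv : IsPrincipal (repSOSp m n) v) :
    Nonempty (isotropyZero (repSOSp m n) v ≃ₜ* Sp (n - m)) := by
  obtain ⟨b, hb, hst⟩ := exists_frame_realify_stdSp hn hmn hm
  exact (isotropyZero_equiv_right (realCore m) (quaternionRealCore n) isUnitaryFor_stdSO
    isUnitaryFor_realify_stdSp (Module.finrank_fin_fun ℝ) (orthonormalFor_single_real le_rfl) hb
    (Or.inr (isUnitaryFor_realify_stdSp.hasSignEigenvalues hb)) continuous_lowerBlock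
    lowerBlock_injective hst
    ((fixesUpToConj_stdSp m).comp (MonoidHom.id (Sp n)) fun _ _ => rfl) stdSO_eq_one v hv).2

theorem repSOSp1Sp_of_le (hn : 1 ≤ n) (hnm : 4 * n ≤ m) (v : (Fin m → ℝ) ⊗[ℝ] HVec n)
    (hv : IsPrincipal (repSOSp1Sp m n) v) :
    Nonempty (isotropyZero (repSOSp1Sp m n) v ≃ₜ* SO (m - 4 * n)) := by
  obtain ⟨b, hb, hst⟩ := exists_frame_stdSp1Sp hn (le_refl (4 * n)) (by omega)
  have := subsingleton_unitary_sub (R := ℍ[ℝ]) (n := n) (r := 4 * n) (by omega)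
  exact isotropyZero_equiv_left (realCore m) (quaternionRealCore n) isUnitaryFor_stdSO
    isUnitaryFor_stdSp1Sp finrank_real_HVec (orthonormalFor_single_real hnm) hb
    (Or.inr (isUnitaryFor_stdSp1Sp.hasSignEigenvalues hb)) continuous_lowerBlockSO
    lowerBlockSO_injective (stabilizerIn_stdSO hnm) (fixesUpToConj_stdSO _) hst.eq_one v hv

theorem repSOSp1Sp_of_ge (hm : 3 ≤ m) (hn : 1 ≤ n) (hmn : m ≤ 4 * n)
    (v : (Fin m → ℝ) ⊗[ℝ] HVec n) (hv : IsPrincipal (repSOSp1Sp m n) v) :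
    Nonempty (isotropyZero (repSOSp1Sp m n) v ≃ₜ* Sp (n - m)) := by
  obtain ⟨b, hb, hst⟩ := exists_frame_stdSp1Sp hn hmn hm
  exact (isotropyZero_equiv_right
    (κ := (spToSp1Sp n).comp (lowerBlock ℍ[ℝ] m n))
    (realCore m) (quaternionRealCore n) isUnitaryFor_stdSO
    isUnitaryFor_stdSp1Sp (Module.finrank_fin_fun ℝ) (orthonormalFor_single_real le_rfl) hb
    (Or.inr (isUnitaryFor_stdSp1Sp.hasSignEigenvalues hb))
    (continuous_spToSp1Sp.comp continuous_lowerBlock)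
    (spToSp1Sp_injective.comp lowerBlock_injective) hst
    ((fixesUpToConj_stdSp m).comp (spToSp1Sp n) stdSp1Sp_spToSp1Sp) stdSO_eq_one v hv).2

theorem repSOU1Sp_of_le (hn : 1 ≤ n) (hnm : 4 * n ≤ m) (v : (Fin m → ℝ) ⊗[ℝ] HVec n)
    (hv : IsPrincipal (repSOU1Sp m n) v) :
    Nonempty (isotropyZero (repSOU1Sp m n) v ≃ₜ* SO (m - 4 * n)) := by
  obtain ⟨b, hb, hst⟩ := exists_frame_realify_stdU1Sp hn (le_refl (4 * n)) (by omega)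
  have := subsingleton_unitary_sub (R := ℍ[ℝ]) (n := n) (r := 4 * n) (by omega)
  exact isotropyZero_equiv_left (realCore m) (quaternionRealCore n) isUnitaryFor_stdSO
    isUnitaryFor_realify_stdU1Sp finrank_real_HVec (orthonormalFor_single_real hnm) hb
    (Or.inr (isUnitaryFor_realify_stdU1Sp.hasSignEigenvalues hb)) continuous_lowerBlockSO
    lowerBlockSO_injective (stabilizerIn_stdSO hnm) (fixesUpToConj_stdSO _) hst.eq_one v hv

theorem repSOU1Sp_of_ge (hm : 2 ≤ m) (hn : 1 ≤ n) (hmn : m ≤ 4 * n)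
    (v : (Fin m → ℝ) ⊗[ℝ] HVec n) (hv : IsPrincipal (repSOU1Sp m n) v) :
    Nonempty (isotropyZero (repSOU1Sp m n) v ≃ₜ* Sp (n - m)) := by
  obtain ⟨b, hb, hst⟩ := exists_frame_realify_stdU1Sp hn hmn hm
  exact (isotropyZero_equiv_right
    (κ := (spToU1Sp n).comp (lowerBlock ℍ[ℝ] m n))
    (realCore m) (quaternionRealCore n) isUnitaryFor_stdSO
    isUnitaryFor_realify_stdU1Sp (Module.finrank_fin_fun ℝ) (orthonormalFor_single_real le_rfl) hb
    (Or.inr (isUnitaryFor_realify_stdU1Sp.hasSignEigenvalues hb))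
    (continuous_spToU1Sp.comp continuous_lowerBlock)
    (spToU1Sp_injective.comp lowerBlock_injective) hst
    ((fixesUpToConj_stdSp m).comp (spToU1Sp n) stdU1Sp_spToU1Sp) stdSO_eq_one v hv).2

theorem repUSp1Sp_of_le (hn : 1 ≤ n) (hnm : 4 * n ≤ 2 * m)
    (v : (Fin m → ℂ) ⊗[ℝ] HVec n) (hv : IsPrincipal (repUSp1Sp m n) v) :
    Nonempty (isotropyZero (repUSp1Sp m n) v ≃ₜ* U (m - 4 * n)) := by
  obtain ⟨a, ha, hsta⟩ := exists_frame_realify_stdU hnm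
  obtain ⟨b, hb, hst⟩ := exists_frame_stdSp1Sp hn (le_refl (4 * n)) (by omega)
  have := subsingleton_unitary_sub (R := ℍ[ℝ]) (n := n) (r := 4 * n) (by omega)
  exact isotropyZero_equiv_left (complexRealCore m) (quaternionRealCore n)
    isUnitaryFor_realify_stdU isUnitaryFor_stdSp1Sp finrank_real_HVec ha hb
    (Or.inr (isUnitaryFor_stdSp1Sp.hasSignEigenvalues hb)) continuous_lowerBlock
    lowerBlock_injective hsta
    ((fixesUpToConj_stdU _).comp (MonoidHom.id (U m)) fun _ _ => rfl) hst.eq_one v hv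

theorem repUSp1Sp_of_ge (hm : 2 ≤ m) (hn : 1 ≤ n) (hmn : 2 * m ≤ 4 * n)
    (v : (Fin m → ℂ) ⊗[ℝ] HVec n) (hv : IsPrincipal (repUSp1Sp m n) v) :
    Nonempty (isotropyZero (repUSp1Sp m n) v ≃ₜ* Sp (n - 2 * m)) := by
  obtain ⟨a, ha, hsta⟩ := exists_frame_realify_stdU (le_refl (2 * m))
  have := subsingleton_unitary_sub (R := ℂ) (n := m) (r := 2 * m) (by omega)
  obtain ⟨b, hb, hst⟩ := exists_frame_stdSp1Sp hn hmn (by omega)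
  exact (isotropyZero_equiv_right
    (κ := (spToSp1Sp n).comp (lowerBlock ℍ[ℝ] (2 * m) n))
    (complexRealCore m) (quaternionRealCore n)
    isUnitaryFor_realify_stdU isUnitaryFor_stdSp1Sp finrank_real_complex_pi ha hb
    (Or.inr (isUnitaryFor_stdSp1Sp.hasSignEigenvalues hb))
    (continuous_spToSp1Sp.comp continuous_lowerBlock)
    (spToSp1Sp_injective.comp lowerBlock_injective) hst
    ((fixesUpToConj_stdSp _).comp (spToSp1Sp n) stdSp1Sp_spToSp1Sp) hsta.eq_one v hv).2

theorem repSp1SpSp1Sp_of_le (hn : 1 ≤ n) (hnm : n ≤ m) (v : HVec m ⊗[ℝ] HVec n)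
    (hv : IsPrincipal (repSp1SpSp1Sp m n) v) :
    Nonempty (isotropyZero (repSp1SpSp1Sp m n) v ≃ₜ* Sp (m - 4 * n)) := by
  obtain ⟨a, ha, hsta⟩ := exists_frame_stdSp1Sp (n := m) (r := 4 * n) (by omega) (by omega)
    (by omega)
  obtain ⟨b, hb, hst⟩ := exists_frame_stdSp1Sp hn (le_refl (4 * n)) (by omega)
  have := subsingleton_unitary_sub (R := ℍ[ℝ]) (n := n) (r := 4 * n) (by omega)
  exact isotropyZero_equiv_left
    (κ := (spToSp1Sp m).comp (lowerBlock ℍ[ℝ] (4 * n) m))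
    (quaternionRealCore m) (quaternionRealCore n)
    isUnitaryFor_stdSp1Sp isUnitaryFor_stdSp1Sp finrank_real_HVec ha hb
    (Or.inr (isUnitaryFor_stdSp1Sp.hasSignEigenvalues hb))
    (continuous_spToSp1Sp.comp continuous_lowerBlock)
    (spToSp1Sp_injective.comp lowerBlock_injective) hsta
    ((fixesUpToConj_stdSp _).comp (spToSp1Sp m) stdSp1Sp_spToSp1Sp) hst.eq_one v hv

end RealCases

/-! ### The representation of `SO(2) × Sp(1)Sp(n)` -/

section Two

variable {n : ℕ}

/-- The inclusion of `U(1)` in `Sp(1)`. -/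
noncomputable def u1ToSp1 : U1 →* Sp1 where
  toFun z := ⟨((z : ℂ) : ℍ[ℝ]), coeComplex_mem_unitary z⟩
  map_one' := Subtype.ext Quaternion.coeComplex_one
  map_mul' _ _ := Subtype.ext (Quaternion.coeComplex_mul _ _)

theorem coe_u1ToSp1 (z : U1) : (u1ToSp1 z : ℍ[ℝ]) = ((z : ℂ) : ℍ[ℝ]) := rfl

theorem coeComplex_injective {z w : ℂ} (h : (z : ℍ[ℝ]) = w) : z = w :=
  Complex.ext (congrArg (fun q : ℍ[ℝ] => q.re) h) (congrArg (fun q : ℍ[ℝ] => q.imI) h)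

theorem u1ToSp1_injective : Function.Injective u1ToSp1 := fun _ _ h =>
  Subtype.ext (coeComplex_injective (congrArg Subtype.val h))

theorem continuous_coeComplex : Continuous fun z : ℂ => (z : ℍ[ℝ]) := by
  have h : ∀ z : ℂ, (z : ℍ[ℝ]) = (z.re : ℍ[ℝ]) + z.im • quatI := fun z => by ext <;> simp
  simp_rw [h]
  exact (Quaternion.continuous_coe.comp Complex.continuous_re).add
    (Complex.continuous_im.smul continuous_const)

theorem continuous_u1ToSp1 : Continuous u1ToSp1 :=
  Continuous.subtype_mk (continuous_coeComplex.comp continuous_subtype_val) _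

/-- The homomorphism `(z, B) ↦ (z, diag(z, z, B))` from `U(1) × Sp(n - 2)` to `Sp(1) × Sp(n)`. -/
noncomputable def diagonalHom (n : ℕ) : U1 × Sp (n - 2) →* Sp1 × Sp n where
  toFun p := (u1ToSp1 p.1, blockHom ℍ[ℝ] 2 n (fun _ => u1ToSp1 p.1, p.2))
  map_one' := Prod.ext (map_one _) (by
    rw [Prod.fst_one, map_one]; exact map_one (blockHom ℍ[ℝ] 2 n))
  map_mul' p q := Prod.ext (map_mul _ _ _) (by
    rw [Prod.fst_mul, map_mul]
    exact map_mul (blockHom ℍ[ℝ] 2 n) (fun _ => u1ToSp1 p.1, p.2) (fun _ => u1ToSp1 q.1, q.2))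

theorem diagonalHom_neg (p : U1 × Sp (n - 2)) : diagonalHom n (-p) = -diagonalHom n p := by
  have h1 : (u1ToSp1 (-p.1) : ℍ[ℝ]) = -(u1ToSp1 p.1 : ℍ[ℝ]) := by
    change ((-(p.1 : ℂ) : ℂ) : ℍ[ℝ]) = -((p.1 : ℂ) : ℍ[ℝ])
    ext <;> simp
  refine Prod.ext (Subtype.ext h1) (Subtype.ext ?_)
  change blockMatrix 2 (fun _ => (u1ToSp1 (-p.1) : ℍ[ℝ]))
      (-(p.2 : Matrix (Fin (n - 2)) (Fin (n - 2)) ℍ[ℝ]))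
    = -blockMatrix 2 (fun _ => (u1ToSp1 p.1 : ℍ[ℝ])) (p.2 : Matrix (Fin (n - 2)) (Fin (n - 2)) ℍ[ℝ])
  rw [h1]
  refine Matrix.ext fun i j => ?_
  simp only [blockMatrix, Matrix.reindex_apply, Matrix.submatrix_apply, Matrix.neg_apply]
  rcases (blockEquiv 2 n).symm i with i | i <;> rcases (blockEquiv 2 n).symm j with j | j
  · by_cases hij : i = j <;> simp [hij]
  all_goals simp

theorem diagonalHom_injective : Function.Injective (diagonalHom n) := by
  intro p q h
  have h1 := u1ToSp1_injective (congrArg Prod.fst h)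
  have h2 : blockMatrix 2 (fun _ => (u1ToSp1 p.1 : ℍ[ℝ]))
      (p.2 : Matrix (Fin (n - 2)) (Fin (n - 2)) ℍ[ℝ])
    = blockMatrix 2 (fun _ => (u1ToSp1 q.1 : ℍ[ℝ]))
      (q.2 : Matrix (Fin (n - 2)) (Fin (n - 2)) ℍ[ℝ]) :=
    congrArg (fun x : Sp1 × Sp n => (x.2 : Matrix (Fin n) (Fin n) ℍ[ℝ])) h
  exact Prod.ext h1 (Subtype.ext (blockMatrix_inj h2))

/-- The embedding `[z, B] ↦ [z, diag(z, z, B)]` of `U(1)Sp(n - 2)` in `Sp(1)Sp(n)`. -/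
noncomputable def diagonalEmbedding (n : ℕ) : U1Sp (n - 2) →* Sp1Sp n :=
  QuotientGroup.lift (diagNeg U1 (Sp (n - 2)))
    ((QuotientGroup.mk' (diagNeg Sp1 (Sp n))).comp (diagonalHom n)) (by
      intro p hp
      rcases (diagNeg_eq _ _).mp hp with rfl | rfl
      · exact map_one _
      · rw [MonoidHom.mem_ker, MonoidHom.comp_apply, diagonalHom_neg, map_one]
        exact (centralProduct_mk_eq (x := (1 : Sp1 × Sp n))).mpr (Or.inr rfl) |>.symm)

theorem diagonalEmbedding_mk (p : U1 × Sp (n - 2)) :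
    diagonalEmbedding n (QuotientGroup.mk p) = QuotientGroup.mk (diagonalHom n p) := rfl

theorem diagonalEmbedding_injective : Function.Injective (diagonalEmbedding n) := by
  intro x y h
  obtain ⟨p, rfl⟩ := QuotientGroup.mk_surjective x
  obtain ⟨q, rfl⟩ := QuotientGroup.mk_surjective y
  rw [diagonalEmbedding_mk, diagonalEmbedding_mk, centralProduct_mk_eq] at h
  refine centralProduct_mk_eq.mpr (h.imp (fun h => diagonalHom_injective h) fun h => ?_)
  rw [← diagonalHom_neg] at h
  exact diagonalHom_injective h

theorem continuous_diagonalEmbedding : Continuous (diagonalEmbedding n) := by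
  have h : Continuous (diagonalHom n) := by
    have h1 : Continuous fun p : U1 × Sp (n - 2) => u1ToSp1 p.1 :=
      continuous_u1ToSp1.comp continuous_fst
    exact h1.prodMk (continuous_blockHom.comp
      ((continuous_pi fun _ => h1).prodMk continuous_snd))
  exact (QuotientGroup.isQuotientMap_mk (N := diagNeg U1 (Sp (n - 2)))).continuous_iff.mpr
    (QuotientGroup.continuous_mk.comp h)

/-- Every quaternion is conjugate to a complex number. -/
theorem exists_conj_complex (h : ℍ[ℝ]) :
    ∃ q ∈ unitary ℍ[ℝ], (q * h * star q).imJ = 0 ∧ (q * h * star q).imK = 0 := by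
  by_cases h0 : h.imJ = 0 ∧ h.imK = 0
  · exact ⟨1, one_mem _, by simpa using h0⟩
  -- `s i + h.im` intertwines conjugation of `h.im` with `s i`
  obtain ⟨s, hs⟩ : ∃ s : ℝ, s ^ 2 = h.imI ^ 2 + h.imJ ^ 2 + h.imK ^ 2 :=
    ⟨_, Real.sq_sqrt (by positivity)⟩
  obtain ⟨p, p0, p1, p2, p3⟩ : ∃ p : ℍ[ℝ], p.re = 0 ∧ p.imI = s + h.imI ∧ p.imJ = h.imJ ∧
    p.imK = h.imK := ⟨⟨0, s + h.imI, h.imJ, h.imK⟩, rfl, rfl, rfl, rfl⟩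
  have hp : p ≠ 0 := fun h' => h0 (by rw [← p2, ← p3, h']; exact ⟨rfl, rfl⟩)
  have hn : ‖p‖ ≠ 0 := norm_ne_zero_iff.mpr hp
  refine ⟨‖p‖⁻¹ • p, mem_unitary_of_norm_eq_one ?_, ?_, ?_⟩
  · rw [norm_smul, norm_inv, norm_norm, inv_mul_cancel₀ hn]
  · rw [star_real_smul, smul_mul_assoc, smul_mul_smul_comm, Quaternion.imJ_smul]
    have : (p * h * star p).imJ = 0 := by
      simp [p0, p1, p2, p3]; linear_combination -h.imJ * hs
    rw [this, smul_zero]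
  · rw [star_real_smul, smul_mul_assoc, smul_mul_smul_comm, Quaternion.imK_smul]
    have : (p * h * star p).imK = 0 := by
      simp [p0, p1, p2, p3]; linear_combination -h.imK * hs
    rw [this, smul_zero]

theorem exists_upperTriangular_Sp (x : ℕ → HVec n) (M : ℕ) :
    ∃ g : Sp n, ∀ i < M, ∀ j : Fin n,
      (i < j → ((g : Matrix (Fin n) (Fin n) ℍ[ℝ]) *ᵥ x i) j = 0) ∧
      (i = j → ∃ r : ℝ, 0 ≤ r ∧ ((g : Matrix (Fin n) (Fin n) ℍ[ℝ]) *ᵥ x i) j = (r : ℍ[ℝ])) := by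
  obtain ⟨g, -, h⟩ := (clearsBelow_connectedComponentOfOne (D := ℍ[ℝ]) (n := n)
    one_lt_rank_quaternion).exists_upperTriangular x M fun _ _ h => h
  exact ⟨g, h⟩

/-- Multiples of `ε₀` and `ε₁ + ε₀ i`: the quaternions commuting with `i` are the complex numbers. -/
theorem exists_frame_stdSp1Sp_two (hn : 2 ≤ n) :
    ∃ a : Fin 2 → HVec n, OrthonormalFor (quaternionRealCore n) a ∧
      StabilizerIn (stdSp1Sp n) a (diagonalEmbedding n) := by
  let c : ℕ → ℍ[ℝ] := fun k => if k = 1 then quatI else 0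
  obtain ⟨a, ha, h⟩ := exists_frame_HVec (n := n) (r := 2) (by omega) (by omega) (by omega)
    (le_refl n) c rfl
    (fun k => by simp only [c]; split_ifs <;> rfl)
    (fun k l hkl => by simp only [c]; split_ifs <;> simp_all)
    (fun k hk hk' => absurd hk' (not_lt.mpr hk))
  refine ⟨a, ha, fun g hg => ?_⟩
  obtain ⟨⟨q, g⟩, rfl⟩ := QuotientGroup.mk_surjective g
  obtain ⟨h1, h2⟩ := h g g.2 q q.2 fun i => op_smul_of_mul_star q.2 (hg i)
  have hI := h1 1 (by omega) (by omega)
  have hJ : (q : ℍ[ℝ]).imJ = 0 := by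
    have := congrArg (fun q : ℍ[ℝ] => q.imK) hI
    simp [c] at this; linarith
  have hK : (q : ℍ[ℝ]).imK = 0 := by
    have := congrArg (fun q : ℍ[ℝ] => q.imJ) hI
    simp [c] at this; linarith
  let z : ℂ := ⟨(q : ℍ[ℝ]).re, (q : ℍ[ℝ]).imI⟩
  have hzq : (z : ℍ[ℝ]) = q := by ext <;> simp [z, hJ, hK]
  have hz : z ∈ unitary ℂ := by
    have hs : z * star z = 1 := coeComplex_injective (by
      rw [Quaternion.coeComplex_mul, ← star_coeComplex, hzq, Quaternion.coeComplex_one]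
      exact Unitary.mul_star_self_of_mem q.2)
    exact Unitary.mem_iff.mpr ⟨by rw [mul_comm]; exact hs, hs⟩
  have hqz : u1ToSp1 ⟨z, hz⟩ = q := Subtype.ext hzq
  obtain ⟨B, hB⟩ := exists_eq_blockHom (g := g) (r := 2) (fun _ => q) fun i hi => by
    rw [← unitVec_coe, h2 i hi]
    funext j
    by_cases hij : j = i
    · simp [unitVec_apply, hij]
    · simp [unitVec_apply, hij, Fin.ext_iff.not.mp hij]
  refine ⟨QuotientGroup.mk (⟨z, hz⟩, B), ?_⟩
  rw [diagonalEmbedding_mk, hB, ← hqz]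
  rfl

/-- Two vectors of `ℍⁿ` can be moved to `ε₀ ℂ + ε₁ ℂ`: the `QR` decomposition leaves one entry that
is not real, and a conjugation makes it complex. -/
theorem fixesUpToConj_diagonalEmbedding : FixesUpToConj (stdSp1Sp n) 2 (diagonalEmbedding n) := by
  intro x
  obtain ⟨g, hg⟩ := exists_upperTriangular_Sp (fun i => if hi : i < 2 then x ⟨i, hi⟩ else 0) 2
  have hg' : ∀ (i : Fin 2) (j : Fin n),
      ((i : ℕ) < j → ((g : Matrix (Fin n) (Fin n) ℍ[ℝ]) *ᵥ x i) j = 0) ∧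
      ((i : ℕ) = j →
        ∃ r : ℝ, 0 ≤ r ∧ ((g : Matrix (Fin n) (Fin n) ℍ[ℝ]) *ᵥ x i) j = (r : ℍ[ℝ])) := by
    intro i j
    have := hg i i.2 j
    rwa [dif_pos i.2] at this
  obtain ⟨q, hq, hqJ, hqK⟩ := exists_conj_complex
    (if hn : 0 < n then ((g : Matrix (Fin n) (Fin n) ℍ[ℝ]) *ᵥ x 1) ⟨0, hn⟩ else 0)
  let G₀ : Sp1Sp n := QuotientGroup.mk (⟨q, hq⟩, blockHom ℍ[ℝ] 2 n (fun _ => ⟨q, hq⟩, 1) * g)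
  have hG : ∀ i j, stdSp1Sp n G₀ (x i) j
      = q * ((g : Matrix (Fin n) (Fin n) ℍ[ℝ]) *ᵥ x i) j * star q := by
    intro i j
    change ((blockMatrix 2 (fun _ => q) (1 : Matrix (Fin (n - 2)) (Fin (n - 2)) ℍ[ℝ]) *
      (g : Matrix (Fin n) (Fin n) ℍ[ℝ])) *ᵥ x i) j * star q = _
    rw [← Matrix.mulVec_mulVec, blockMatrix_mulVec _ _ fun j hj => (hg' i j).1 (by omega)]
    rfl
  have hzero : ∀ i (j : Fin n), 2 ≤ (j : ℕ) → stdSp1Sp n G₀ (x i) j = 0 := by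
    intro i j hj
    rw [hG, (hg' i j).1 (by omega), mul_zero, zero_mul]
  have hreal : ∀ r : ℝ, q * (r : ℍ[ℝ]) * star q = (r : ℍ[ℝ]) := fun r => by
    rw [← Quaternion.coe_commutes, mul_assoc, Unitary.mul_star_self_of_mem hq, mul_one]
  have hcomplex : ∀ i j, (stdSp1Sp n G₀ (x i) j).imJ = 0 ∧ (stdSp1Sp n G₀ (x i) j).imK = 0 := by
    intro i j
    rcases lt_trichotomy (i : ℕ) j with h | h | h
    · rw [hG, (hg' i j).1 h]; simp
    · obtain ⟨r, -, hr⟩ := (hg' i j).2 h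
      rw [hG, hr, hreal]; simp
    · have hi : i = 1 := Fin.ext (by have := i.2; simp; omega)
      have hj : j = ⟨0, by have := j.2; omega⟩ := Fin.ext (by have := i.2; simp; omega)
      subst hi
      rw [dif_pos (by have := j.2; omega)] at hqJ hqK
      rw [hG, hj]
      exact ⟨hqJ, hqK⟩
  refine ⟨G₀⁻¹, fun l i => ?_⟩
  obtain ⟨⟨z, B⟩, rfl⟩ := QuotientGroup.mk_surjective l
  have key : stdSp1Sp n (diagonalEmbedding n (QuotientGroup.mk (z, B))) (stdSp1Sp n G₀ (x i))
      = stdSp1Sp n G₀ (x i) := by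
    funext j
    change (blockMatrix 2 (fun _ => ((z : ℂ) : ℍ[ℝ])) (B : Matrix _ _ _) *ᵥ
      (stdSp1Sp n G₀ (x i))) j * star ((z : ℂ) : ℍ[ℝ]) = _
    rw [blockMatrix_mulVec _ _ (hzero i)]
    have hcomm : ((z : ℂ) : ℍ[ℝ]) * stdSp1Sp n G₀ (x i) j
        = stdSp1Sp n G₀ (x i) j * ((z : ℂ) : ℍ[ℝ]) := by
      obtain ⟨h1, h2⟩ := hcomplex i j
      ext <;> simp [h1, h2] <;> ring
    rw [Pi.mul_apply, hcomm, mul_assoc, Unitary.mul_star_self_of_mem (coeComplex_mem_unitary z),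
      mul_one]
  rw [map_mul, map_mul, Module.End.mul_apply, Module.End.mul_apply, inv_inv, key]
  exact Representation.inv_self_apply _ _ _

theorem repSOSp1Sp_two (hn : 2 ≤ n) (v : (Fin 2 → ℝ) ⊗[ℝ] HVec n)
    (hv : IsPrincipal (repSOSp1Sp 2 n) v) :
    (∀ h ∈ isotropyZero (repSOSp1Sp 2 n) v, (h : SO 2 × Sp1Sp n).1 = 1) ∧
      Nonempty (isotropyZero (repSOSp1Sp 2 n) v ≃ₜ* U1Sp (n - 2)) := by
  obtain ⟨b, hb, hst⟩ := exists_frame_stdSp1Sp_two hn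
  exact isotropyZero_equiv_right (realCore 2) (quaternionRealCore n) isUnitaryFor_stdSO
    isUnitaryFor_stdSp1Sp (Module.finrank_fin_fun ℝ) (orthonormalFor_single_real le_rfl) hb
    (Or.inr (isUnitaryFor_stdSp1Sp.hasSignEigenvalues hb)) continuous_diagonalEmbedding
    diagonalEmbedding_injective hst fixesUpToConj_diagonalEmbedding stdSO_eq_one v hv

end Two

/-! ### A unitary frame of `ℂ²ⁿ` on which eigenvalues of `Sp(n)` are signs -/

section OddFrame

variable {n r : ℕ}

theorem complex_smul_eq_op_smul (z : ℂ) (x : HVec n) : z • x = MulOpposite.op (z : ℍ[ℝ]) • x :=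
  funext fun _ => complex_smul_def _ _

/-- If the quaternionic product `h` of two eigenvectors of `g` lies in `jℂ`, then `s̄ h t = h s t`,
and invariance under `g` forces `s t = 1`. -/
theorem mul_eigenvalue_eq_one {g : Matrix (Fin n) (Fin n) ℍ[ℝ]}
    (hg : g ∈ unitary (Matrix (Fin n) (Fin n) ℍ[ℝ])) {x y : HVec n} {s t : ℂ}
    (hx : g *ᵥ x = s • x) (hy : g *ᵥ y = t • y) (h : complexPart (star x ⬝ᵥ y) = 0)
    (h0 : star x ⬝ᵥ y ≠ 0) : s * t = 1 := by
  have h1 := star_mulVec_dotProduct_mulVec hg x y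
  rw [hx, hy, complex_smul_eq_op_smul, complex_smul_eq_op_smul, star_op_smul_dotProduct] at h1
  set p := star x ⬝ᵥ y
  have hre : p.re = 0 := congrArg Complex.re h
  have him : p.imI = 0 := congrArg Complex.im h
  have h2 : star (s : ℍ[ℝ]) * p = p * (s : ℍ[ℝ]) := by
    ext <;> simp [hre, him] <;> ring
  rw [h2, mul_assoc, ← Quaternion.coeComplex_mul] at h1
  refine coeComplex_injective ?_
  rw [Quaternion.coeComplex_one]
  exact mul_left_cancel₀ h0 (h1.trans (mul_one p).symm)

/-- Vectors of `ℍⁿ` that are orthogonal over `ℂ` but not over `ℍ`: the product of consecutive ones,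
and that of the first and the third, is `j`. -/
noncomputable def oddVec (n : ℕ) : ℕ → HVec n
  | 0 => unitVec n 0
  | 1 => unitVec n 1 + MulOpposite.op quatJ • unitVec n 0
  | 2 => unitVec n 2 + MulOpposite.op (quatJ - 1) • unitVec n 1 + MulOpposite.op quatJ • unitVec n 0
  | k + 3 => unitVec n (k + 3) + MulOpposite.op quatJ • unitVec n (k + 2)

theorem star_op_smul_dotProduct_left (x y : HVec n) (p : ℍ[ℝ]) :
    star (MulOpposite.op p • x) ⬝ᵥ y = star p * (star x ⬝ᵥ y) := by
  simpa using star_op_smul_dotProduct x y p 1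

theorem star_oddVec_dotProduct (hn : 2 ≤ n) {k l : ℕ} (hkl : k < l) (hk : k < n) :
    star (oddVec n k) ⬝ᵥ oddVec n l = if l = k + 1 ∨ (k = 0 ∧ l = 2) then quatJ else 0 := by
  have h0 : 0 < n := by omega
  have h1 : 1 < n := by omega
  have hJ : star quatJ * quatJ = 1 := by ext <;> simp
  rcases k with _ | _ | _ | k <;> rcases l with _ | _ | _ | l <;> try omega
  all_goals
    simp [oddVec, -MulOpposite.op_sub, add_dotProduct, dotProduct_add, star_op_smul_dotProduct_left,
      star_unitVec_dotProduct_unitVec, h0, h1, hk, hJ]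
  split_ifs <;> first | omega | simp

/-- The first vectors of the family span the same quaternionic space as the unit vectors. -/
theorem unitVec_of_oddVec {P : HVec n → Prop} (hadd : ∀ x y, P x → P y → P (x + y))
    (hsmul : ∀ (q : ℍ[ℝ]) x, P x → P (MulOpposite.op q • x)) {N : ℕ}
    (h : ∀ k < N, P (oddVec n k)) (k : ℕ) (hk : k < N) : P (unitVec n k) := by
  have hsub : ∀ x y (q : ℍ[ℝ]), P (x + MulOpposite.op q • y) → P y → P x := by
    intro x y q h1 h2
    have := hadd _ _ h1 (hsmul (-q) _ h2)
    rwa [MulOpposite.op_neg, neg_smul, add_neg_cancel_right] at this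
  induction k using Nat.strong_induction_on with
  | _ k ih =>
    have := h k hk
    rcases k with _ | _ | _ | k
    · exact this
    · exact hsub _ _ _ this (ih 0 (by omega) (by omega))
    · exact hsub _ _ _ (hsub _ _ _ this (ih 0 (by omega) (by omega)))
        (ih 1 (by omega) (by omega))
    · exact hsub _ _ _ this (ih (k + 2) (by omega) (by omega))

/-- A frame of at least three vectors on which elements of `Sp(n)` have only the eigenvalues `±1`:
the vectors `oddVec` up to scalars, extended to a unitary basis. -/
theorem exists_frame_stdSp (hn : 2 ≤ n) (hr3 : 3 ≤ r) (hr : r ≤ 2 * n) :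
    ∃ b : Fin r → HVec n, OrthonormalFor (quaternionCore n) b ∧ HasSignEigenvalues (stdSp n) b ∧
      StabilizerIn (stdSp n) b (lowerBlock ℍ[ℝ] r n) := by
  have hJ : quatJ ≠ 0 := fun h => by
    have := congrArg (fun q : ℍ[ℝ] => q.imJ) h
    simp at this
  have hpair : ∀ k l, k < l → l < max n 3 → star (oddVec n k) ⬝ᵥ oddVec n l
      = if l = k + 1 ∨ (k = 0 ∧ l = 2) then quatJ else 0 := fun k l hkl hl =>
    star_oddVec_dotProduct hn hkl (by omega)
  have horth : ∀ k l, k < l → l < max n 3 →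
      complexPart (star (oddVec n k) ⬝ᵥ oddVec n l) = 0 := by
    intro k l hkl hl
    rw [hpair k l hkl hl]
    split_ifs
    · exact Complex.ext rfl rfl
    · exact map_zero _
  obtain ⟨b, hb, -, hbf⟩ := exists_orthonormalFor_extension (quaternionCore n)
    finrank_complex_HVec (t := max n 3) (oddVec n)
    (fun k hk l hl hkl => by
      rcases lt_or_gt_of_ne hkl with h | h
      · exact horth k l h hl
      · rw [← (quaternionCore n).conj_inner_symm]
        rw [show (quaternionCore n).inner (oddVec n l) (oddVec n k) = 0 from horth l k h hk]
        simp)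
    (fun k hk h => by
      -- each vector has non-zero product with one of the first two
      rcases Nat.lt_or_ge (k + 1) (max n 3) with h1 | h1
      · have := hpair k (k + 1) (by omega) h1
        rw [if_pos (Or.inl rfl), h] at this
        exact hJ (by simpa using this.symm)
      · have := hpair (k - 1) k (by omega) hk
        rw [if_pos (Or.inl (by omega)), h] at this
        exact hJ (by simpa using this.symm))
  have heig : ∀ (g : Sp n) (i : Fin (2 * n)) (s : ℂ), (i : ℕ) < max n 3 →
      stdSp n g (b i) = s • b i →
      (g : Matrix (Fin n) (Fin n) ℍ[ℝ]) *ᵥ oddVec n i = s • oddVec n i := by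
    intro g i s hi h
    obtain ⟨c, -, hc⟩ := hbf i hi
    rw [← stdSp_apply, hc, map_smul, h, smul_comm]
  refine ⟨fun i => b (Fin.castLE hr i), fun i j => ?_, fun g s hs => ?_, fun g hg => ?_⟩
  · rw [hb]; simp
  · -- the eigenvalues as a function of a natural number
    obtain ⟨S, hS⟩ : ∃ S : ℕ → ℂ, ∀ i : Fin r, s i = S i :=
      ⟨fun k => if h : k < r then s ⟨k, h⟩ else 1, fun i => by simp⟩
    have hSf : ∀ k < r, k < max n 3 →
        (g : Matrix (Fin n) (Fin n) ℍ[ℝ]) *ᵥ oddVec n k = S k • oddVec n k := by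
      intro k hk hkt
      exact heig g (Fin.castLE hr ⟨k, hk⟩) _ hkt (by rw [hs ⟨k, hk⟩, hS])
    have hmul : ∀ k l, k < l → l < r → l < max n 3 → (l = k + 1 ∨ (k = 0 ∧ l = 2)) →
        S k * S l = 1 := by
      intro k l hkl hl hlt h
      refine mul_eigenvalue_eq_one g.2 (hSf k (by omega) (by omega)) (hSf l hl hlt)
        (horth k l hkl hlt) ?_
      rw [hpair k l hkl hlt, if_pos h]
      exact hJ
    -- the triangle `0`, `1`, `2`
    have hS0 : S 0 = 1 ∨ S 0 = -1 := by
      have h01 := hmul 0 1 (by omega) (by omega) (by omega) (by omega)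
      have h02 := hmul 0 2 (by omega) (by omega) (by omega) (by omega)
      have h12 := hmul 1 2 (by omega) (by omega) (by omega) (by omega)
      refine mul_self_eq_one_iff.mp ?_
      linear_combination (S 0 * S 2) * h01 + h02 - S 0 * S 0 * h12
    have hstep : ∀ {x y : ℂ}, (x = 1 ∨ x = -1) → x * y = 1 → (y = 1 ∨ y = -1) := by
      rintro x y (rfl | rfl) h
      · left; simpa using h
      · right; linear_combination -h
    have hSt : ∀ k < r, k < max n 3 → S k = 1 ∨ S k = -1 := by
      intro k
      induction k with
      | zero => exact fun _ _ => hS0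
      | succ k ih =>
        intro hk hkt
        exact hstep (ih (by omega) (by omega))
          (hmul k (k + 1) (by omega) hk hkt (Or.inl rfl))
    intro i
    rw [hS]
    by_cases hi : (i : ℕ) < max n 3
    · exact hSt i i.2 hi
    -- `b i` cannot be orthogonal over `ℍ` to the basis given by the first vectors
    obtain ⟨k, hk, hne⟩ : ∃ k < n, star (oddVec n k) ⬝ᵥ b (Fin.castLE hr i) ≠ 0 := by
      by_contra! hcon
      refine hb.ne_zero (Fin.castLE hr i) (funext fun j => ?_)
      have := unitVec_of_oddVec (P := fun x => star x ⬝ᵥ b (Fin.castLE hr i) = 0)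
        (fun x y hx hy => by rw [star_add, add_dotProduct, hx, hy, add_zero])
        (fun q x hx => by rw [star_op_smul_dotProduct_left, hx, mul_zero]) hcon j j.2
      simpa [star_unitVec_dotProduct] using this
    refine hstep (hSt k (by omega) (by omega)) (mul_eigenvalue_eq_one g.2
      (hSf k (by omega) (by omega)) (y := b (Fin.castLE hr i)) ?_ ?_ hne)
    · rw [← stdSp_apply, hs i, hS]
    · obtain ⟨c, -, hc⟩ := hbf ⟨k, by omega⟩ (by simp; omega)
      change oddVec n k = _ at hc
      rw [← quaternionCore_inner, hc, (quaternionCore n).smul_left, hb, if_neg, mul_zero]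
      intro h
      have := congrArg Fin.val h
      simp at this; omega
  · refine mem_range_lowerBlock_of_unitVec fun k hk => ?_
    rcases Nat.lt_or_ge k (max n 3) with hkt | hkt
    · refine unitVec_of_oddVec
        (P := fun x => (g : Matrix (Fin n) (Fin n) ℍ[ℝ]) *ᵥ x = x)
        (fun x y hx hy => by rw [Matrix.mulVec_add, hx, hy])
        (fun q x hx => by rw [Matrix.mulVec_smul, hx]) (N := min r (max n 3)) ?_ k (by omega)
      intro l hl
      have := heig g (Fin.castLE hr ⟨l, by omega⟩) 1 (by simp; omega)
        (by rw [one_smul]; exact hg _)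
      simpa using this
    · have : unitVec n k = 0 := by rw [unitVec, dif_neg (by omega)]
      rw [this]; simp

end OddFrame

/-! ### The generic complex tensor products -/

section ComplexCases

variable {m n : ℕ}

theorem repUSp_of_le (hn : 2 ≤ n) (hnm : 2 * n ≤ m) (v : (Fin m → ℂ) ⊗[ℂ] HVec n)
    (hv : IsPrincipal (repUSp m n) v) :
    Nonempty (isotropyZero (repUSp m n) v ≃ₜ* U (m - 2 * n)) := by
  obtain ⟨b, hb, hs, hst⟩ := exists_frame_stdSp hn (by omega) (le_refl (2 * n))
  have := subsingleton_unitary_sub (R := ℍ[ℝ]) (n := n) (r := 2 * n) (by omega)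
  exact isotropyZero_equiv_left (complexCore m) (quaternionCore n) isUnitaryFor_stdU
    isUnitaryFor_stdSp finrank_complex_HVec (orthonormalFor_single_complex hnm) hb (Or.inr hs)
    continuous_lowerBlock lowerBlock_injective (stabilizerIn_stdU hnm) (fixesUpToConj_stdU _)
    hst.eq_one v hv

theorem repUSp_of_ge (hm : 3 ≤ m) (hn : 2 ≤ n) (hmn : m ≤ 2 * n) (v : (Fin m → ℂ) ⊗[ℂ] HVec n)
    (hv : IsPrincipal (repUSp m n) v) :
    Nonempty (isotropyZero (repUSp m n) v ≃ₜ* Sp (n - m)) := by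
  obtain ⟨b, hb, hs, hst⟩ := exists_frame_stdSp hn hm hmn
  have := subsingleton_unitary_sub (R := ℂ) (le_refl m)
  exact (isotropyZero_equiv_right (complexCore m) (quaternionCore n) isUnitaryFor_stdU
    isUnitaryFor_stdSp (Module.finrank_fin_fun ℂ) (orthonormalFor_single_complex le_rfl) hb
    (Or.inr hs) continuous_lowerBlock lowerBlock_injective hst (fixesUpToConj_stdSp _)
    (stabilizerIn_stdU le_rfl).eq_one v hv).2

/-- `U(1)Sp(n)` acts faithfully. -/
theorem stdU1Sp_eq_one (hn : 1 ≤ n) {g : U1Sp n} (hg : ∀ x, stdU1Sp n g x = x) : g = 1 := by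
  obtain ⟨b, -, hst⟩ := exists_frame_realify_stdU1Sp hn (le_refl (4 * n)) (by omega)
  have := subsingleton_unitary_sub (R := ℍ[ℝ]) (n := n) (r := 4 * n) (by omega)
  exact hst.eq_one g fun i => hg (b i)

theorem repSpU1Sp_of_le (hn : 2 ≤ n) (hnm : n ≤ m) (v : HVec m ⊗[ℂ] HVec n)
    (hv : IsPrincipal (repSpU1Sp m n) v) :
    Nonempty (isotropyZero (repSpU1Sp m n) v ≃ₜ* Sp (m - 2 * n)) := by
  obtain ⟨a, ha, hs, hst⟩ := exists_frame_stdSp (n := m) (r := 2 * n) (by omega) (by omega)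
    (by omega)
  obtain ⟨b, hb, hspan, -⟩ := exists_orthonormalFor_extension (quaternionCore n)
    finrank_complex_HVec (t := 0) (fun _ => 0) (by simp) (by simp)
  refine isotropyZero_equiv_left (quaternionCore m) (quaternionCore n) isUnitaryFor_stdSp
    isUnitaryFor_stdU1Sp finrank_complex_HVec ha hb (Or.inl hs) continuous_lowerBlock
    lowerBlock_injective hst (fixesUpToConj_stdSp _)
    (fun g hg => stdU1Sp_eq_one (by omega) fun x => sub_eq_zero.mp (hspan _ fun i => ?_)) v hv
  have h1 := isUnitaryFor_stdU1Sp g (b i) x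
  rw [hg i] at h1
  rw [quaternionCore_inner, quaternionCore_inner] at h1
  rw [quaternionCore_inner, dotProduct_sub, map_sub, h1, sub_self]

end ComplexCases

/-! ### Diagonalization of a tensor by a unitary group -/

section Diagonalization

variable {m : ℕ}

theorem exists_unitary_orthogonal' {V : Type*} [NormedAddCommGroup V] [InnerProductSpace ℂ V]
    (x : Fin m → V) : ∃ u : U m, ∀ k l, k ≠ l →
      inner ℂ (∑ i, (u : Matrix (Fin m) (Fin m) ℂ) k i • x i)
        (∑ i, (u : Matrix (Fin m) (Fin m) ℂ) l i • x i) = 0 := by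
  have hH := Matrix.isHermitian_gram ℂ x
  refine ⟨Matrix.UnitaryGroup.transpose hH.eigenvectorUnitary, fun k l hkl => ?_⟩
  have h1 := congrFun (congrFun hH.conjStarAlgAut_star_eigenvectorUnitary k) l
  rw [Matrix.diagonal_apply_ne _ hkl, Unitary.conjStarAlgAut_star_apply, mul_assoc] at h1
  rw [← h1]
  simp only [sum_inner, inner_sum, inner_smul_left, inner_smul_right, Matrix.mul_apply,
    Matrix.star_apply, Matrix.gram_apply, Finset.mul_sum]
  rw [Finset.sum_comm]
  refine Finset.sum_congr rfl fun i _ => Finset.sum_congr rfl fun j _ => ?_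
  simp only [Matrix.UnitaryGroup.transpose_coe, Matrix.transpose_apply, starRingEnd_apply]
  ring

/-- Some unitary combinations of given vectors are pairwise orthogonal, by the spectral theorem
for their Gram matrix, and can be ordered so that the vanishing ones come last. -/
theorem exists_unitary_orthogonal {V : Type*} [AddCommGroup V] [Module ℂ V]
    (c : InnerProductSpace.Core ℂ V) (x : Fin m → V) :
    ∃ (u : U m) (y : Fin m → V), (∀ k, y k = ∑ i, (u : Matrix (Fin m) (Fin m) ℂ) k i • x i) ∧
      (∀ k l, k ≠ l → c.inner (y k) (y l) = 0) ∧ ∀ k l, k ≤ l → y k = 0 → y l = 0 := by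
  obtain ⟨u, hu⟩ : ∃ u : U m, ∀ k l, k ≠ l →
      c.inner (∑ i, (u : Matrix (Fin m) (Fin m) ℂ) k i • x i)
        (∑ i, (u : Matrix (Fin m) (Fin m) ℂ) l i • x i) = 0 := by
    let _ : NormedAddCommGroup V := c.toNormedAddCommGroup
    let _ : InnerProductSpace ℂ V := InnerProductSpace.ofCore c.toCore
    exact exists_unitary_orthogonal' x
  classical
  let f : Fin m → ℕ := fun k =>
    if ∑ i, (u : Matrix (Fin m) (Fin m) ℂ) k i • x i = 0 then 1 else 0
  let σ := Tuple.sort f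
  refine ⟨⟨(u : Matrix (Fin m) (Fin m) ℂ).submatrix σ id, ?_⟩, _, fun k => rfl,
    fun k l hkl => hu _ _ (σ.injective.ne hkl), fun k l hkl hk => ?_⟩
  · rw [Matrix.mem_unitaryGroup_iff, Matrix.star_eq_conjTranspose, Matrix.conjTranspose_submatrix]
    have := Matrix.submatrix_mul_equiv (u : Matrix (Fin m) (Fin m) ℂ)
      (u : Matrix (Fin m) (Fin m) ℂ)ᴴ σ (Equiv.refl (Fin m)) σ
    rw [Equiv.coe_refl] at this
    rw [this, ← Matrix.star_eq_conjTranspose, Unitary.mul_star_self_of_mem u.2,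
      Matrix.submatrix_one_equiv]
  · have h1 : f (σ k) ≤ f (σ l) := Tuple.monotone_sort f hkl
    change ∑ i, (u : Matrix (Fin m) (Fin m) ℂ) (σ k) i • x i = 0 at hk
    by_contra h
    change ¬ ∑ i, (u : Matrix (Fin m) (Fin m) ℂ) (σ l) i • x i = 0 at h
    simp only [f] at h1
    rw [if_pos hk, if_neg h] at h1
    omega

/-- Under `U(m)`, every element of `ℂᵐ ⊗ V` is equivalent to some `∑ εₖ ⊗ yₖ` with orthogonal `yₖ`,
the vanishing ones last. -/
theorem exists_outerTensor_stdU_eq {G V : Type*} [Group G] [AddCommGroup V] [Module ℂ V]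
    (c : InnerProductSpace.Core ℂ V) (ρ : Representation ℂ G V) (v : (Fin m → ℂ) ⊗[ℂ] V) :
    ∃ (u : U m) (y : Fin m → V),
      outerTensor (stdU m) ρ (u, 1) v = ∑ k, (Pi.single k 1 : Fin m → ℂ) ⊗ₜ[ℂ] y k ∧
      (∀ k l, k ≠ l → c.inner (y k) (y l) = 0) ∧ ∀ k l, k ≤ l → y k = 0 → y l = 0 := by
  obtain ⟨x, rfl⟩ := TensorProduct.eq_repr_basis_left (Pi.basisFun ℂ (Fin m)) v
  obtain ⟨u, y, hy, h⟩ := exists_unitary_orthogonal c x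
  refine ⟨u, y, ?_, h⟩
  rw [Finsupp.sum_fintype _ _ (by simp), map_sum]
  simp only [outerTensor_tmul, map_one, Module.End.one_apply, Pi.basisFun_apply, stdU_apply,
    Matrix.mulVec_single_one, hy, TensorProduct.tmul_sum]
  rw [Finset.sum_comm]
  refine Finset.sum_congr rfl fun i _ => ?_
  simp only [← TensorProduct.smul_tmul]
  rw [← TensorProduct.sum_tmul]
  congr 1
  funext k
  simp [Finset.sum_apply, Pi.single_apply]

/-- Non-zero orthogonal vectors are at most as many as the dimension. -/
theorem eq_zero_of_orthogonal {V : Type*} [AddCommGroup V] [Module ℂ V] [FiniteDimensional ℂ V]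
    (c : InnerProductSpace.Core ℂ V) {N : ℕ} (hN : Module.finrank ℂ V = N) {y : Fin m → V}
    (horth : ∀ k l, k ≠ l → c.inner (y k) (y l) = 0) (hsort : ∀ k l, k ≤ l → y k = 0 → y l = 0)
    (k : Fin m) (hk : N ≤ k) : y k = 0 := by
  by_contra h
  have hlt : ∀ i < N, i < m := fun i hi => by have := k.2; omega
  obtain ⟨b, -, hspan, hb⟩ := exists_orthonormalFor_extension c hN (t := N)
    (fun i => if hi : i < m then y ⟨i, hi⟩ else 0)
    (fun i hi j hj hij => by
      simp only [dif_pos (hlt i hi), dif_pos (hlt j hj)]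
      exact horth _ _ (by simpa using hij))
    (fun i hi h0 => by
      simp only [dif_pos (hlt i hi)] at h0
      exact h (hsort _ _ (Fin.le_def.mpr (by simp; omega)) h0))
  refine h (hspan _ fun i => ?_)
  obtain ⟨s, hs0, hs⟩ := hb i i.2
  simp only [dif_pos (hlt i i.2)] at hs
  have h1 := horth ⟨i, hlt i i.2⟩ k (by rw [Ne, Fin.ext_iff]; simp; omega)
  rw [hs, c.smul_left] at h1
  exact (mul_eq_zero.mp h1).resolve_left (by simpa using hs0)

end Diagonalization

/-! ### The exceptional representations of `U(m) × Sp(n)` -/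

section Exceptional

variable {m n r : ℕ}

/-- The homomorphism `z ↦ (z, z̄, z̄, …)`. -/
noncomputable def conjDiagonal (n : ℕ) : U1 →* (Fin n → U1) where
  toFun z i := if (i : ℕ) = 0 then z else z⁻¹
  map_one' := funext fun i => by simp
  map_mul' z w := funext fun i => by
    rw [Pi.mul_apply]
    split_ifs
    · rfl
    · rw [mul_inv]

theorem conjDiagonal_apply (z : U1) (i : Fin n) :
    conjDiagonal n z i = if (i : ℕ) = 0 then z else z⁻¹ := rfl

theorem continuous_conjDiagonal : Continuous (conjDiagonal n) := by
  refine continuous_pi fun i => ?_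
  simp_rw [conjDiagonal_apply]
  split_ifs
  · exact continuous_id
  · exact continuous_inv

/-- The homomorphism `(z, A, B) ↦ (diag(z̄, z, A), diag(z, z̄, B))`, with `r` diagonal entries. For
`r ≤ 2` it describes the stabilizer of a generic tensor of rank `r`. -/
noncomputable def conjEmbedding (r m n : ℕ) : U1 × (U (m - r) × Sp (n - r)) →* U m × Sp n where
  toFun p := (blockHom ℂ r m (conjDiagonal m p.1⁻¹, p.2.1),
    blockHom ℍ[ℝ] r n (fun i => u1ToSp1 (conjDiagonal n p.1 i), p.2.2))
  map_one' := by
    rw [Prod.fst_one, inv_one, map_one, map_one]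
    refine Prod.ext (map_one (blockHom ℂ r m)) ?_
    simp only [Pi.one_apply, map_one]
    exact map_one (blockHom ℍ[ℝ] r n)
  map_mul' p q := by
    rw [Prod.fst_mul, mul_inv, map_mul, map_mul]
    refine Prod.ext (map_mul (blockHom ℂ r m) (conjDiagonal m p.1⁻¹, p.2.1)
      (conjDiagonal m q.1⁻¹, q.2.1)) ?_
    simp only [Pi.mul_apply, map_mul]
    exact map_mul (blockHom ℍ[ℝ] r n) (fun i => u1ToSp1 (conjDiagonal n p.1 i), p.2.2)
      (fun i => u1ToSp1 (conjDiagonal n q.1 i), q.2.2)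

theorem continuous_conjEmbedding : Continuous (conjEmbedding r m n) := by
  refine Continuous.prodMk (continuous_blockHom.comp (Continuous.prodMk
    (continuous_conjDiagonal.comp continuous_fst.inv) continuous_snd.fst))
    (continuous_blockHom.comp (Continuous.prodMk (continuous_pi fun i => ?_) continuous_snd.snd))
  exact continuous_u1ToSp1.comp
    ((continuous_apply i).comp (continuous_conjDiagonal.comp continuous_fst))

theorem conjEmbedding_injective (hr : 1 ≤ r) (hn : 1 ≤ n) :
    Function.Injective (conjEmbedding r m n) := by
  intro p q h
  have h1 : blockMatrix r (fun i => (conjDiagonal m p.1⁻¹ i : ℂ))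
      (p.2.1 : Matrix (Fin (m - r)) (Fin (m - r)) ℂ)
    = blockMatrix r (fun i => (conjDiagonal m q.1⁻¹ i : ℂ))
      (q.2.1 : Matrix (Fin (m - r)) (Fin (m - r)) ℂ) :=
    congrArg (fun x : U m × Sp n => (x.1 : Matrix (Fin m) (Fin m) ℂ)) h
  have h2 : blockMatrix r (fun i => (u1ToSp1 (conjDiagonal n p.1 i) : ℍ[ℝ]))
      (p.2.2 : Matrix (Fin (n - r)) (Fin (n - r)) ℍ[ℝ])
    = blockMatrix r (fun i => (u1ToSp1 (conjDiagonal n q.1 i) : ℍ[ℝ]))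
      (q.2.2 : Matrix (Fin (n - r)) (Fin (n - r)) ℍ[ℝ]) :=
    congrArg (fun x : U m × Sp n => (x.2 : Matrix (Fin n) (Fin n) ℍ[ℝ])) h
  refine Prod.ext (u1ToSp1_injective (Subtype.ext ?_))
    (Prod.ext (Subtype.ext (blockMatrix_inj h1)) (Subtype.ext (blockMatrix_inj h2)))
  have h3 := congrFun (congrFun h2 ⟨0, hn⟩) ⟨0, hn⟩
  rw [blockMatrix_apply _ _ _ _ (Or.inl hr), blockMatrix_apply _ _ _ _ (Or.inl hr), if_pos rfl,
    if_pos rfl, conjDiagonal_apply, conjDiagonal_apply, if_pos rfl, if_pos rfl] at h3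
  exact h3

theorem coe_u1ToSp1_inv (z : U1) : (u1ToSp1 z⁻¹ : ℍ[ℝ]) = star (u1ToSp1 z : ℍ[ℝ]) := by
  rw [map_inv]; rfl

/-- The image of the embedding fixes `∑ εₖ ⊗ xₖ` if `x₀` is a real multiple of `ε₀` and `x₁` is the
sum of a real multiple of `ε₁` and an element of `ε₀ jℂ`. -/
theorem outerTensor_conjEmbedding (hr : r ≤ 2) (p : U1 × (U (m - r) × Sp (n - r)))
    {x : Fin m → HVec n} (h0 : ∀ k : Fin m, r ≤ k → x k = 0)
    (hlt : ∀ (k : Fin m) (j : Fin n), (k : ℕ) < j → x k j = 0)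
    (heq : ∀ (k : Fin m) (j : Fin n), (k : ℕ) = j → ∃ c : ℝ, x k j = (c : ℍ[ℝ]))
    (hgt : ∀ (k : Fin m) (j : Fin n), (j : ℕ) < k → complexPart (x k j) = 0) :
    outerTensor (stdU m) (stdSp n) (conjEmbedding r m n p)
      (∑ k, (Pi.single k 1 : Fin m → ℂ) ⊗ₜ[ℂ] x k)
      = ∑ k, (Pi.single k 1 : Fin m → ℂ) ⊗ₜ[ℂ] x k := by
  rw [map_sum]
  refine Finset.sum_congr rfl fun k _ => ?_
  rcases le_or_gt r k with hk | hk
  · rw [h0 k hk, TensorProduct.tmul_zero, map_zero]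
  rw [outerTensor_tmul]
  have h1 : stdU m (conjEmbedding r m n p).1 (Pi.single k 1)
      = (conjDiagonal m p.1⁻¹ k : ℂ) • (Pi.single k 1 : Fin m → ℂ) := by
    change blockMatrix r (fun i => (conjDiagonal m p.1⁻¹ i : ℂ)) _ *ᵥ _ = _
    rw [blockMatrix_mulVec _ _ fun j hj => Pi.single_eq_of_ne (fun h => by subst h; omega) _]
    funext j
    by_cases hj : j = k
    · simp [hj]
    · simp [hj]
  have h2 : stdSp n (conjEmbedding r m n p).2 (x k)
      = fun j => (u1ToSp1 (conjDiagonal n p.1 j) : ℍ[ℝ]) * x k j := by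
    rw [stdSp_apply]
    change blockMatrix r (fun i => (u1ToSp1 (conjDiagonal n p.1 i) : ℍ[ℝ])) _ *ᵥ _ = _
    rw [blockMatrix_mulVec _ _ fun j hj => hlt k j (by omega)]
    rfl
  rw [h1, h2, TensorProduct.smul_tmul]
  congr 1
  funext j
  rw [Pi.smul_apply, complex_smul_def, ← coe_u1ToSp1, conjDiagonal_apply, conjDiagonal_apply]
  have hz : ∀ z : U1, star (u1ToSp1 z : ℍ[ℝ]) * u1ToSp1 z = 1 ∧
      (u1ToSp1 z : ℍ[ℝ]) * star (u1ToSp1 z : ℍ[ℝ]) = 1 := fun z =>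
    Unitary.mem_iff.mp (u1ToSp1 z).2
  rcases lt_trichotomy (k : ℕ) j with h | h | h
  · rw [hlt k j h, mul_zero, zero_mul]
  · obtain ⟨c, hc⟩ := heq k j h
    rw [hc, ← Quaternion.coe_commutes, mul_assoc, h]
    split_ifs
    · rw [coe_u1ToSp1_inv, (hz _).2, mul_one]
    · rw [inv_inv, coe_u1ToSp1_inv, (hz _).1, mul_one]
  · rw [if_pos (by omega), if_neg (by omega), inv_inv]
    have hre : (x k j).re = 0 := congrArg Complex.re (hgt k j h)
    have him : (x k j).imI = 0 := congrArg Complex.im (hgt k j h)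
    have h3 : (u1ToSp1 p.1 : ℍ[ℝ]) * x k j = x k j * star (u1ToSp1 p.1 : ℍ[ℝ]) := by
      rw [coe_u1ToSp1]
      ext <;> simp [hre, him] <;> ring
    rw [h3, mul_assoc, (hz _).1, mul_one]

/-- A tensor of rank at most `r` is diagonalized by `U(m)`, and then brought into upper triangular
form by `Sp(n)`. -/
theorem exists_conj_conjEmbedding (hr : r ≤ 2) (hrmn : m ≤ r ∨ 2 * n ≤ r)
    (v : (Fin m → ℂ) ⊗[ℂ] HVec n) :
    ∃ g, ∀ p, g * conjEmbedding r m n p * g⁻¹ ∈ isotropy (repUSp m n) v := by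
  obtain ⟨u, y, hv, horth, hsort⟩ := exists_outerTensor_stdU_eq (quaternionCore n) (stdSp n) v
  have hy0 : ∀ k : Fin m, r ≤ k → y k = 0 := by
    intro k hk
    rcases hrmn with h | h
    · exact absurd k.2 (by omega)
    · exact eq_zero_of_orthogonal (quaternionCore n) finrank_complex_HVec horth hsort k (by omega)
  obtain ⟨g, hg⟩ := exists_upperTriangular_Sp
    (fun i => if hi : i < m then y ⟨i, hi⟩ else 0) m
  let x : Fin m → HVec n := fun k => (g : Matrix (Fin n) (Fin n) ℍ[ℝ]) *ᵥ y k
  have hg' : ∀ (k : Fin m) (j : Fin n), ((k : ℕ) < j → x k j = 0) ∧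
      ((k : ℕ) = j → ∃ c : ℝ, 0 ≤ c ∧ x k j = (c : ℍ[ℝ])) := by
    intro k j
    have := hg k k.2 j
    rwa [dif_pos k.2] at this
  have hgv : repUSp m n (u, g) v = ∑ k, (Pi.single k 1 : Fin m → ℂ) ⊗ₜ[ℂ] x k := by
    have h1 : ((u, g) : U m × Sp n) = (1, g) * (u, 1) := by simp
    rw [h1, map_mul, Module.End.mul_apply]
    change outerTensor _ _ _ (outerTensor _ _ _ _) = _
    rw [hv, map_sum]
    refine Finset.sum_congr rfl fun k _ => ?_
    rw [outerTensor_tmul, map_one, Module.End.one_apply, stdSp_apply]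
  refine ⟨(u, g)⁻¹, fun p => ?_⟩
  change repUSp m n _ v = v
  rw [inv_inv, map_mul, map_mul, Module.End.mul_apply, Module.End.mul_apply, hgv]
  have key := outerTensor_conjEmbedding hr p (x := x)
    (fun k hk => by simp only [x]; rw [hy0 k hk, Matrix.mulVec_zero])
    (fun k j => (hg' k j).1) (fun k j h => ((hg' k j).2 h).imp fun _ h => h.2) (fun k j h => ?_)
  · change repUSp m n _ (outerTensor _ _ _ _) = _
    rw [key, ← hgv]
    exact Representation.inv_self_apply _ _ _
  -- only the entry of `x 1` at `0` is in question; `x 0` is a multiple of `ε₀`, orthogonal to `x 1`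
  rcases le_or_gt r k with hk | hk
  · simp only [x]; rw [hy0 k hk, Matrix.mulVec_zero]; exact map_zero _
  have hk0 : (0 : ℕ) < m := by have := k.2; omega
  have hj0 : (j : ℕ) = 0 := by omega
  obtain ⟨c, -, hc⟩ := (hg' ⟨0, hk0⟩ j).2 hj0.symm
  have hdot : star (x ⟨0, hk0⟩) ⬝ᵥ x k = c * x k j := by
    rw [dotProduct, Finset.sum_eq_single j]
    · rw [Pi.star_apply, hc, Quaternion.star_coe]
    · intro i _ hij
      rw [Pi.star_apply, (hg' ⟨0, hk0⟩ i).1 (Nat.pos_of_ne_zero fun h => hij (Fin.ext (by omega))),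
        star_zero, zero_mul]
    · simp
  have h1 : complexPart ((c : ℍ[ℝ]) * x k j) = 0 := by
    have h2 := horth ⟨0, hk0⟩ k (by rw [Ne, Fin.ext_iff]; simp; omega)
    rwa [quaternionCore_inner, ← star_mulVec_dotProduct_mulVec g.2, hdot] at h2
  by_cases hc0 : c = 0
  · -- then `y 0 = 0`, and all other vectors vanish as well
    have hx0 : x ⟨0, hk0⟩ = 0 := by
      funext i
      by_cases hi : i = j
      · rw [hi, hc, hc0]; simp
      · exact (hg' ⟨0, hk0⟩ i).1 (Nat.pos_of_ne_zero fun h => hi (Fin.ext (by omega)))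
    have hy : y ⟨0, hk0⟩ = 0 := by
      have := congrArg (fun z => star (g : Matrix (Fin n) (Fin n) ℍ[ℝ]) *ᵥ z) hx0
      simp only [x, Matrix.mulVec_mulVec, Unitary.coe_star_mul_self, Matrix.one_mulVec,
        Matrix.mulVec_zero] at this
      exact this
    have hyk := hsort ⟨0, hk0⟩ k (Fin.le_def.mpr (Nat.zero_le _)) hy
    simp only [x]; rw [hyk, Matrix.mulVec_zero]; exact map_zero _
  · have hre := congrArg Complex.re h1
    have him := congrArg Complex.im h1
    simp [hc0] at hre him
    exact Complex.ext hre him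

/-- A vector with isotropy group in the image of the embedding: it has the singular vectors `εₖ`
and, up to scalars, `ε₀` and `ε₁ + ε₀ j`. -/
theorem exists_isotropy_le_conjEmbedding (hn : 1 ≤ n) (hr1 : 1 ≤ r) (hr : r ≤ 2) (hrm : r ≤ m) :
    ∃ w : (Fin m → ℂ) ⊗[ℂ] HVec n, isotropy (repUSp m n) w ≤ (conjEmbedding r m n).range := by
  have hJ : quatJ ≠ 0 := fun h => by
    have := congrArg (fun q : ℍ[ℝ] => q.imJ) h
    simp at this
  have h01 : star (oddVec n 0) ⬝ᵥ oddVec n 1 = quatJ := by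
    simp [oddVec, dotProduct_add, star_unitVec_dotProduct_unitVec, show 0 < n by omega]
  have hJc : complexPart quatJ = 0 := Complex.ext rfl rfl
  obtain ⟨b, hb, -, hbf⟩ := exists_orthonormalFor_extension (quaternionCore n)
    finrank_complex_HVec (t := 2) (oddVec n)
    (fun k hk l hl hkl => by
      have h : (quaternionCore n).inner (oddVec n 0) (oddVec n 1) = 0 := by
        rw [quaternionCore_inner, h01, hJc]
      obtain ⟨rfl, rfl⟩ | ⟨rfl, rfl⟩ : k = 0 ∧ l = 1 ∨ k = 1 ∧ l = 0 := by omega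
      · exact h
      · rw [← (quaternionCore n).conj_inner_symm, h, map_zero])
    (fun k hk h => by
      interval_cases k
      · rw [h] at h01; exact hJ (by simpa using h01.symm)
      · rw [h] at h01; exact hJ (by simpa using h01.symm))
  let b' : Fin r → HVec n := fun i => b (Fin.castLE (by omega) i)
  have hb' : OrthonormalFor (quaternionCore n) b' := fun i j => by
    simp only [b']; rw [hb]; simp
  refine ⟨singularVector ℂ (fun i : Fin r => (Pi.single (Fin.castLE hrm i) 1 : Fin m → ℂ)) b',
    fun g hg => ?_⟩
  obtain ⟨s, hs1, hsa, hsb⟩ := exists_eigenvalues_of_mem_isotropy (complexCore m) (quaternionCore n)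
    isUnitaryFor_stdU isUnitaryFor_stdSp (orthonormalFor_single_complex hrm) hb' hg
  have hf : ∀ i : Fin r, (g.2 : Matrix (Fin n) (Fin n) ℍ[ℝ]) *ᵥ oddVec n i
      = star (s i) • oddVec n i := by
    intro i
    obtain ⟨c, -, hc⟩ := hbf (Fin.castLE (by omega) i) (by simp; omega)
    have hc' : oddVec n i = c • b' i := hc
    rw [← stdSp_apply, hc', map_smul, hsb, smul_comm]
  let z : U1 := ⟨star (s ⟨0, hr1⟩), Unitary.mem_iff.mpr
    ⟨by rw [star_star, mul_comm, hs1], by rw [star_star, hs1]⟩⟩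
  -- the two eigenvalues are inverse to each other
  have hs : ∀ i : Fin r, (i : ℕ) ≠ 0 → star (s i) = s ⟨0, hr1⟩ := by
    intro i hi
    have hi1 : (i : ℕ) = 1 := by have := i.2; omega
    have h1 := hf i
    rw [hi1] at h1
    have h2 := mul_eigenvalue_eq_one g.2.2 (hf ⟨0, hr1⟩) h1
      (by rw [h01, hJc]) (by rw [h01]; exact hJ)
    have h3 := hs1 ⟨0, hr1⟩
    linear_combination (s ⟨0, hr1⟩) * h2 - star (s i) * h3
  have hzinv : ((z⁻¹ : U1) : ℂ) = s ⟨0, hr1⟩ := star_star _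
  obtain ⟨A, hA⟩ := exists_eq_blockHom (g := g.1) (r := r) (conjDiagonal m z⁻¹) fun i hi => by
    have h1 := hsa ⟨i, hi⟩
    rw [stdU_apply] at h1
    have h2 : s ⟨i, hi⟩ = conjDiagonal m z⁻¹ i := by
      rw [conjDiagonal_apply]
      split_ifs with h0
      · rw [hzinv]; congr 1; exact Fin.ext h0
      · rw [inv_inv, ← star_star (s ⟨i, hi⟩), hs ⟨i, hi⟩ h0]
    rw [h2] at h1
    refine h1.trans ?_
    funext j
    by_cases hj : j = i
    · simp [hj]
    · simp [hj]
  have hg0 : (g.2 : Matrix (Fin n) (Fin n) ℍ[ℝ]) *ᵥ unitVec n 0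
      = MulOpposite.op (u1ToSp1 z : ℍ[ℝ]) • unitVec n 0 :=
    (hf ⟨0, hr1⟩).trans (complex_smul_eq_op_smul _ _)
  obtain ⟨B, hB⟩ := exists_eq_blockHom (g := g.2) (r := r)
    (fun i => u1ToSp1 (conjDiagonal n z i)) fun i hi => by
    have h2 : (g.2 : Matrix (Fin n) (Fin n) ℍ[ℝ]) *ᵥ unitVec n i
        = MulOpposite.op (u1ToSp1 (conjDiagonal n z i) : ℍ[ℝ]) • unitVec n i := by
      rw [conjDiagonal_apply]
      split_ifs with h0
      · rw [h0]; exact hg0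
      have hi1 : (i : ℕ) = 1 := by omega
      have h1 := hf ⟨1, by omega⟩
      change _ *ᵥ (unitVec n 1 + MulOpposite.op quatJ • unitVec n 0) = _ •
        (unitVec n 1 + MulOpposite.op quatJ • unitVec n 0) at h1
      rw [hs _ one_ne_zero, ← hzinv, complex_smul_eq_op_smul, Matrix.mulVec_add,
        Matrix.mulVec_smul, hg0, smul_add, smul_smul, smul_smul, ← MulOpposite.op_mul,
        ← MulOpposite.op_mul, ← coe_u1ToSp1] at h1
      have h3 : quatJ * (u1ToSp1 z⁻¹ : ℍ[ℝ]) = (u1ToSp1 z : ℍ[ℝ]) * quatJ := by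
        rw [coe_u1ToSp1_inv, coe_u1ToSp1]
        ext <;> simp
      rw [h3] at h1
      rw [hi1]
      exact add_right_cancel h1
    rw [← unitVec_coe, h2]
    funext j
    by_cases hj : j = i
    · simp [unitVec_apply, hj]
    · simp [unitVec_apply, hj, Fin.ext_iff.not.mp hj]
  exact ⟨(z, A, B), Prod.ext hA.symm hB.symm⟩

theorem repUSp_exceptional (hn : 1 ≤ n) (hr1 : 1 ≤ r) (hr : r ≤ 2) (hrm : r ≤ m)
    (hrmn : m ≤ r ∨ 2 * n ≤ r) (v : (Fin m → ℂ) ⊗[ℂ] HVec n) (hv : IsPrincipal (repUSp m n) v) :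
    Nonempty (isotropyZero (repUSp m n) v ≃ₜ* U1 × (U (m - r) × Sp (n - r))) := by
  obtain ⟨w, hw⟩ := exists_isotropy_le_conjEmbedding hn hr1 hr hrm
  exact (isotropyZero_equiv_of_comparison (X := Unit) (repUSp m n) (conjEmbedding r m n)
    continuous_conjEmbedding (conjEmbedding_injective hr1 hn)
    (exists_conj_conjEmbedding hr hrmn) w (fun _ => ())
    (fun g hg h hh _ => Subgroup.mul_mem _ (Subgroup.inv_mem _ (hw hg)) (hw hh)) v hv).2

end Exceptional

/-! ### The principal isotropy groups -/

section Trivial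

variable {k G V L : Type*} [CommSemiring k] [Group G] [AddCommMonoid V] [Module k V]
  [TopologicalSpace G] [IsTopologicalGroup G] [Group L] [TopologicalSpace L]

theorem isotropyZero_eq_bot [Subsingleton L] {ρ : Representation k G V} {v : V}
    (h : Nonempty (isotropyZero ρ v ≃ₜ* L)) : isotropyZero ρ v = ⊥ := by
  obtain ⟨e⟩ := h
  have := e.toEquiv.subsingleton
  exact Subgroup.eq_bot_of_subsingleton _

theorem subsingleton_SO {m : ℕ} (hm : m ≤ 1) : Subsingleton (SO m) := by
  refine ⟨fun A B => ?_⟩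
  have h : ∀ A : SO m, A = 1 := by
    intro A
    have hdet := (SO.mem_iff.mp A.2).2
    obtain rfl | rfl : m = 0 ∨ m = 1 := by omega
    · exact Subsingleton.elim _ _
    · rw [Matrix.det_fin_one] at hdet
      refine Subtype.ext (Matrix.ext fun i j => ?_)
      rw [Subsingleton.elim i 0, Subsingleton.elim j 0, hdet]
      rfl
  rw [h A, h B]

variable (A B C : Type*) [Group A] [TopologicalSpace A] [Group B] [TopologicalSpace B] [Group C]
  [TopologicalSpace C]

/-- A product does not change when a trivial group is omitted. -/
def prodProdEquivLeft [Subsingleton C] : A × (B × C) ≃ₜ* A × B where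
  toFun p := (p.1, p.2.1)
  invFun p := (p.1, (p.2, 1))
  left_inv _ := Prod.ext rfl (Prod.ext rfl (Subsingleton.elim _ _))
  right_inv _ := rfl
  map_mul' _ _ := rfl
  continuous_toFun := by fun_prop
  continuous_invFun := by fun_prop

/-- A product does not change when a trivial group is omitted. -/
def prodProdEquivRight [Subsingleton B] : A × (B × C) ≃ₜ* A × C where
  toFun p := (p.1, p.2.2)
  invFun p := (p.1, (1, p.2))
  left_inv _ := Prod.ext rfl (Prod.ext (Subsingleton.elim _ _) rfl)
  right_inv _ := rfl
  map_mul' _ _ := rfl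
  continuous_toFun := by fun_prop
  continuous_invFun := by fun_prop

/-- Any two trivial groups are isomorphic. -/
def equivOfSubsingleton [Subsingleton A] [Subsingleton B] : A ≃ₜ* B where
  toFun _ := 1
  invFun _ := 1
  left_inv _ := Subsingleton.elim _ _
  right_inv _ := Subsingleton.elim _ _
  map_mul' _ _ := Subsingleton.elim _ _
  continuous_toFun := continuous_const
  continuous_invFun := continuous_const

end Trivial

theorem mainTheorem3 :
    -- `(SO(m) × U(n), ℝᵐ ⊗_ℝ ℂⁿ)`
    (∀ m n : ℕ, 1 ≤ m → 1 ≤ n →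
      ∀ v : (Fin m → ℝ) ⊗[ℝ] (Fin n → ℂ), IsPrincipal (repSOU m n) v →
        (2 * n + 1 < m → Nonempty (isotropyZero (repSOU m n) v ≃ₜ* SO (m - 2 * n))) ∧
        (m < n → Nonempty (isotropyZero (repSOU m n) v ≃ₜ* U (n - m))) ∧
        (¬ 2 * n + 1 < m → ¬ m < n → isotropyZero (repSOU m n) v = ⊥)) ∧
    -- `(SO(m) × Sp(n), ℝᵐ ⊗_ℝ ℍⁿ)`
    (∀ m n : ℕ, 1 ≤ m → 1 ≤ n →
      ∀ v : (Fin m → ℝ) ⊗[ℝ] HVec n, IsPrincipal (repSOSp m n) v →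
        (4 * n + 1 < m → Nonempty (isotropyZero (repSOSp m n) v ≃ₜ* SO (m - 4 * n))) ∧
        (m < n → Nonempty (isotropyZero (repSOSp m n) v ≃ₜ* Sp (n - m))) ∧
        (¬ 4 * n + 1 < m → ¬ m < n → isotropyZero (repSOSp m n) v = ⊥)) ∧
    -- `(SO(m) × Sp(1)Sp(n), ℝᵐ ⊗_ℝ ℝ⁴ⁿ)`, `m ≥ 3`
    (∀ m n : ℕ, 3 ≤ m → 1 ≤ n →
      ∀ v : (Fin m → ℝ) ⊗[ℝ] HVec n, IsPrincipal (repSOSp1Sp m n) v →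
        (4 * n + 1 < m → Nonempty (isotropyZero (repSOSp1Sp m n) v ≃ₜ* SO (m - 4 * n))) ∧
        (m < n → Nonempty (isotropyZero (repSOSp1Sp m n) v ≃ₜ* Sp (n - m))) ∧
        (¬ 4 * n + 1 < m → ¬ m < n → isotropyZero (repSOSp1Sp m n) v = ⊥)) ∧
    -- `(SO(2) × Sp(1)Sp(n), ℝ² ⊗_ℝ ℝ⁴ⁿ)`: `H⁰ = {1} × U(1)Sp(n - 2)`
    (∀ n : ℕ, 2 ≤ n →
      ∀ v : (Fin 2 → ℝ) ⊗[ℝ] HVec n, IsPrincipal (repSOSp1Sp 2 n) v →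
        (∀ h ∈ isotropyZero (repSOSp1Sp 2 n) v, (h : SO 2 × Sp1Sp n).1 = 1) ∧
        Nonempty (isotropyZero (repSOSp1Sp 2 n) v ≃ₜ* U1Sp (n - 2))) ∧
    -- `(SO(m) × U(1)Sp(n), ℝᵐ ⊗_ℝ ℂ²ⁿ)`
    (∀ m n : ℕ, 2 ≤ m → 1 ≤ n →
      ∀ v : (Fin m → ℝ) ⊗[ℝ] HVec n, IsPrincipal (repSOU1Sp m n) v →
        (4 * n < m → Nonempty (isotropyZero (repSOU1Sp m n) v ≃ₜ* SO (m - 4 * n))) ∧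
        (m ≤ n → Nonempty (isotropyZero (repSOU1Sp m n) v ≃ₜ* Sp (n - m))) ∧
        (¬ 4 * n < m → ¬ m ≤ n → isotropyZero (repSOU1Sp m n) v = ⊥)) ∧
    -- `(U(m) × Sp(1)Sp(n), ℂᵐ ⊗_ℝ ℝ⁴ⁿ)`
    (∀ m n : ℕ, 2 ≤ m → 2 ≤ n →
      ∀ v : (Fin m → ℂ) ⊗[ℝ] HVec n, IsPrincipal (repUSp1Sp m n) v →
        (4 * n ≤ m → Nonempty (isotropyZero (repUSp1Sp m n) v ≃ₜ* U (m - 4 * n))) ∧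
        (2 * m ≤ n → Nonempty (isotropyZero (repUSp1Sp m n) v ≃ₜ* Sp (n - 2 * m))) ∧
        (¬ 4 * n ≤ m → ¬ 2 * m ≤ n → isotropyZero (repUSp1Sp m n) v = ⊥)) ∧
    -- `(Sp(1)Sp(m) × Sp(1)Sp(n), ℝ⁴ᵐ ⊗_ℝ ℝ⁴ⁿ)`, `m ≥ n`
    (∀ m n : ℕ, 1 ≤ n → n ≤ m →
      ∀ v : HVec m ⊗[ℝ] HVec n, IsPrincipal (repSp1SpSp1Sp m n) v →
        (4 * n < m → Nonempty (isotropyZero (repSp1SpSp1Sp m n) v ≃ₜ* Sp (m - 4 * n))) ∧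
        (¬ 4 * n < m → isotropyZero (repSp1SpSp1Sp m n) v = ⊥)) ∧
    -- `(U(m) × Sp(n), ℂᵐ ⊗_ℂ ℍⁿ)`; the four cases are exhaustive, and `U(m - 2n) = 1` if `m ≤ 2n`
    (∀ m n : ℕ, 1 ≤ m → 1 ≤ n →
      ∀ v : (Fin m → ℂ) ⊗[ℂ] HVec n, IsPrincipal (repUSp m n) v →
        (2 ≤ n → n + 1 ≤ m → Nonempty (isotropyZero (repUSp m n) v ≃ₜ* U (m - 2 * n))) ∧
        (3 ≤ m → m ≤ n → Nonempty (isotropyZero (repUSp m n) v ≃ₜ* Sp (n - m))) ∧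
        (2 ≤ m → n = 1 → Nonempty (isotropyZero (repUSp m n) v ≃ₜ* U1 × U (m - 2))) ∧
        (m ≤ 2 → m ≤ n → Nonempty (isotropyZero (repUSp m n) v ≃ₜ* U1 × Sp (n - m)))) ∧
    -- `(Sp(m) × U(1)Sp(n), ℍᵐ ⊗_ℂ ℂ²ⁿ)`, `m ≥ n ≥ 2`
    (∀ m n : ℕ, 2 ≤ n → n ≤ m →
      ∀ v : HVec m ⊗[ℂ] HVec n, IsPrincipal (repSpU1Sp m n) v →
        (2 * n < m → Nonempty (isotropyZero (repSpU1Sp m n) v ≃ₜ* Sp (m - 2 * n))) ∧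
        (¬ 2 * n < m → isotropyZero (repSpU1Sp m n) v = ⊥)) := by
  have hSO0 : ∀ {k : ℕ}, k ≤ 1 → Subsingleton (SO k) := fun h => subsingleton_SO h
  have hsub : ∀ {k : ℕ}, k ≤ 0 → Subsingleton (U k) ∧ Subsingleton (Sp k) := by
    intro k hk
    obtain rfl : k = 0 := Nat.le_zero.mp hk
    exact ⟨inferInstance, inferInstance⟩
  refine ⟨?_, ?_, ?_, ?_, ?_, ?_, ?_, ?_, ?_⟩
  · intro m n _ _ v hv
    refine ⟨fun h => repSOU_of_le (by omega) v hv, fun h => repSOU_of_ge (by omega) v hv,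
      fun h1 h2 => ?_⟩
    rcases le_total (2 * n) m with h | h
    · have := hSO0 (k := m - 2 * n) (by omega)
      exact isotropyZero_eq_bot (repSOU_of_le h v hv)
    · have := (hsub (k := n - m) (by omega)).1
      exact isotropyZero_eq_bot (repSOU_of_ge h v hv)
  · intro m n hm hn v hv
    refine ⟨fun h => repSOSp_of_le hn (by omega) v hv,
      fun h => repSOSp_of_ge hm hn (by omega) v hv, fun h1 h2 => ?_⟩
    rcases le_total (4 * n) m with h | h
    · have := hSO0 (k := m - 4 * n) (by omega)
      exact isotropyZero_eq_bot (repSOSp_of_le hn h v hv)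
    · have := (hsub (k := n - m) (by omega)).2
      exact isotropyZero_eq_bot (repSOSp_of_ge hm hn h v hv)
  · intro m n hm hn v hv
    refine ⟨fun h => repSOSp1Sp_of_le hn (by omega) v hv,
      fun h => repSOSp1Sp_of_ge hm hn (by omega) v hv, fun h1 h2 => ?_⟩
    rcases le_total (4 * n) m with h | h
    · have := hSO0 (k := m - 4 * n) (by omega)
      exact isotropyZero_eq_bot (repSOSp1Sp_of_le hn h v hv)
    · have := (hsub (k := n - m) (by omega)).2
      exact isotropyZero_eq_bot (repSOSp1Sp_of_ge hm hn h v hv)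
  · exact fun n hn v hv => repSOSp1Sp_two hn v hv
  · intro m n hm hn v hv
    refine ⟨fun h => repSOU1Sp_of_le hn (by omega) v hv,
      fun h => repSOU1Sp_of_ge hm hn (by omega) v hv, fun h1 h2 => ?_⟩
    have := (hsub (k := n - m) (by omega)).2
    exact isotropyZero_eq_bot (repSOU1Sp_of_ge hm hn (by omega) v hv)
  · intro m n hm hn v hv
    refine ⟨fun h => repUSp1Sp_of_le (by omega) (by omega) v hv,
      fun h => repUSp1Sp_of_ge hm (by omega) (by omega) v hv, fun h1 h2 => ?_⟩
    rcases le_total (4 * n) (2 * m) with h | h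
    · have := (hsub (k := m - 4 * n) (by omega)).1
      exact isotropyZero_eq_bot (repUSp1Sp_of_le (by omega) h v hv)
    · have := (hsub (k := n - 2 * m) (by omega)).2
      exact isotropyZero_eq_bot (repUSp1Sp_of_ge hm (by omega) h v hv)
  · intro m n hn hnm v hv
    refine ⟨fun h => repSp1SpSp1Sp_of_le hn hnm v hv, fun h => ?_⟩
    have := (hsub (k := m - 4 * n) (by omega)).2
    exact isotropyZero_eq_bot (repSp1SpSp1Sp_of_le hn hnm v hv)
  · intro m n hm hn v hv
    refine ⟨fun h2 hnm => ?_, fun h3 hmn => repUSp_of_ge h3 (by omega) (by omega) v hv,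
      fun h2 h1 => ?_, fun h2 hmn => ?_⟩
    · rcases le_total (2 * n) m with h | h
      · exact repUSp_of_le h2 h v hv
      · have := (hsub (k := m - 2 * n) (by omega)).1
        have := (hsub (k := n - m) (by omega)).2
        obtain ⟨e⟩ := repUSp_of_ge (by omega) h2 h v hv
        exact ⟨e.trans (equivOfSubsingleton _ _)⟩
    · have := (hsub (k := n - 2) (by omega)).2
      obtain ⟨e⟩ := repUSp_exceptional hn one_le_two le_rfl h2 (Or.inr (by omega)) v hv
      exact ⟨e.trans (prodProdEquivLeft _ _ _)⟩
    · have := (hsub (k := m - m) (by omega)).1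
      obtain ⟨e⟩ := repUSp_exceptional hn hm h2 le_rfl (Or.inl le_rfl) v hv
      exact ⟨e.trans (prodProdEquivRight _ _ _)⟩
  · intro m n hn hnm v hv
    refine ⟨fun h => repSpU1Sp_of_le hn hnm v hv, fun h => ?_⟩
    have := (hsub (k := m - 2 * n) (by omega)).2
    exact isotropyZero_eq_bot (repSpU1Sp_of_le hn hnm v hv)
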